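/- Let $\mathcal X\subset\mathbb R^d$ and let $x_1,\dots,x_n\in\mathcal X$ be pairwise distinct design points ($n\ge 0$). For $\sigma^2>0$ and $\phi=(\phi_1,\dots,\phi_d)$ with all $\phi_k>0$, put $\Sigma_0(x,x')=\sigma^2\exp\bigl(-\sum_{k=1}^d\phi_k(x^{(k)}-x'^{(k)})^2\bigr)$ and $G_0=\mathcal{GP}(0,\Sigma_0)$, a Gaussian process over $\mathcal X$. **The $\infty$-GP model.** The hyperparameters are $\Theta=(\Theta^{(1)},\Theta^{(2)})$ with $\Theta^{(1)}=(\beta,\tau^2)$ and $\Theta^{(2)}=(\nu,\sigma^2,\phi)$. A priori $\beta\sim N(\beta_0,\Sigma_\beta)$ on $\mathbb R^d$ ($\Sigma_\beta$ positive semidefinite), $\tau^2\sim\mathrm{IGamma}(a_\tau,b_\tau)$, $\sigma^2\sim\mathrm{IGamma}(a_\sigma,b_\sigma)$, $\phi\sim U((0,b_\phi]^d)$ and $\nu\sim\mathrm{Gamma}(a_\nu,b_\nu)$ (shape and rate), independently, with all of $a_\tau,b_\tau,a_\sigma,b_\sigma,b_\phi,a_\nu,b_\nu$ positive. Given $\Theta$,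 the sticks $V_1,V_2,\dots$ are i.i.d. $\mathrm{Beta}(1,\nu)$ and, independently of them, the surfaces of a sequence $(\eta^{(l)})_{l\ge1}$ over $\mathcal X$ are i.i.d. with law $G_0$; put $w_l=V_l\prod_{r<l}(1-V_r)$. Given all this, the indices $c_1,c_2,\dots$ are i.i.d. with $P(c_i=l)=w_l$, so that $\eta^{(c_i)}(x)$ is a draw from $G_x=\sum_l w_l\delta_{\eta^{(l)}(x)}$. Given all this, the noise variables $\epsilon_1,\epsilon_2,\dots$ are i.i.d. $N(0,\tau^2)$. The $i$-th observation, taken at a point $x\in\mathcal X$, is $y(x)=\beta^\top x+\eta^{(c_i)}(x)+\epsilon_i$. Number the surfaces realized by the observations as $\xi^{(1)},\xi^{(2)},\dots$ in order of first appearance, and let $z_i$ be the number of the surface of the $i$-th observation, so $\xi^{(z_i)}=\eta^{(c_i)}$. Let $K_n$ be the number of surfaces realized by the first $n$ observations, $n_j=\#\{i\le n: z_i=j\}$, $\bm\xi_{1:n}(x_{1:n})=(\xi^{(j)}(x_i))_{j\le K_n,\,i\le n}$ and $\bm z_{1:n}=(z_1,\dots,z_n)$. Let $\mathcal H_n=\{(x_i,y(x_i))\}_{i\le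 n}$ be the data, and write $[Y\mid X]$ for the regular conditional distribution of $Y$ given $X$ (identities between such distributions hold almost surely). **Proposition.** Let $x_{n+1}\in\mathcal X$ be any further point, at which the $(n+1)$-st observation is taken. Then $$[y(x_{n+1})\mid\mathcal H_n]=\int A\;[\Theta^{(1)},\xi^{(z_{n+1})}(x_{n+1})\mid\mathcal H_n]=\int\!\!\int A\; B\; C,$$ and in particular $[\Theta^{(1)},\xi^{(z_{n+1})}(x_{n+1})\mid\mathcal H_n]=\int B\;C$ (with $\Theta^{(2)},\bm\xi_{1:n}(x_{1:n}),\bm z_{1:n}$ integrated out), where * $A=[y(x_{n+1})\mid\Theta^{(1)},\xi^{(z_{n+1})}(x_{n+1})]=N\bigl(x_{n+1}^\top\beta+\xi^{(z_{n+1})}(x_{n+1}),\,\tau^2\bigr)$; * $B=[\xi^{(z_{n+1})}(x_{n+1})\mid\bm\xi_{1:n}(x_{1:n}),\bm z_{1:n},\Theta^{(2)}]=\frac{\nu}{\nu+n}N(0,\sigma^2)+\sum_{j=1}^{K_n}\frac{n_j}{\nu+n}N\bigl(\mu_n^{(j)}(x_{n+1}),\sigma_n^2(x_{n+1})\bigr)$,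 with $\mu_n^{(j)}(x)=\Sigma_0(x,x_{1:n})\Sigma_0(x_{1:n},x_{1:n})^{-1}\xi^{(j)}(x_{1:n})$ and $\sigma_n^2(x)=\sigma^2-\Sigma_0(x,x_{1:n})\Sigma_0(x_{1:n},x_{1:n})^{-1}\Sigma_0(x_{1:n},x)$; * $C=[\Theta,\bm\xi_{1:n}(x_{1:n}),\bm z_{1:n}\mid\mathcal H_n]$ is the joint posterior of the hyperparameters and the latent variables. Term $B$ also holds for the new surface as a process over $\mathcal X$: given $\bm\xi_{1:n}(x_{1:n}),\bm z_{1:n},\Theta^{(2)}$, with probability $\frac{\nu}{\nu+n}$ one has $z_{n+1}=K_n+1$ and the surface $\xi^{(z_{n+1})}$ follows $G_0$, and with probability $\frac{n_j}{\nu+n}$ one has $z_{n+1}=j$ and the surface follows the Gaussian process with mean function $\mu_n^{(j)}$ and covariance function $\Sigma_0(x,x')-\Sigma_0(x,x_{1:n})\Sigma_0(x_{1:n},x_{1:n})^{-1}\Sigma_0(x_{1:n},x')$ ($j\le K_n$), in the sense of the joint law of $z_{n+1}$ and the values at any finitely many points; and the posterior of $\Theta^{(1)}$, $z_{n+1}$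 and these values given $\mathcal H_n$ is the integral of this law against $C$. -/

import Mathlib

open MeasureTheory ProbabilityTheory

noncomputable section

namespace InfiniteGP

/-! ### Parameters and priors -/

/-- First-layer hyperparameters `Θ⁽¹⁾ = (β, τ²)`. -/
abbrev FirstLayer (d : ℕ) : Type := EuclideanSpace ℝ (Fin d) × ℝ

/-- Second-layer hyperparameters `Θ⁽²⁾ = (ν, σ², φ)`. -/
abbrev SecondLayer (d : ℕ) : Type := ℝ × ℝ × (Fin d → ℝ)

/-- The concentration parameter `ν`. -/
def SecondLayer.nu {d : ℕ} (θ : SecondLayer d) : ℝ := θ.1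

/-- The variance `σ²` of the baseline Gaussian process. -/
def SecondLayer.sigmaSq {d : ℕ} (θ : SecondLayer d) : ℝ := θ.2.1

/-- The length-scale parameters `φ = (φ₁, …, φ_d)`. -/
def SecondLayer.phi {d : ℕ} (θ : SecondLayer d) : Fin d → ℝ := θ.2.2

instance instStandardBorelSpaceHyper (d : ℕ) :
    StandardBorelSpace (FirstLayer d × SecondLayer d) := inferInstance

/-- Constants of the hyperprior. -/
structure HyperPrior (d : ℕ) where
  beta0 : EuclideanSpace ℝ (Fin d)
  SigmaBeta : Matrix (Fin d) (Fin d) ℝ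
  posSemidef_SigmaBeta : SigmaBeta.PosSemidef
  (aTau bTau aSigma bSigma aNu bNu bPhi : ℝ)
  aTau_pos : 0 < aTau
  bTau_pos : 0 < bTau
  aSigma_pos : 0 < aSigma
  bSigma_pos : 0 < bSigma
  aNu_pos : 0 < aNu
  bNu_pos : 0 < bNu
  bPhi_pos : 0 < bPhi

/-- Inverse-Gamma distribution with shape `a` and scale `b`: the law of `1 / X` where `X` has the
Gamma distribution with shape `a` and rate `b`. -/
def inverseGammaMeasure (a b : ℝ) : Measure ℝ := (gammaMeasure a b).map (fun t => t⁻¹)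

/-- Uniform distribution on the cube `(0, b]^d`. -/
def uniformCube (d : ℕ) (b : ℝ) : Measure (Fin d → ℝ) :=
  ProbabilityTheory.cond volume (Set.univ.pi fun _ => Set.Ioc 0 b)

/-- The prior of `Θ⁽¹⁾`: `β ∼ N(β₀, Σ_β)` and `τ² ∼ IGamma(a_τ, b_τ)`, independent. -/
def HyperPrior.first {d : ℕ} (h : HyperPrior d) : Measure (FirstLayer d) :=
  (multivariateGaussian h.beta0 h.SigmaBeta).prod (inverseGammaMeasure h.aTau h.bTau)

/-- The prior of `Θ⁽²⁾`: `ν ∼ Gamma(a_ν, b_ν)`, `σ² ∼ IGamma(a_σ, b_σ)`, `φ ∼ U((0, b_φ]^d)`,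
independent. -/
def HyperPrior.second {d : ℕ} (h : HyperPrior d) : Measure (SecondLayer d) :=
  (gammaMeasure h.aNu h.bNu).prod
    ((inverseGammaMeasure h.aSigma h.bSigma).prod (uniformCube d h.bPhi))

/-! ### The baseline Gaussian process and kriging -/

section Kriging

variable {d m n : ℕ} {S : Set (EuclideanSpace ℝ (Fin d))}

/-- Covariance function `Σ₀(p, q) = σ² exp(-∑ₖ φₖ (p⁽ᵏ⁾ - q⁽ᵏ⁾)²)` of the baseline process. -/
def baseCov (θ : SecondLayer d) (p q : S) : ℝ :=
  θ.sigmaSq * Real.exp (-∑ k, θ.phi k * (p.1 k - q.1 k) ^ 2)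

/-- Covariance matrix `Σ₀(p_{1:m}, p_{1:m})`. -/
def gram (θ : SecondLayer d) (p : Fin m → S) : Matrix (Fin m) (Fin m) ℝ :=
  Matrix.of fun a b => baseCov θ (p a) (p b)

/-- The marginal at `p₁, …, p_m` of the baseline `G₀ = GP(0, σ² ρ_φ)`. -/
def baseGP (θ : SecondLayer d) (p : Fin m → S) : Measure (EuclideanSpace ℝ (Fin m)) :=
  multivariateGaussian 0 (gram θ p)

/-- The vector `Σ₀(p, x_{1:n})`. -/
def crossCov (θ : SecondLayer d) (x : Fin n → S) (p : S) : Fin n → ℝ :=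
  fun i => baseCov θ p (x i)

/-- Kriging mean `Σ₀(p, x_{1:n}) Σ₀(x_{1:n}, x_{1:n})⁻¹ v`, where `v` is the vector of the values
of a surface at `x_{1:n}`. -/
def krigMean (θ : SecondLayer d) (x : Fin n → S) (v : Fin n → ℝ) (p : S) : ℝ :=
  crossCov θ x p ⬝ᵥ ((gram θ x)⁻¹.mulVec v)

/-- Kriging covariance `Σ₀(p, q) - Σ₀(p, x_{1:n}) Σ₀(x_{1:n}, x_{1:n})⁻¹ Σ₀(x_{1:n}, q)`. -/
def krigCov (θ : SecondLayer d) (x : Fin n → S) (p q : S) : ℝ :=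
  baseCov θ p q - crossCov θ x p ⬝ᵥ ((gram θ x)⁻¹.mulVec (crossCov θ x q))

/-- Kriging variance `σ_n²(p) = σ² - Σ₀(p, x_{1:n}) Σ₀(x_{1:n}, x_{1:n})⁻¹ Σ₀(x_{1:n}, p)`. -/
def krigVar (θ : SecondLayer d) (x : Fin n → S) (p : S) : ℝ :=
  θ.sigmaSq - crossCov θ x p ⬝ᵥ ((gram θ x)⁻¹.mulVec (crossCov θ x p))

/-- The marginal at `p₁, …, p_m` of the kriging process `GP(μ_n, σ_n²)` given the values `v` of a
surface at `x_{1:n}`. -/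
def krigGP (θ : SecondLayer d) (x : Fin n → S) (v : Fin n → ℝ) (p : Fin m → S) :
    Measure (EuclideanSpace ℝ (Fin m)) :=
  multivariateGaussian (WithLp.toLp 2 fun a => krigMean θ x v (p a))
    (Matrix.of fun a b => krigCov θ x (p a) (p b))

end Kriging

/-! ### Stick-breaking, and surface assignments in order of appearance -/

/-- Stick-breaking weight `w_l = V_l ∏_{r < l} (1 - V_r)` (sticks are numbered from `0`). -/
def stickWeight (v : ℕ → ℝ) (l : ℕ) : ℝ := v l * ∏ r ∈ Finset.range l, (1 - v r)

/-- The distribution `∑_l w_l δ_l` on the indices of the surfaces. -/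
def stickMeasure (v : ℕ → ℝ) : Measure ℕ :=
  Measure.sum fun l => ENNReal.ofReal (stickWeight v l) • Measure.dirac l

/-- The distinct values among `c 0, …, c (n - 1)`, listed in order of first appearance. -/
def appearance (c : ℕ → ℕ) : ℕ → List ℕ
  | 0 => []
  | n + 1 => if c n ∈ appearance c n then appearance c n else appearance c n ++ [c n]

/-- The rank, counted from `0`, of the value `c i` in the order of first appearance. -/
def appearanceLabel (c : ℕ → ℕ) (i : ℕ) : ℕ := (appearance c (i + 1)).idxOf (c i)

/-- `K_n`: the number of distinct surfaces in the assignments `z_{1:n}`. -/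
def numSurfaces {n : ℕ} (z : Fin n → ℕ) : ℕ := (Finset.univ.image z).card

/-- `n_j = #{i : z_i = j}`. -/
def surfaceCount {n : ℕ} (z : Fin n → ℕ) (j : ℕ) : ℕ := (Finset.univ.filter fun i => z i = j).card

/-! ### The model -/

/-- Random variables that follow the `∞`-GP model over the decision space `S`: sequential sampling
from a spatial Dirichlet process with baseline `GP(0, σ² ρ_φ)`, Gaussian noise and hyperpriors.
The `i`-th latent value is drawn from `G_{x_i} = ∑_l w_l δ_{ξ^{(l)}(x_i)}`, which is done by drawing
the index `l` of the surface (`stickIndex i`) with probabilities `w_l`. -/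
structure Model {d : ℕ} (h : HyperPrior d) (S : Set (EuclideanSpace ℝ (Fin d)))
    {Ω : Type*} [MeasurableSpace Ω] (P : Measure Ω) [IsProbabilityMeasure P] where
  /-- `Θ⁽¹⁾ = (β, τ²)` -/
  first : Ω → FirstLayer d
  /-- `Θ⁽²⁾ = (ν, σ², φ)` -/
  second : Ω → SecondLayer d
  /-- the sticks `V_r` -/
  stick : ℕ → Ω → ℝ
  /-- the surfaces `ξ^{(l)}` -/
  surface : ℕ → S → Ω → ℝ
  /-- the index of the surface on which the `i`-th observation is realized -/
  stickIndex : ℕ → Ω → ℕ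
  /-- the noise `ε_i` -/
  noise : ℕ → Ω → ℝ
  measurable_first : Measurable first
  measurable_second : Measurable second
  measurable_stick : ∀ r, Measurable (stick r)
  measurable_surface : ∀ l p, Measurable (surface l p)
  measurable_stickIndex : ∀ i, Measurable (stickIndex i)
  measurable_noise : ∀ i, Measurable (noise i)
  /-- The hyperparameters follow their prior. -/
  law_hyper : P.map (fun ω => (first ω, second ω)) = h.first.prod h.second
  /-- Given the hyperparameters, the sticks are i.i.d. `Beta(1, ν)`, the surfaces are i.i.d.
  `GP(0, σ² ρ_φ)`, and the sticks are independent of the surfaces. -/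
  law_stick_surface : ∀ (L m : ℕ) (p : Fin m → S),
    ∀ᵐ θ ∂(P.map fun ω => (first ω, second ω)),
      condDistrib
        (fun ω => ((fun r : Fin L => stick r ω),
          (fun l : Fin L => (WithLp.toLp 2 fun a => surface l (p a) ω : EuclideanSpace ℝ (Fin m)))))
        (fun ω => (first ω, second ω)) P θ
      = (Measure.pi fun _ : Fin L => betaMeasure 1 θ.2.nu).prod
          (Measure.pi fun _ : Fin L => baseGP θ.2 p)
  /-- Given the hyperparameters, sticks and surfaces, the indices are i.i.d. with probabilities
  `w_l`. -/
  law_stickIndex : ∀ m : ℕ,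
    ∀ᵐ c ∂(P.map fun ω => ((first ω, second ω), (fun r => stick r ω), fun l p => surface l p ω)),
      condDistrib (fun ω => fun i : Fin m => stickIndex i ω)
        (fun ω => ((first ω, second ω), (fun r => stick r ω), fun l p => surface l p ω)) P c
      = Measure.pi fun _ : Fin m => stickMeasure c.2.1
  /-- Given everything else, the noise variables are i.i.d. `N(0, τ²)`. -/
  law_noise : ∀ m : ℕ,
    ∀ᵐ c ∂(P.map fun ω => ((first ω, second ω), (fun r => stick r ω), (fun l p => surface l p ω),
        fun i => stickIndex i ω)),
      condDistrib (fun ω => fun i : Fin m => noise i ω)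
        (fun ω => ((first ω, second ω), (fun r => stick r ω), (fun l p => surface l p ω),
          fun i => stickIndex i ω)) P c
      = Measure.pi fun _ : Fin m => gaussianReal 0 c.1.1.2.toNNReal

namespace Model

variable {d : ℕ} {h : HyperPrior d} {S : Set (EuclideanSpace ℝ (Fin d))}
  {Ω : Type*} [MeasurableSpace Ω] {P : Measure Ω} [IsProbabilityMeasure P]

/-- The latent value at the point `p` on the surface assigned to the `i`-th observation (counted
from `0`), that is `ξ^{(z_i)}(p)`. -/
def latent (M : Model h S P) (i : ℕ) (p : S) (ω : Ω) : ℝ := M.surface (M.stickIndex i ω) p ω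

/-- The `i`-th observation when it is taken at the point `p`: `βᵀp + ξ^{(z_i)}(p) + ε_i`. -/
def obs (M : Model h S P) (i : ℕ) (p : S) (ω : Ω) : ℝ :=
  inner ℝ (M.first ω).1 p.1 + M.latent i p ω + M.noise i ω

/-- The data `H_n = ((x_1, y(x_1)), …, (x_n, y(x_n)))`. -/
def data {n : ℕ} (M : Model h S P) (x : Fin n → S) (ω : Ω) : Fin n → S × ℝ :=
  fun i => (x i, M.obs i (x i) ω)

/-- The surface assignment of the `i`-th observation, where the realized surfaces are numbered
`0, 1, 2, …` in order of first appearance. -/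
def assignment (M : Model h S P) (i : ℕ) (ω : Ω) : ℕ := appearanceLabel (fun k => M.stickIndex k ω) i

/-- The surface assignments `z_{1:n}`. -/
def assignments (M : Model h S P) (n : ℕ) (ω : Ω) : Fin n → ℕ := fun i => M.assignment i ω

/-- The table `ξ_{1:n}(x_{1:n}) = (ξ^{(j)}(x_i))`, whose `j`-th row holds the values at
`x_1, …, x_n` of the `j`-th realized surface; the rows `j ≥ K_n` are unused and filled with zeros. -/
def table {n : ℕ} (M : Model h S P) (x : Fin n → S) (ω : Ω) : Fin n → Fin n → ℝ :=
  fun j i => ((appearance (fun k => M.stickIndex k ω) n)[(j : ℕ)]?).elim 0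
    fun l => M.surface l (x i) ω

end Model

/-! ### The finite Gaussian process mixture -/

section Mixture

variable {d m n : ℕ} {S : Set (EuclideanSpace ℝ (Fin d))}

/-- The mixture `ν/(ν+n) N(0, σ²) + ∑_{j < K_n} n_j/(ν+n) N(μ_n^{(j)}(p), σ_n²(p))`: the finite
Gaussian process mixture evaluated at `p`. Here `t` is the table of the values of the realized
surfaces and `z` the vector of surface assignments. -/
def gpMixture (θ : SecondLayer d) (x : Fin n → S) (t : Fin n → Fin n → ℝ) (z : Fin n → ℕ)
    (p : S) : Measure ℝ :=
  ENNReal.ofReal (θ.nu / (θ.nu + n)) • gaussianReal 0 θ.sigmaSq.toNNReal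
    + ∑ j ∈ Finset.univ.filter (fun j : Fin n => (j : ℕ) < numSurfaces z),
        ENNReal.ofReal (surfaceCount z j / (θ.nu + n)) •
          gaussianReal (krigMean θ x (t j) p) (krigVar θ x p).toNNReal

/-- The urn scheme followed by kriging at `p₁, …, p_m`: with probability `ν/(ν+n)` the new surface
(number `K_n`), drawn from `G₀`; with probability `n_j/(ν+n)` the realized surface `j`, which
follows `GP(μ_n^{(j)}, σ_n²)`. A measure on pairs (surface number, values at `p₁, …, p_m`). -/
def urnKriging (θ : SecondLayer d) (x : Fin n → S) (t : Fin n → Fin n → ℝ) (z : Fin n → ℕ)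
    (p : Fin m → S) : Measure (ℕ × EuclideanSpace ℝ (Fin m)) :=
  ENNReal.ofReal (θ.nu / (θ.nu + n)) • (Measure.dirac (numSurfaces z)).prod (baseGP θ p)
    + ∑ j ∈ Finset.univ.filter (fun j : Fin n => (j : ℕ) < numSurfaces z),
        ENNReal.ofReal (surfaceCount z j / (θ.nu + n)) •
          (Measure.dirac (j : ℕ)).prod (krigGP θ x (t j) p)

end Mixture

end InfiniteGP

end

noncomputable section

namespace InfiniteGP

/-! ### Measurability of Gaussian measures in their parameters -/

/-! The core is a single law: given the hyperparameters, the table of realized surface values and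
the assignments, the next label and the next surface jointly follow `urnKriging`
(`Model.condLaw_urnKriging`). Two mechanisms produce it, independent of each other given the
hyperparameters.

Labels. A word with K letters in order of appearance occurs exactly when its letters sit on K
distinct sticks, given by an injection a. Given the sticks, this has a product probability, and
integrating the independent Beta(1, ν) sticks turns it into a product of Beta moments. Summing over
all a gives ν^K ∏ Γ(m_j) Γ(ν) / Γ(ν + N) (`tsum_stickProb`). The series is not evaluated directly:
splitting by the class on the first stick yields a recursion which the closed form also satisfies;
induction on the truncation bounds the series by the closed form, and finiteness then allows the
recursion to be solved for it. Appending one letter multiplies the closed form by n_j/(ν+n) or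
ν/(ν+n).

Surfaces. Whatever a is, the K surfaces on its sticks are independent draws of the baseline process.
A realized surface is therefore predicted by Gaussian conditioning on its own row of the table, and
a new surface, which has no row, keeps the baseline law. Conditioning is proved with characteristic
functions by completing the square; it needs an invertible Gram matrix at distinct points, that is,
strict positive definiteness of the Gaussian kernel (a Fourier integral together with independence
of characters).

Data. Given everything else, the noise depends on τ² only, and the data are a function of the latent
variables and the noise. Hence the data add nothing to the latent variables when the next surface is
predicted (`CondLaw.add_noise`), and nothing to Θ⁽¹⁾ and the latent value when the next observation
is predicted. `CondLaw.posterior` turns such conditional independence into an integral against the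
posterior. Conditional laws are handled through test functions (`CondLaw`) and become statements on
`condDistrib` by uniqueness of disintegrations. -/

open scoped MatrixOrder in
theorem isClosed_setOf_nonneg_matrix (m : ℕ) :
    IsClosed {a : Matrix (Fin m) (Fin m) ℝ | 0 ≤ a} := by
  simp only [Matrix.nonneg_iff_posSemidef, Matrix.posSemidef_iff_dotProduct_mulVec, Set.ofPred_and,
    Set.ofPred_forall]
  refine IsClosed.inter ?_ (isClosed_iInter fun x => ?_)
  · exact isClosed_eq (by fun_prop) continuous_id
  · exact isClosed_le continuous_const (by fun_prop)

-- The square root is continuous on the closed cone of positive semidefinite matrices and takes the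
-- default value 0 off it, so it is measurable on all matrices without any assumption on the
-- parameters.
open scoped MatrixOrder Matrix.Norms.L2Operator in
theorem measurable_sqrt_of_fun {m : ℕ} :
    Measurable (fun (a : Fin m → Fin m → ℝ) (i j : Fin m) =>
      CFC.sqrt (Matrix.of a : Matrix (Fin m) (Fin m) ℝ) i j) := by
  classical
  have hcl : IsClosed {a : Fin m → Fin m → ℝ | 0 ≤ (Matrix.of a : Matrix (Fin m) (Fin m) ℝ)} :=
    isClosed_setOf_nonneg_matrix m
  have hc : ContinuousOn (fun (a : Fin m → Fin m → ℝ) (i j : Fin m) =>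
      CFC.sqrt (Matrix.of a : Matrix (Fin m) (Fin m) ℝ) i j)
      {a | 0 ≤ (Matrix.of a : Matrix (Fin m) (Fin m) ℝ)} :=
    CFC.continuousOn_sqrt (A := Matrix (Fin m) (Fin m) ℝ)
  have := hc.measurable_piecewise (g := fun _ => 0) continuousOn_const hcl.measurableSet
  convert this using 1
  ext a i j
  by_cases ha : 0 ≤ (Matrix.of a : Matrix (Fin m) (Fin m) ℝ)
  · rw [Set.piecewise_eq_of_mem _ _ _
      (show a ∈ {a | 0 ≤ (Matrix.of a : Matrix (Fin m) (Fin m) ℝ)} from ha)]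
  · rw [Set.piecewise_eq_of_notMem _ _ _
      (show a ∉ {a | 0 ≤ (Matrix.of a : Matrix (Fin m) (Fin m) ℝ)} from ha),
      CFC.sqrt_of_not_nonneg ha]
    rfl

open scoped MatrixOrder in
theorem measurable_sqrt_apply {γ : Type*} [MeasurableSpace γ] {m : ℕ}
    {Q : γ → Matrix (Fin m) (Fin m) ℝ} (hQ : ∀ i j, Measurable fun c => Q c i j) (i j : Fin m) :
    Measurable fun c => CFC.sqrt (Q c) i j := by
  have h : Measurable fun c => (fun i j => Q c i j) := by
    refine measurable_pi_lambda _ fun i => measurable_pi_lambda _ fun j => hQ i j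
  exact (measurable_pi_apply j).comp ((measurable_pi_apply i).comp (measurable_sqrt_of_fun.comp h))

/-- The mass of a set under the image is the mass of a section of a measurable set. This is the
device behind measurability of all Gaussian families below: each is written as the image of one
fixed standard Gaussian. -/
theorem measurable_map_param {γ α β : Type*} [MeasurableSpace γ] [MeasurableSpace α]
    [MeasurableSpace β] (μ : Measure α) [SFinite μ] {f : γ → α → β}
    (hf : Measurable (Function.uncurry f)) : Measurable fun c => μ.map (f c) := by
  refine Measure.measurable_of_measurable_coe _ fun s hs => ?_
  have : ∀ c, μ.map (f c) s = μ (Prod.mk c ⁻¹' (Function.uncurry f ⁻¹' s)) := fun c => by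
    rw [Measure.map_apply (show Measurable (f c) from hf.comp measurable_prodMk_left) hs]; rfl
  simp_rw [this]
  exact measurable_measure_prodMk_left (hf hs)

open scoped MatrixOrder in
theorem measurable_gaussian_transform {γ : Type*} [MeasurableSpace γ] {m : ℕ}
    {Q : γ → Matrix (Fin m) (Fin m) ℝ} (hQ : ∀ i j, Measurable fun c => Q c i j)
    {μ : γ → EuclideanSpace ℝ (Fin m)} (hμ : Measurable μ) :
    Measurable fun p : γ × EuclideanSpace ℝ (Fin m) =>
      μ p.1 + Matrix.toEuclideanCLM (𝕜 := ℝ) (CFC.sqrt (Q p.1)) p.2 := by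
  refine (hμ.comp measurable_fst).add ?_
  have : ∀ p : γ × EuclideanSpace ℝ (Fin m),
      Matrix.toEuclideanCLM (𝕜 := ℝ) (CFC.sqrt (Q p.1)) p.2
        = WithLp.toLp 2 fun i => ∑ j, CFC.sqrt (Q p.1) i j * p.2 j := fun p => rfl
  simp_rw [this]
  refine (WithLp.measurable_toLp 2 _).comp (measurable_pi_lambda _ fun i =>
    Finset.measurable_sum _ fun j _ => ?_)
  exact ((measurable_sqrt_apply hQ i j).comp measurable_fst).mul
    (by fun_prop)

theorem measurable_multivariateGaussian {γ : Type*} [MeasurableSpace γ] {m : ℕ}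
    {Q : γ → Matrix (Fin m) (Fin m) ℝ} (hQ : ∀ i j, Measurable fun c => Q c i j)
    {μ : γ → EuclideanSpace ℝ (Fin m)} (hμ : Measurable μ) :
    Measurable fun c => multivariateGaussian (μ c) (Q c) :=
  measurable_map_param _ (measurable_gaussian_transform hQ hμ)

-- The product is the image of a fixed product of standard Gaussians under the coordinatewise affine
-- map, which reduces the claim to `measurable_map_param`.
open scoped MatrixOrder in
theorem measurable_pi_multivariateGaussian {γ : Type*} [MeasurableSpace γ] {m K : ℕ}
    {Q : γ → Matrix (Fin m) (Fin m) ℝ} (hQ : ∀ i j, Measurable fun c => Q c i j)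
    {μ : γ → EuclideanSpace ℝ (Fin m)} (hμ : Measurable μ) :
    Measurable fun c => Measure.pi fun _ : Fin K => multivariateGaussian (μ c) (Q c) := by
  have hT := measurable_gaussian_transform hQ hμ
  have : ∀ c, (Measure.pi fun _ : Fin K => multivariateGaussian (μ c) (Q c))
      = (Measure.pi fun _ : Fin K => stdGaussian (EuclideanSpace ℝ (Fin m))).map
        (fun u j => μ c + Matrix.toEuclideanCLM (𝕜 := ℝ) (CFC.sqrt (Q c)) (u j)) := fun c => by
    have hm : AEMeasurable (fun x : EuclideanSpace ℝ (Fin m) =>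
      μ c + Matrix.toEuclideanCLM (𝕜 := ℝ) (CFC.sqrt (Q c)) x)
      (stdGaussian (EuclideanSpace ℝ (Fin m))) := by fun_prop
    have := Measure.isProbabilityMeasure_map hm
    rw [Measure.pi_map_pi (fun _ => hm)]
    rfl
  simp_rw [this]
  refine measurable_map_param _ (measurable_pi_lambda _ fun j => ?_)
  exact hT.comp (measurable_fst.prodMk ((measurable_pi_apply j).comp measurable_snd))

theorem gaussianReal_eq_map (μ : ℝ) (v : NNReal) :
    gaussianReal μ v = (gaussianReal 0 1).map fun x => μ + √(v : ℝ) * x := by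
  have h1 := gaussianReal_map_const_mul (μ := 0) (v := 1) (√(v : ℝ))
  have h2 := gaussianReal_map_const_add (μ := 0) (v := v) μ
  have : NNReal.mk (√(v : ℝ) ^ 2) (sq_nonneg _) = v := by ext; simp
  rw [mul_zero, mul_one, this] at h1
  rw [zero_add, ← h1, Measure.map_map (by fun_prop) (by fun_prop)] at h2
  exact h2.symm

theorem measurable_gaussianReal {γ : Type*} [MeasurableSpace γ] {μ v : γ → ℝ}
    (hμ : Measurable μ) (hv : Measurable v) :
    Measurable fun c => gaussianReal (μ c) (v c).toNNReal := by
  have : ∀ c, gaussianReal (μ c) (v c).toNNReal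
      = (gaussianReal 0 1).map fun x => μ c + √((v c).toNNReal : ℝ) * x :=
    fun c => gaussianReal_eq_map _ _
  simp_rw [this]
  refine measurable_map_param _ ?_
  simp only [Function.uncurry_def]
  fun_prop

theorem measurable_pi_gaussianReal {γ : Type*} [MeasurableSpace γ] {v : γ → ℝ}
    (hv : Measurable v) (m : ℕ) :
    Measurable fun c => Measure.pi fun _ : Fin m => gaussianReal 0 (v c).toNNReal := by
  have : ∀ c, (Measure.pi fun _ : Fin m => gaussianReal 0 (v c).toNNReal)
      = (Measure.pi fun _ : Fin m => gaussianReal 0 1).map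
        (fun u j => 0 + √((v c).toNNReal : ℝ) * u j) := fun c => by
    have hm : AEMeasurable (fun x : ℝ => 0 + √((v c).toNNReal : ℝ) * x) (gaussianReal 0 1) := by
      fun_prop
    have := Measure.isProbabilityMeasure_map hm
    rw [Measure.pi_map_pi (fun _ => hm), ← gaussianReal_eq_map]
  simp_rw [this]
  refine measurable_map_param _ ?_
  simp only [Function.uncurry_def]
  fun_prop

/-! ### Measurability of kriging and of the mixtures in the parameters -/

section Kriging

variable {d m n : ℕ} {S : Set (EuclideanSpace ℝ (Fin d))}

theorem measurable_nu : Measurable (SecondLayer.nu (d := d)) := measurable_fst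

theorem measurable_sigmaSq : Measurable (SecondLayer.sigmaSq (d := d)) :=
  measurable_fst.comp measurable_snd

theorem measurable_baseCov (p q : S) : Measurable fun θ : SecondLayer d => baseCov θ p q := by
  unfold baseCov SecondLayer.sigmaSq SecondLayer.phi
  fun_prop

/-- By Cramer's rule an entry of the inverse is a quotient of polynomials in the covariances; the
convention 0⁻¹ = 0 keeps this measurable where the Gram matrix is singular. -/
theorem measurable_krigWeight (x : Fin n → S) (i j : Fin n) :
    Measurable fun θ : SecondLayer d => (gram θ x)⁻¹ i j := by
  have hg : ∀ i j, Measurable fun θ : SecondLayer d => gram θ x i j := fun i j =>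
    measurable_baseCov (x i) (x j)
  simp_rw [Matrix.inv_def, Matrix.smul_apply, smul_eq_mul, Ring.inverse_eq_inv',
    Matrix.adjugate_apply, Matrix.det_apply]
  refine Measurable.mul (Measurable.inv (Finset.measurable_sum _ fun s _ => ?_))
    (Finset.measurable_sum _ fun s _ => ?_)
  · exact (Finset.measurable_prod _ fun i _ => hg _ _).const_smul _
  · refine (Finset.measurable_prod _ fun k _ => ?_).const_smul (Equiv.Perm.sign s)
    by_cases h : s k = j
    · simp [h, Matrix.updateRow_apply]
    · simpa [h, Matrix.updateRow_apply] using hg _ _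

theorem measurable_krigMean (x : Fin n → S) (p : S) :
    Measurable fun c : SecondLayer d × (Fin n → ℝ) => krigMean c.1 x c.2 p := by
  unfold krigMean crossCov
  simp only [dotProduct, Matrix.mulVec]
  refine Finset.measurable_sum _ fun i _ => ((measurable_baseCov _ _).comp measurable_fst).mul
    (Finset.measurable_sum _ fun j _ => ((measurable_krigWeight x i j).comp measurable_fst).mul ?_)
  fun_prop

theorem measurable_krigCov (x : Fin n → S) (p q : S) :
    Measurable fun θ : SecondLayer d => krigCov θ x p q := by
  unfold krigCov crossCov
  simp only [dotProduct, Matrix.mulVec]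
  exact (measurable_baseCov _ _).sub (Finset.measurable_sum _ fun i _ =>
    (measurable_baseCov _ _).mul (Finset.measurable_sum _ fun j _ =>
      (measurable_krigWeight x i j).mul (measurable_baseCov _ _)))

theorem measurable_krigVar (x : Fin n → S) (p : S) :
    Measurable fun θ : SecondLayer d => krigVar θ x p := by
  unfold krigVar crossCov
  simp only [dotProduct, Matrix.mulVec]
  exact measurable_sigmaSq.sub (Finset.measurable_sum _ fun i _ =>
    (measurable_baseCov _ _).mul (Finset.measurable_sum _ fun j _ =>
      (measurable_krigWeight x i j).mul (measurable_baseCov _ _)))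

theorem measurable_baseGP (p : Fin m → S) : Measurable fun θ : SecondLayer d => baseGP θ p :=
  measurable_multivariateGaussian (fun _ _ => measurable_baseCov _ _) measurable_const

theorem measurable_pi_baseGP (K : ℕ) (p : Fin m → S) :
    Measurable fun θ : SecondLayer d => Measure.pi fun _ : Fin K => baseGP θ p :=
  measurable_pi_multivariateGaussian (fun _ _ => measurable_baseCov _ _) measurable_const

theorem measurable_krigGP (x : Fin n → S) (p : Fin m → S) :
    Measurable fun c : SecondLayer d × (Fin n → ℝ) => krigGP c.1 x c.2 p :=
  measurable_multivariateGaussian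
    (Q := fun c : SecondLayer d × (Fin n → ℝ) => Matrix.of fun a b => krigCov c.1 x (p a) (p b))
    (fun _ _ => (measurable_krigCov x _ _).comp measurable_fst)
    ((WithLp.measurable_toLp 2 _).comp (measurable_pi_lambda _ fun _ => measurable_krigMean x _))

instance (θ : SecondLayer d) (p : Fin m → S) : IsProbabilityMeasure (baseGP θ p) := by
  unfold baseGP; infer_instance

instance (θ : SecondLayer d) (x : Fin n → S) (v : Fin n → ℝ) (p : Fin m → S) :
    IsProbabilityMeasure (krigGP θ x v p) := by
  unfold krigGP; infer_instance

theorem measurable_dirac_prod {γ α β : Type*} [MeasurableSpace γ] [MeasurableSpace α]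
    [MeasurableSpace β] (a : α) {μ : γ → Measure β} (hμ : Measurable μ) [∀ c, SFinite (μ c)] :
    Measurable fun c => (Measure.dirac a).prod (μ c) := by
  simp_rw [Measure.dirac_prod]
  exact (Measure.measurable_map _ measurable_prodMk_left).comp hμ

theorem measurable_add_measure {γ α : Type*} [MeasurableSpace γ] [MeasurableSpace α]
    {μ ν : γ → Measure α} (hμ : Measurable μ) (hν : Measurable ν) :
    Measurable fun c => μ c + ν c := by
  refine Measure.measurable_of_measurable_coe _ fun s hs => ?_
  simp only [Measure.add_apply]
  exact ((Measure.measurable_coe hs).comp hμ).add ((Measure.measurable_coe hs).comp hν)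

theorem measurable_smul_measure {γ α : Type*} [MeasurableSpace γ] [MeasurableSpace α]
    {μ : γ → Measure α} (hμ : Measurable μ) {w : γ → ENNReal} (hw : Measurable w) :
    Measurable fun c => w c • μ c := by
  refine Measure.measurable_of_measurable_coe _ fun s hs => ?_
  simp only [Measure.smul_apply, smul_eq_mul]
  exact hw.mul ((Measure.measurable_coe hs).comp hμ)

theorem measurable_sum_measure {γ α ι : Type*} [MeasurableSpace γ] [MeasurableSpace α]
    (s : Finset ι) {μ : ι → γ → Measure α} (hμ : ∀ i, Measurable (μ i)) :
    Measurable fun c => ∑ i ∈ s, μ i c := by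
  refine Measure.measurable_of_measurable_coe _ fun t ht => ?_
  simp only [Measure.finsetSum_apply]
  exact Finset.measurable_sum _ fun i _ => (Measure.measurable_coe ht).comp (hμ i)

theorem measurable_urnKriging (x : Fin n → S) (p : Fin m → S) :
    Measurable fun c : SecondLayer d × (Fin n → Fin n → ℝ) × (Fin n → ℕ) =>
      urnKriging c.1 x c.2.1 c.2.2 p := by
  suffices h : Measurable fun c : (SecondLayer d × (Fin n → Fin n → ℝ)) × (Fin n → ℕ) =>
      urnKriging c.1.1 x c.1.2 c.2 p from
    h.comp (f := fun c : SecondLayer d × (Fin n → Fin n → ℝ) × (Fin n → ℕ) =>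
      ((c.1, c.2.1), c.2.2)) (by fun_prop)
  -- Assignment words form a countable type, so `z`, and with it the index set of the sum, may be
  -- held fixed.
  refine measurable_from_prod_countable_left fun z => ?_
  have hν : Measurable fun c : SecondLayer d × (Fin n → Fin n → ℝ) => c.1.nu :=
    measurable_nu.comp measurable_fst
  have hb : Measurable fun c : SecondLayer d × (Fin n → Fin n → ℝ) =>
      (Measure.dirac (numSurfaces z)).prod (baseGP c.1 p) :=
    measurable_dirac_prod (μ := fun c : SecondLayer d × (Fin n → Fin n → ℝ) => baseGP c.1 p) _
      ((measurable_baseGP p).comp measurable_fst)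
  have hk : ∀ j : Fin n, Measurable fun c : SecondLayer d × (Fin n → Fin n → ℝ) =>
      (Measure.dirac (j : ℕ)).prod (krigGP c.1 x (c.2 j) p) := fun j =>
    measurable_dirac_prod
      (μ := fun c : SecondLayer d × (Fin n → Fin n → ℝ) => krigGP c.1 x (c.2 j) p) _
      ((measurable_krigGP x p).comp
        (g := fun c : SecondLayer d × (Fin n → ℝ) => krigGP c.1 x c.2 p)
        (f := fun c : SecondLayer d × (Fin n → Fin n → ℝ) => (c.1, c.2 j)) (by fun_prop))
  exact measurable_add_measure (measurable_smul_measure hb (by fun_prop))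
    (measurable_sum_measure (Finset.univ.filter fun j : Fin n => (j : ℕ) < numSurfaces z)
      fun j => measurable_smul_measure (hk j)
      (w := fun c : SecondLayer d × (Fin n → Fin n → ℝ) =>
        ENNReal.ofReal (surfaceCount z j / (c.1.nu + n))) (by fun_prop))

theorem measurable_gpMixture (x : Fin n → S) (p : S) :
    Measurable fun c : SecondLayer d × (Fin n → Fin n → ℝ) × (Fin n → ℕ) =>
      gpMixture c.1 x c.2.1 c.2.2 p := by
  suffices h : Measurable fun c : (SecondLayer d × (Fin n → Fin n → ℝ)) × (Fin n → ℕ) =>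
      gpMixture c.1.1 x c.1.2 c.2 p from
    h.comp (f := fun c : SecondLayer d × (Fin n → Fin n → ℝ) × (Fin n → ℕ) =>
      ((c.1, c.2.1), c.2.2)) (by fun_prop)
  refine measurable_from_prod_countable_left fun z => ?_
  have hν : Measurable fun c : SecondLayer d × (Fin n → Fin n → ℝ) => c.1.nu :=
    measurable_nu.comp measurable_fst
  have hσ : Measurable fun c : SecondLayer d × (Fin n → Fin n → ℝ) => c.1.sigmaSq :=
    measurable_sigmaSq.comp measurable_fst
  have hk : ∀ j : Fin n, Measurable fun c : SecondLayer d × (Fin n → Fin n → ℝ) =>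
      gaussianReal (krigMean c.1 x (c.2 j) p) (krigVar c.1 x p).toNNReal := fun j =>
    measurable_gaussianReal
      ((measurable_krigMean x p).comp
        (f := fun c : SecondLayer d × (Fin n → Fin n → ℝ) => (c.1, c.2 j)) (by fun_prop))
      ((measurable_krigVar x p).comp measurable_fst)
  exact measurable_add_measure (measurable_smul_measure
    (measurable_gaussianReal measurable_const hσ) (by fun_prop))
    (measurable_sum_measure (Finset.univ.filter fun j : Fin n => (j : ℕ) < numSurfaces z)
      fun j => measurable_smul_measure (hk j)
      (w := fun c : SecondLayer d × (Fin n → Fin n → ℝ) =>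
        ENNReal.ofReal (surfaceCount z j / (c.1.nu + n))) (by fun_prop))

end Kriging

/-! ### Strict positive definiteness of the Gaussian kernel -/

section GaussKernel

variable {d : ℕ} {ι : Type*} [Fintype ι]

/-- Real part of the characteristic function of the standard Gaussian: the kernel is a mixture of
cosines. -/
theorem exp_neg_norm_sq_eq_integral (t : EuclideanSpace ℝ (Fin d)) :
    Real.exp (-‖t‖ ^ 2 / 2)
      = ∫ w, Real.cos (inner ℝ w t) ∂stdGaussian (EuclideanSpace ℝ (Fin d)) := by
  have h := congrArg Complex.re (charFun_stdGaussian t)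
  rw [charFun_apply] at h
  have hi : Integrable (fun w : EuclideanSpace ℝ (Fin d) =>
      Complex.exp (inner ℝ w t * Complex.I)) (stdGaussian (EuclideanSpace ℝ (Fin d))) := by
    refine Integrable.of_bound (Measurable.aestronglyMeasurable (by fun_prop)) 1
      (ae_of_all _ fun w => ?_)
    rw [Complex.norm_exp_ofReal_mul_I]
  have h2 := integral_re hi
  simp only [RCLike.re_to_complex] at h2
  rw [← h2] at h
  simp only [Complex.exp_ofReal_mul_I_re] at h
  rw [h]
  norm_cast

/-- Under the integral over frequencies w, the quadratic form is |∑ c_i exp(i⟨w, s_i⟩)|², a sum of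
two squares. -/
theorem gaussKernel_nonneg (s : ι → EuclideanSpace ℝ (Fin d)) (c : ι → ℝ) :
    0 ≤ ∑ i, ∑ j, c i * c j * Real.exp (-‖s i - s j‖ ^ 2 / 2) := by
  simp_rw [exp_neg_norm_sq_eq_integral, ← integral_const_mul]
  have hi : ∀ t : EuclideanSpace ℝ (Fin d), Integrable
      (fun w : EuclideanSpace ℝ (Fin d) => Real.cos (inner ℝ w t))
      (stdGaussian (EuclideanSpace ℝ (Fin d))) := fun t => by
    refine Integrable.of_bound (Measurable.aestronglyMeasurable (by fun_prop)) 1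
      (ae_of_all _ fun w => ?_)
    simpa using Real.abs_cos_le_one _
  have hs : ∀ i, ∑ j, ∫ w, c i * c j * Real.cos (inner ℝ w (s i - s j))
      ∂stdGaussian (EuclideanSpace ℝ (Fin d))
      = ∫ w, ∑ j, c i * c j * Real.cos (inner ℝ w (s i - s j))
        ∂stdGaussian (EuclideanSpace ℝ (Fin d)) := fun i =>
    (integral_finsetSum _ fun j _ => (hi _).const_mul _).symm
  simp_rw [hs]
  rw [← integral_finsetSum _ fun i _ => integrable_finsetSum _ fun j _ => (hi _).const_mul _]
  refine integral_nonneg fun w => ?_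
  have : ∑ i, ∑ j, c i * c j * Real.cos (inner ℝ w (s i - s j))
      = (∑ i, c i * Real.cos (inner ℝ w (s i))) ^ 2 + (∑ i, c i * Real.sin (inner ℝ w (s i))) ^ 2 := by
    rw [sq, sq, Finset.sum_mul_sum, Finset.sum_mul_sum, ← Finset.sum_add_distrib]
    refine Finset.sum_congr rfl fun i _ => ?_
    rw [← Finset.sum_add_distrib]
    refine Finset.sum_congr rfl fun j _ => ?_
    rw [inner_sub_right, Real.cos_sub]
    ring
  simp only [this, Pi.zero_apply]
  positivity

/-- Adjoin the point y with weight -b, where b is the sum in question. The enlarged form equals 0 -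
2b² + b² = -b², and it is nonnegative, so b = 0. -/
theorem gaussKernel_sum_eq_zero (s : ι → EuclideanSpace ℝ (Fin d)) (c : ι → ℝ)
    (h : ∑ i, ∑ j, c i * c j * Real.exp (-‖s i - s j‖ ^ 2 / 2) = 0)
    (y : EuclideanSpace ℝ (Fin d)) : ∑ i, c i * Real.exp (-‖s i - y‖ ^ 2 / 2) = 0 := by
  set b := ∑ i, c i * Real.exp (-‖s i - y‖ ^ 2 / 2) with hb
  have h1 := gaussKernel_nonneg (ι := Option ι) (fun o => o.elim y s) (fun o => o.elim (-b) c)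
  simp only [Fintype.sum_option, Option.elim, Finset.sum_add_distrib, h] at h1
  have h2 : ∑ i, -b * c i * Real.exp (-‖y - s i‖ ^ 2 / 2) = -b * b := by
    rw [hb, Finset.mul_sum]
    exact Finset.sum_congr rfl fun i _ => by rw [norm_sub_rev, ← hb]; ring
  have h3 : ∑ i, c i * -b * Real.exp (-‖s i - y‖ ^ 2 / 2) = -b * b := by
    rw [hb, Finset.mul_sum]
    exact Finset.sum_congr rfl fun i _ => by rw [← hb]; ring
  rw [h2, h3] at h1
  simp at h1
  nlinarith [sq_nonneg b]

/-- A null vector makes ∑ c_i exp(-‖s_i - y‖²/2) vanish for every y. Dividing by exp(-‖y‖²/2) leaves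
a linear relation between the characters y ↦ exp⟨s_i, y⟩, which are distinct and hence independent
by Dedekind's lemma. -/
theorem gaussKernel_definite (s : ι → EuclideanSpace ℝ (Fin d)) (hs : Function.Injective s)
    (c : ι → ℝ) (h : ∑ i, ∑ j, c i * c j * Real.exp (-‖s i - s j‖ ^ 2 / 2) = 0) : c = 0 := by
  let χ : ι → (Multiplicative (EuclideanSpace ℝ (Fin d)) →* ℝ) := fun i =>
    { toFun := fun y => Real.exp (inner ℝ (s i) y.toAdd)
      map_one' := by simp
      map_mul' := fun a b => by rw [toAdd_mul, inner_add_right, Real.exp_add] }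
  have hχ : Function.Injective χ := fun i j hij => by
    refine hs (ext_inner_right ℝ fun y => ?_)
    have := DFunLike.congr_fun hij (Multiplicative.ofAdd y)
    exact Real.exp_injective this
  have hli := (linearIndependent_monoidHom (Multiplicative (EuclideanSpace ℝ (Fin d))) ℝ).comp χ hχ
  rw [Fintype.linearIndependent_iff] at hli
  have hz := hli (fun i => c i * Real.exp (-‖s i‖ ^ 2 / 2)) (by
    funext y
    have := gaussKernel_sum_eq_zero s c h y.toAdd
    have h2 : ∀ i, c i * Real.exp (-‖s i - y.toAdd‖ ^ 2 / 2)
        = Real.exp (-‖y.toAdd‖ ^ 2 / 2) *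
          (c i * Real.exp (-‖s i‖ ^ 2 / 2) * Real.exp (inner ℝ (s i) y.toAdd)) := fun i => by
      rw [norm_sub_sq_real, mul_assoc, ← Real.exp_add, mul_left_comm, ← Real.exp_add]
      congr 2
      ring
    simp_rw [h2, ← Finset.mul_sum] at this
    have h3 := (mul_eq_zero.1 this).resolve_left (Real.exp_pos _).ne'
    simpa [χ] using h3)
  funext i
  exact (mul_eq_zero.1 (hz i)).resolve_right (Real.exp_pos _).ne'

end GaussKernel

/-! ### Positive definiteness of the covariance matrices, and Gaussian conditioning -/

section Kriging

variable {d m n : ℕ} {S : Set (EuclideanSpace ℝ (Fin d))}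

/-- The hyperparameters of the baseline process are in their admissible range. -/
def SecondLayer.Admissible (θ : SecondLayer d) : Prop :=
  0 < θ.nu ∧ 0 < θ.sigmaSq ∧ ∀ k, 0 < θ.phi k

theorem baseCov_self (θ : SecondLayer d) (p : S) : baseCov θ p p = θ.sigmaSq := by
  simp [baseCov]

theorem baseCov_comm (θ : SecondLayer d) (p q : S) : baseCov θ p q = baseCov θ q p := by
  unfold baseCov
  congr 3
  exact Finset.sum_congr rfl fun k _ => by ring

/-- Rescaled coordinates in which the covariance is the standard Gaussian kernel. -/
def rescale (θ : SecondLayer d) (p : S) : EuclideanSpace ℝ (Fin d) :=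
  WithLp.toLp 2 fun k => √(2 * θ.phi k) * p.1 k

theorem baseCov_eq (θ : SecondLayer d) (hφ : ∀ k, 0 < θ.phi k) (p q : S) :
    baseCov θ p q = θ.sigmaSq * Real.exp (-‖rescale θ p - rescale θ q‖ ^ 2 / 2) := by
  unfold baseCov
  rw [EuclideanSpace.real_norm_sq_eq, neg_div, Finset.sum_div]
  congr 3
  refine Finset.sum_congr rfl fun k _ => ?_
  have : (rescale θ p - rescale θ q) k = √(2 * θ.phi k) * (p.1 k - q.1 k) := by
    simp [rescale, mul_sub]
  rw [this, mul_pow, Real.sq_sqrt (by have := hφ k; positivity)]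
  ring

theorem rescale_injective (θ : SecondLayer d) (hφ : ∀ k, 0 < θ.phi k) :
    Function.Injective (rescale θ : S → _) := fun p q h => by
  ext k
  have := congrArg (fun v : EuclideanSpace ℝ (Fin d) => v k) h
  simp only [rescale] at this
  exact mul_left_cancel₀ (Real.sqrt_pos.2 (by have := hφ k; positivity)).ne' this

theorem dotProduct_gram_mulVec (θ : SecondLayer d) (hφ : ∀ k, 0 < θ.phi k) (p : Fin m → S)
    (c : Fin m → ℝ) : c ⬝ᵥ (gram θ p).mulVec c = θ.sigmaSq *
      ∑ i, ∑ j, c i * c j * Real.exp (-‖rescale θ (p i) - rescale θ (p j)‖ ^ 2 / 2) := by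
  simp only [dotProduct, Matrix.mulVec, gram, Matrix.of_apply, Finset.mul_sum]
  refine Finset.sum_congr rfl fun i _ => Finset.sum_congr rfl fun j _ => ?_
  rw [baseCov_eq θ hφ]
  ring

theorem isHermitian_gram (θ : SecondLayer d) (p : Fin m → S) : (gram θ p).IsHermitian := by
  ext i j
  simp [gram, baseCov_comm θ (p j)]

theorem posSemidef_gram {θ : SecondLayer d} (hθ : θ.Admissible) (p : Fin m → S) :
    (gram θ p).PosSemidef := by
  refine Matrix.posSemidef_iff_dotProduct_mulVec.2 ⟨isHermitian_gram θ p, fun c => ?_⟩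
  rw [star_trivial, dotProduct_gram_mulVec θ hθ.2.2]
  exact mul_nonneg hθ.2.1.le (gaussKernel_nonneg _ c)

theorem posDef_gram {θ : SecondLayer d} (hθ : θ.Admissible) {x : Fin n → S}
    (hx : Function.Injective x) : (gram θ x).PosDef := by
  refine Matrix.posDef_iff_dotProduct_mulVec.2 ⟨isHermitian_gram θ x, fun c hc => ?_⟩
  rw [star_trivial, dotProduct_gram_mulVec θ hθ.2.2]
  refine mul_pos hθ.2.1 (lt_of_le_of_ne (gaussKernel_nonneg _ c) fun h => hc ?_)
  exact gaussKernel_definite _ ((rescale_injective θ hθ.2.2).comp hx) c h.symm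

/-! ### Kriging as Gaussian conditioning -/

/-- Covariances between the design points and further points. -/
def crossGram (θ : SecondLayer d) (x : Fin n → S) (p : Fin m → S) : Matrix (Fin n) (Fin m) ℝ :=
  Matrix.of fun i a => baseCov θ (x i) (p a)

/-- Covariance matrix of the kriging process. -/
def krigGram (θ : SecondLayer d) (x : Fin n → S) (p : Fin m → S) : Matrix (Fin m) (Fin m) ℝ :=
  Matrix.of fun a b => krigCov θ x (p a) (p b)

theorem krigGram_eq (θ : SecondLayer d) (x : Fin n → S) (p : Fin m → S) :
    krigGram θ x p = gram θ p - (crossGram θ x p).transpose * (gram θ x)⁻¹ * crossGram θ x p := by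
  ext a b
  simp only [krigGram, krigCov, Matrix.of_apply, Matrix.sub_apply, gram]
  congr 1
  rw [Matrix.mul_assoc, Matrix.mul_apply]
  simp only [dotProduct, crossCov, Matrix.mulVec, Matrix.mul_apply, Matrix.transpose_apply,
    crossGram, Matrix.of_apply]
  refine Finset.sum_congr rfl fun i _ => ?_
  rw [baseCov_comm θ (p a)]
  congr 1
  exact Finset.sum_congr rfl fun j _ => by rw [baseCov_comm θ (p b)]

theorem krigMean_eq (θ : SecondLayer d) (x : Fin n → S) (p : Fin m → S) (v : Fin n → ℝ)
    (a : Fin m) :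
    krigMean θ x v (p a) = ((crossGram θ x p).transpose * (gram θ x)⁻¹).mulVec v a := by
  rw [← Matrix.mulVec_mulVec]
  simp only [krigMean, Matrix.mulVec, dotProduct, crossCov, crossGram, Matrix.transpose_apply,
    Matrix.of_apply]
  exact Finset.sum_congr rfl fun i _ => by rw [baseCov_comm θ (p a)]

theorem gram_append (θ : SecondLayer d) (x : Fin n → S) (p : Fin m → S) :
    (gram θ (Fin.append x p)).submatrix finSumFinEquiv finSumFinEquiv
      = Matrix.fromBlocks (gram θ x) (crossGram θ x p) (crossGram θ x p).conjTranspose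
          (gram θ p) := by
  ext i j
  rcases i with i | i <;> rcases j with j | j <;>
    simp [gram, crossGram, baseCov_comm θ (p _) (x _)]

/-- It is the Schur complement of the design block in the Gram matrix of all points. Only
semidefiniteness can be expected, since the further points may repeat one another or design points.
-/
theorem posSemidef_krigGram {θ : SecondLayer d} (hθ : θ.Admissible) {x : Fin n → S}
    (hx : Function.Injective x) (p : Fin m → S) : (krigGram θ x p).PosSemidef := by
  have hpd := posDef_gram hθ hx
  have := hpd.isUnit.invertible
  rw [krigGram_eq, ← Matrix.conjTranspose_eq_transpose_of_trivial,
    ← Matrix.PosDef.fromBlocks₁₁ _ _ hpd, ← gram_append]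
  exact (posSemidef_gram hθ _).submatrix _

/-- Completing the square: the shift by G⁻¹Bt absorbs the cross terms, and what remains in t is the
Schur complement. This is the comparison of exponents needed for `baseGP_append`. -/
theorem schur_quadratic {θ : SecondLayer d} (hθ : θ.Admissible) {x : Fin n → S}
    (hx : Function.Injective x) (p : Fin m → S) (s : Fin n → ℝ) (t : Fin m → ℝ) :
    let w := s + ((gram θ x)⁻¹ * crossGram θ x p).mulVec t
    w ⬝ᵥ (gram θ x).mulVec w + t ⬝ᵥ (krigGram θ x p).mulVec t
      = Fin.append s t ⬝ᵥ (gram θ (Fin.append x p)).mulVec (Fin.append s t) := by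
  intro w
  set G := gram θ x with hG
  set B := crossGram θ x p with hB
  have hdet : IsUnit G.det := (Matrix.isUnit_iff_isUnit_det _).1 (posDef_gram hθ hx).isUnit
  have hGT : G.transpose = G := isHermitian_gram θ x
  have hR : Fin.append s t ⬝ᵥ (gram θ (Fin.append x p)).mulVec (Fin.append s t)
      = s ⬝ᵥ G.mulVec s + s ⬝ᵥ B.mulVec t + (t ⬝ᵥ B.transpose.mulVec s
        + t ⬝ᵥ (gram θ p).mulVec t) := by
    simp only [dotProduct, Matrix.mulVec, Fin.sum_univ_add, Fin.append_left, Fin.append_right,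
      gram, Matrix.of_apply, hB, hG, crossGram, Matrix.transpose_apply, mul_add,
      Finset.sum_add_distrib, baseCov_comm θ (p _) (x _)]
    ring
  have hGw : G.mulVec w = G.mulVec s + B.mulVec t := by
    rw [Matrix.mulVec_add, Matrix.mulVec_mulVec, ← Matrix.mul_assoc, Matrix.mul_nonsing_inv _ hdet,
      Matrix.one_mul]
  have e1 : ∀ v : Fin n → ℝ, (G⁻¹ * B).mulVec t ⬝ᵥ v = t ⬝ᵥ (B.transpose * G⁻¹).mulVec v := by
    intro v
    rw [dotProduct_comm, Matrix.dotProduct_mulVec, dotProduct_comm, ← Matrix.mulVec_transpose,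
      Matrix.transpose_mul, Matrix.transpose_nonsing_inv, hGT]
  rw [hR, hGw, show w = s + (G⁻¹ * B).mulVec t from rfl, add_dotProduct, e1, dotProduct_add,
    Matrix.mulVec_add, Matrix.mulVec_mulVec, Matrix.mulVec_mulVec, Matrix.mul_assoc B.transpose,
    Matrix.nonsing_inv_mul _ hdet, Matrix.mul_one, krigGram_eq, Matrix.sub_mulVec, dotProduct_add,
    dotProduct_sub]
  ring

/-- A pair (values at `x`, kriging residuals at `p`) turned into the values at `x` and `p`. -/
def krigMap (θ : SecondLayer d) (x : Fin n → S) (p : Fin m → S)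
    (e : EuclideanSpace ℝ (Fin n) × EuclideanSpace ℝ (Fin m)) : EuclideanSpace ℝ (Fin (n + m)) :=
  WithLp.toLp 2 (Fin.append e.1 fun a => krigMean θ x e.1 (p a) + e.2 a)

theorem measurable_krigMap (θ : SecondLayer d) (x : Fin n → S) (p : Fin m → S) :
    Measurable (krigMap θ x p) := by
  refine (WithLp.measurable_toLp 2 _).comp (measurable_pi_lambda _ fun i => ?_)
  refine Fin.addCases (fun i => ?_) (fun a => ?_) i
  · simp only [Fin.append_left]; fun_prop
  · simp only [Fin.append_right]
    refine ((measurable_krigMean x (p a)).comp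
      (f := fun e : EuclideanSpace ℝ (Fin n) × EuclideanSpace ℝ (Fin m) =>
        (θ, (e.1 : Fin n → ℝ))) (by fun_prop)).add (by fun_prop)

/-- Kriging as an independent sum: values at further points are the kriging mean plus a residual
independent of the design values. Both sides are compared through characteristic functions, which
requires no density and so allows a singular residual covariance. -/
theorem baseGP_append {θ : SecondLayer d} (hθ : θ.Admissible) {x : Fin n → S}
    (hx : Function.Injective x) (p : Fin m → S) :
    baseGP θ (Fin.append x p)
      = ((baseGP θ x).prod (multivariateGaussian 0 (krigGram θ x p))).map (krigMap θ x p) := by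
  have hm := measurable_krigMap θ x p
  have := Measure.isProbabilityMeasure_map (μ := (baseGP θ x).prod
    (multivariateGaussian 0 (krigGram θ x p))) hm.aemeasurable
  refine Measure.ext_of_charFun ?_
  funext t
  set s : Fin n → ℝ := fun i => t (Fin.castAdd m i)
  set r : Fin m → ℝ := fun a => t (Fin.natAdd n a)
  have ht : (t : Fin (n + m) → ℝ) = Fin.append s r := by
    funext i; refine Fin.addCases (fun i => ?_) (fun a => ?_) i <;> simp [s, r]
  set w := s + ((gram θ x)⁻¹ * crossGram θ x p).mulVec r with hw
  have hGT : (gram θ x).transpose = gram θ x := isHermitian_gram θ x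
  -- The functional t splits into one of the design values and one of the residuals; transposing the
  -- kriging weights produces the shifted vector w.
  have hinner : ∀ e : EuclideanSpace ℝ (Fin n) × EuclideanSpace ℝ (Fin m),
      inner ℝ (krigMap θ x p e) t = inner ℝ e.1 (WithLp.toLp 2 w) + inner ℝ e.2 (WithLp.toLp 2 r) := by
    intro e
    have h1 : ∀ {k : ℕ} (u v : EuclideanSpace ℝ (Fin k)), inner ℝ u v = (u : Fin k → ℝ) ⬝ᵥ v := by
      intro k u v
      rw [EuclideanSpace.inner_eq_star_dotProduct, dotProduct_comm]; simp
    have h2 : (fun a => krigMean θ x e.1 (p a)) ⬝ᵥ r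
        = e.1 ⬝ᵥ ((gram θ x)⁻¹ * crossGram θ x p).mulVec r := by
      simp_rw [krigMean_eq]
      rw [dotProduct_comm, Matrix.dotProduct_mulVec, dotProduct_comm, ← Matrix.mulVec_transpose,
        Matrix.transpose_mul, Matrix.transpose_nonsing_inv, hGT, Matrix.transpose_transpose]
    rw [h1, h1, h1, ht]
    have h3 : ((krigMap θ x p e : EuclideanSpace ℝ (Fin (n + m))) : Fin (n + m) → ℝ) ⬝ᵥ Fin.append s r
        = e.1 ⬝ᵥ s + ((fun a => krigMean θ x e.1 (p a)) ⬝ᵥ r + e.2 ⬝ᵥ r) := by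
      simp [krigMap, dotProduct, Fin.sum_univ_add, add_mul, Finset.sum_add_distrib]
    rw [h3, h2, hw, dotProduct_add]
    ring
  rw [baseGP, charFun_multivariateGaussian (posSemidef_gram hθ _), charFun_apply,
    integral_map hm.aemeasurable (Measurable.aestronglyMeasurable (by fun_prop))]
  simp_rw [hinner, Complex.ofReal_add, add_mul, Complex.exp_add]
  rw [integral_prod_mul (fun u : EuclideanSpace ℝ (Fin n) =>
      Complex.exp (inner ℝ u (WithLp.toLp 2 w) * Complex.I))
    (fun u : EuclideanSpace ℝ (Fin m) => Complex.exp (inner ℝ u (WithLp.toLp 2 r) * Complex.I)),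
    ← charFun_apply, ← charFun_apply, baseGP, charFun_multivariateGaussian (posSemidef_gram hθ _),
    charFun_multivariateGaussian (posSemidef_krigGram hθ hx p), ← Complex.exp_add, ht,
    ← schur_quadratic hθ hx p s r]
  congr 1
  simp only [inner_zero_right, Complex.ofReal_zero, zero_mul, zero_sub, Complex.ofReal_add]
  ring

theorem krigGP_eq_map (θ : SecondLayer d) (x : Fin n → S) (v : Fin n → ℝ) (p : Fin m → S) :
    krigGP θ x v p = (multivariateGaussian 0 (krigGram θ x p)).map
      fun z => WithLp.toLp 2 fun a => krigMean θ x v (p a) + z a := by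
  have h : (fun z : EuclideanSpace ℝ (Fin m) =>
      (WithLp.toLp 2 fun a => krigMean θ x v (p a) + z a : EuclideanSpace ℝ (Fin m)))
      = fun z => (WithLp.toLp 2 fun a => krigMean θ x v (p a)) + z := by
    funext z; rfl
  rw [h, krigGP, multivariateGaussian, multivariateGaussian, Measure.map_map (by fun_prop)
    (by fun_prop)]
  congr 1
  funext z
  simp [krigGram]

/-- The values at the design points, as a vector, among the values at `x` and `p`. -/
def leftPart (n m : ℕ) (e : EuclideanSpace ℝ (Fin (n + m))) : Fin n → ℝ :=
  fun i => e (Fin.castAdd m i)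

/-- The values at the further points among the values at `x` and `p`. -/
def rightPart (n m : ℕ) (e : EuclideanSpace ℝ (Fin (n + m))) : EuclideanSpace ℝ (Fin m) :=
  WithLp.toLp 2 fun a => e (Fin.natAdd n a)

theorem measurable_leftPart : Measurable (leftPart n m) := by
  unfold leftPart; fun_prop

theorem measurable_rightPart : Measurable (rightPart n m) := by
  unfold rightPart; fun_prop

/-- Disintegration form of `baseGP_append`: fixing the design values only translates the residual
law by the kriging mean. -/
theorem lintegral_baseGP_append {θ : SecondLayer d} (hθ : θ.Admissible) {x : Fin n → S}
    (hx : Function.Injective x) (p : Fin m → S)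
    {f : (Fin n → ℝ) × EuclideanSpace ℝ (Fin m) → ENNReal} (hf : Measurable f) :
    ∫⁻ e, f (leftPart n m e, rightPart n m e) ∂baseGP θ (Fin.append x p)
      = ∫⁻ e, ∫⁻ y, f (leftPart n m e, y) ∂krigGP θ x (leftPart n m e) p
          ∂baseGP θ (Fin.append x p) := by
  have hm := measurable_krigMap θ x p
  have hmean : ∀ a, Measurable fun v : Fin n → ℝ => krigMean θ x v (p a) := fun a =>
    (measurable_krigMean x (p a)).comp (measurable_const.prodMk measurable_id)
  have hshift : ∀ v : Fin n → ℝ, Measurable fun z : EuclideanSpace ℝ (Fin m) =>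
      (WithLp.toLp 2 fun a => krigMean θ x v (p a) + z a : EuclideanSpace ℝ (Fin m)) := fun v => by
    fun_prop
  have hl : ∀ e, leftPart n m (krigMap θ x p e) = e.1 := fun e => by
    funext i; simp [leftPart, krigMap]
  have hr : ∀ e, rightPart n m (krigMap θ x p e)
      = WithLp.toLp 2 fun a => krigMean θ x e.1 (p a) + e.2 a := fun e => by
    ext i; simp [rightPart, krigMap]
  have hk : ∀ v : Fin n → ℝ, ∫⁻ y, f (v, y) ∂krigGP θ x v p
      = ∫⁻ z, f (v, WithLp.toLp 2 fun a => krigMean θ x v (p a) + z a)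
        ∂multivariateGaussian 0 (krigGram θ x p) := fun v => by
    rw [krigGP_eq_map, lintegral_map (f := fun y => f (v, y)) (hf.comp measurable_prodMk_left)
      (hshift v)]
  have hjoint : Measurable fun q : (Fin n → ℝ) × EuclideanSpace ℝ (Fin m) =>
      f (q.1, WithLp.toLp 2 fun a => krigMean θ x q.1 (p a) + q.2 a) := by
    refine hf.comp (measurable_fst.prodMk ((WithLp.measurable_toLp 2 _).comp
      (measurable_pi_lambda _ fun a => ((hmean a).comp measurable_fst).add (by fun_prop))))
  have hjoint' : Measurable fun q : EuclideanSpace ℝ (Fin n) × EuclideanSpace ℝ (Fin m) =>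
      f ((q.1 : Fin n → ℝ), WithLp.toLp 2 fun a => krigMean θ x q.1 (p a) + q.2 a) :=
    hjoint.comp (f := fun q : EuclideanSpace ℝ (Fin n) × EuclideanSpace ℝ (Fin m) =>
      ((q.1 : Fin n → ℝ), q.2)) (by fun_prop)
  simp_rw [hk]
  rw [baseGP_append hθ hx p, lintegral_map
      (f := fun e => f (leftPart n m e, rightPart n m e)) (hf.comp
      (measurable_leftPart.prodMk measurable_rightPart)) hm,
    lintegral_map (f := fun e => ∫⁻ z, f (leftPart n m e, WithLp.toLp 2 fun a =>
      krigMean θ x (leftPart n m e) (p a) + z a) ∂multivariateGaussian 0 (krigGram θ x p))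
      ((Measurable.lintegral_prod_right' hjoint).comp measurable_leftPart) hm]
  simp_rw [hl, hr]
  have hinner : Measurable fun q : EuclideanSpace ℝ (Fin n) × EuclideanSpace ℝ (Fin m) =>
      ∫⁻ z, f ((q.1 : Fin n → ℝ), WithLp.toLp 2 fun a => krigMean θ x q.1 (p a) + z a)
        ∂multivariateGaussian 0 (krigGram θ x p) :=
    (Measurable.lintegral_prod_right' (ν := multivariateGaussian 0 (krigGram θ x p)) hjoint).comp
      (f := fun q : EuclideanSpace ℝ (Fin n) × EuclideanSpace ℝ (Fin m) => (q.1 : Fin n → ℝ))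
      (by fun_prop)
  rw [lintegral_prod _ hjoint'.aemeasurable, lintegral_prod _ hinner.aemeasurable]
  -- On the right the integrand no longer depends on the outer residual, which integrates to 1.
  simp

/-- Consistency of the marginals under selection and repetition of points; the test vector is pushed
forward along σ to compare characteristic functions. -/
theorem map_baseGP_comp {k : ℕ} {θ : SecondLayer d} (hθ : θ.Admissible) (q : Fin k → S)
    (σ : Fin m → Fin k) :
    (baseGP θ q).map (fun e => (WithLp.toLp 2 fun a => e (σ a) : EuclideanSpace ℝ (Fin m)))
      = baseGP θ (q ∘ σ) := by
  have hm : Measurable fun e : EuclideanSpace ℝ (Fin k) =>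
      (WithLp.toLp 2 fun a => e (σ a) : EuclideanSpace ℝ (Fin m)) := by fun_prop
  have := Measure.isProbabilityMeasure_map (μ := baseGP θ q) hm.aemeasurable
  refine Measure.ext_of_charFun ?_
  funext t
  set s : EuclideanSpace ℝ (Fin k) := WithLp.toLp 2 fun i => ∑ a, if σ a = i then t a else 0
  have hin : ∀ e : EuclideanSpace ℝ (Fin k),
      inner ℝ (WithLp.toLp 2 fun a => e (σ a) : EuclideanSpace ℝ (Fin m)) t = inner ℝ e s := by
    intro e
    simp only [PiLp.inner_apply, s, RCLike.inner_apply, conj_trivial, Finset.sum_mul]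
    rw [Finset.sum_comm]
    exact Finset.sum_congr rfl fun a _ => by simp
  rw [charFun_apply, integral_map hm.aemeasurable (Measurable.aestronglyMeasurable (by fun_prop))]
  simp_rw [hin]
  rw [← charFun_apply, baseGP, baseGP, charFun_multivariateGaussian (posSemidef_gram hθ _),
    charFun_multivariateGaussian (posSemidef_gram hθ _)]
  congr 2
  · simp
  · congr 2
    have hs : ∀ u : Fin k → ℝ, (s : Fin k → ℝ) ⬝ᵥ u = ∑ a, t a * u (σ a) := fun u => by
      simp only [dotProduct, s, Finset.sum_mul]
      rw [Finset.sum_comm]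
      exact Finset.sum_congr rfl fun a _ => by simp
    rw [hs]
    refine Finset.sum_congr rfl fun a _ => ?_
    rw [Matrix.mulVec, dotProduct_comm, hs, Matrix.mulVec, dotProduct_comm]
    rfl

theorem map_rightPart_baseGP {θ : SecondLayer d} (hθ : θ.Admissible) (x : Fin n → S)
    (p : Fin m → S) : (baseGP θ (Fin.append x p)).map (rightPart n m) = baseGP θ p := by
  have := map_baseGP_comp hθ (Fin.append x p) (Fin.natAdd n)
  rwa [show Fin.append x p ∘ Fin.natAdd n = p by ext; simp] at this

/-- Lets the pointwise term B be read off from the process version with one point, forgetting the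
label. Admissibility is needed to identify the variances of the one-dimensional marginals. -/
theorem gpMixture_eq_map {θ : SecondLayer d} (hθ : θ.Admissible) {x : Fin n → S}
    (hx : Function.Injective x) (t : Fin n → Fin n → ℝ) (z : Fin n → ℕ) (p : S) :
    gpMixture θ x t z p = (urnKriging θ x t z fun _ : Fin 1 => p).map fun u => u.2 0 := by
  have hm : Measurable fun u : ℕ × EuclideanSpace ℝ (Fin 1) => u.2 0 := by fun_prop
  have hd : ∀ (k : ℕ) (μ : Measure (EuclideanSpace ℝ (Fin 1))) [SFinite μ],
      ((Measure.dirac k).prod μ).map (fun u : ℕ × EuclideanSpace ℝ (Fin 1) => u.2 0)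
        = μ.map fun u => u 0 := fun k μ _ => by
    rw [Measure.dirac_prod, Measure.map_map hm measurable_prodMk_left]; rfl
  have hb : (baseGP θ fun _ : Fin 1 => p).map (fun u => u 0)
      = gaussianReal 0 θ.sigmaSq.toNNReal := by
    rw [baseGP, (measurePreserving_eval_multivariateGaussian (posSemidef_gram hθ _)).map_eq]
    simp [gram, baseCov_self]
  have hk : ∀ v : Fin n → ℝ, (krigGP θ x v fun _ : Fin 1 => p).map (fun u => u 0)
      = gaussianReal (krigMean θ x v p) (krigVar θ x p).toNNReal := fun v => by
    have h := (measurePreserving_eval_multivariateGaussian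
      (μ := WithLp.toLp 2 fun _ : Fin 1 => krigMean θ x v p)
      (posSemidef_krigGram hθ hx fun _ : Fin 1 => p) (i := 0)).map_eq
    rw [show krigVar θ x p = krigGram θ x (fun _ : Fin 1 => p) 0 0 by
      simp [krigGram, krigVar, krigCov, baseCov_self]]
    exact h
  rw [gpMixture, urnKriging, Measure.map_add _ _ hm, Measure.map_smul, hd, hb]
  congr 1
  rw [← Measure.mapₗ_apply_of_measurable hm, map_sum]
  refine Finset.sum_congr rfl fun j _ => ?_
  rw [Measure.mapₗ_apply_of_measurable hm, Measure.map_smul, hd, hk]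

end Kriging

/-! ### Partition probabilities of the stick-breaking process -/

/-- The mixed moment `E[V ^ s (1 - V) ^ t]` of `V ∼ Beta(1, ν)`. -/
def betaMoment (ν : ℝ) (s t : ℕ) : ENNReal :=
  ∫⁻ v, ENNReal.ofReal (v ^ s * (1 - v) ^ t) ∂betaMeasure 1 ν

/-- Multiplying the density by v^s (1-v)^t gives a multiple of the Beta(s+1, ν+t) density, so the
moment is a ratio of Beta functions. -/
theorem betaMoment_eq {ν : ℝ} (hν : 0 < ν) (s t : ℕ) :
    betaMoment ν s t = ENNReal.ofReal
      (ν * Real.Gamma (s + 1) * Real.Gamma (ν + t) / Real.Gamma (ν + s + t + 1)) := by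
  have h1 : betaMoment ν s t = ∫⁻ v, betaPDF 1 ν v * ENNReal.ofReal (v ^ s * (1 - v) ^ t) := by
    rw [betaMoment, betaMeasure, lintegral_withDensity_eq_lintegral_mul _
      (by unfold betaPDF; fun_prop) (by fun_prop)]
    rfl
  have hs : (0 : ℝ) < s + 1 := by positivity
  have ht : (0 : ℝ) < ν + t := by positivity
  have h2 : ∀ v, betaPDF 1 ν v * ENNReal.ofReal (v ^ s * (1 - v) ^ t)
      = ENNReal.ofReal (beta (s + 1) (ν + t) / beta 1 ν) * betaPDF (s + 1) (ν + t) v := fun v => by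
    rw [betaPDF_eq, betaPDF_eq]
    split_ifs with hv
    · rw [← ENNReal.ofReal_mul (by have := beta_pos one_pos hν; have := hv.1; have := sub_pos.2 hv.2; positivity),
        ← ENNReal.ofReal_mul (div_nonneg (beta_pos hs ht).le (beta_pos one_pos hν).le)]
      congr 1
      have h3 : v ^ ((s : ℝ) + 1 - 1) = v ^ s := by rw [add_sub_cancel_right, Real.rpow_natCast]
      have h4 : (1 - v) ^ (ν + t - 1) = (1 - v) ^ (ν - 1) * (1 - v) ^ t := by
        rw [show ν + t - 1 = ν - 1 + t by ring, Real.rpow_add (sub_pos.2 hv.2), Real.rpow_natCast]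
      rw [h3, h4, sub_self, Real.rpow_zero]
      have := (beta_pos hs ht).ne'
      have := (beta_pos one_pos hν).ne'
      field_simp
    · simp
  simp_rw [h1, h2]
  rw [lintegral_const_mul' _ _ ENNReal.ofReal_ne_top, lintegral_betaPDF_eq_one hs ht, mul_one]
  congr 1
  rw [beta, beta, Real.Gamma_one, one_mul, add_comm 1 ν, Real.Gamma_add_one hν.ne',
    show (s : ℝ) + 1 + (ν + t) = ν + s + t + 1 by ring]
  have := (Real.Gamma_pos_of_pos hν).ne'
  have := (Real.Gamma_pos_of_pos (show 0 < ν + s + t + 1 by positivity)).ne'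
  field_simp

theorem betaMoment_zero_left {ν : ℝ} (hν : 0 < ν) (t : ℕ) :
    betaMoment ν 0 t = ENNReal.ofReal (ν / (ν + t)) := by
  rw [betaMoment_eq hν]
  congr 1
  have ht : (0 : ℝ) < ν + t := by positivity
  have := (Real.Gamma_pos_of_pos ht).ne'
  simp only [Nat.cast_zero, zero_add, add_zero, Real.Gamma_one, mul_one]
  rw [Real.Gamma_add_one ht.ne']
  field_simp

/-! ### Splitting injections into the sticks by the class on the first stick -/

section FirstStick

variable {ι : Type} [DecidableEq ι]

/-- Put the class `j` on the first stick and the others on the sticks after it. -/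
def insertFirst (j : ι) (a : {i // i ≠ j} → ℕ) (i : ι) : ℕ :=
  if h : i = j then 0 else a ⟨i, h⟩ + 1

theorem insertFirst_self (j : ι) (a : {i // i ≠ j} → ℕ) : insertFirst j a j = 0 := by
  simp [insertFirst]

theorem insertFirst_coe (j : ι) (a : {i // i ≠ j} → ℕ) (i : {i // i ≠ j}) :
    insertFirst j a i = a i + 1 := by
  simp [insertFirst, i.2]

/-- Move all classes to the next stick. -/
def shiftEmbedding (a : ι ↪ ℕ) : ι ↪ ℕ :=
  ⟨fun j => a j + 1, fun _ _ h => a.injective (Nat.succ_injective h)⟩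

theorem insertFirst_injective (j : ι) (a : {i // i ≠ j} ↪ ℕ) :
    Function.Injective (insertFirst j a) := fun i k h => by
  by_cases hi : i = j <;> by_cases hk : k = j <;> simp [insertFirst, hi, hk] at h
  · rw [hi, hk]
  · exact h

/-- An injection of the classes into the sticks, by the class on the first stick, if any. -/
def firstStick : ((ι ↪ ℕ) ⊕ Σ j : ι, ({i // i ≠ j} ↪ ℕ)) → (ι ↪ ℕ)
  | Sum.inl a => shiftEmbedding a
  | Sum.inr ⟨j, a⟩ => ⟨insertFirst j a, insertFirst_injective j a⟩

theorem firstStick_inl (a : ι ↪ ℕ) : ⇑(firstStick (Sum.inl a)) = fun j => a j + 1 := rfl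

theorem firstStick_inr (j : ι) (a : {i // i ≠ j} ↪ ℕ) :
    ⇑(firstStick (Sum.inr ⟨j, a⟩)) = insertFirst j a := rfl

theorem firstStick_injective : Function.Injective (firstStick (ι := ι)) := by
  rintro (a | ⟨j, a⟩) (b | ⟨k, b⟩) h
  · congr 1
    ext i
    have := DFunLike.congr_fun h i
    simpa [firstStick_inl] using this
  · have := DFunLike.congr_fun h k
    simp [firstStick_inl, firstStick_inr, insertFirst] at this
  · have := DFunLike.congr_fun h j
    simp [firstStick_inl, firstStick_inr, insertFirst] at this
  · have hjk : j = k := by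
      by_contra hne
      have := DFunLike.congr_fun h j
      simp [firstStick_inr, insertFirst, hne] at this
    subst hjk
    congr 2
    ext i
    have := DFunLike.congr_fun h (i : ι)
    simpa [firstStick_inr, insertFirst_coe] using this

theorem firstStick_surjective : Function.Surjective (firstStick (ι := ι)) := by
  intro a
  by_cases h : ∃ j, a j = 0
  · obtain ⟨j, hj⟩ := h
    have hpos : ∀ i, i ≠ j → a i ≠ 0 := fun i hi h0 => hi (a.injective (h0.trans hj.symm))
    refine ⟨Sum.inr ⟨j, ⟨fun i => a i - 1, fun i k hik => ?_⟩⟩, ?_⟩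
    · have := hpos i i.2
      have := hpos k k.2
      exact Subtype.ext (a.injective (by simp only at hik; omega))
    · refine DFunLike.ext _ _ fun i => ?_
      rw [firstStick_inr]
      by_cases hi : i = j
      · rw [hi, insertFirst_self, hj]
      · rw [insertFirst_coe j _ ⟨i, hi⟩]
        exact Nat.succ_pred_eq_of_ne_zero (hpos i hi)
  · push Not at h
    refine ⟨Sum.inl ⟨fun i => a i - 1, fun i k hik => ?_⟩, ?_⟩
    · have := h i
      have := h k
      exact a.injective (by simp only at hik; omega)
    · refine DFunLike.ext _ _ fun i => ?_
      rw [firstStick_inl]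
      exact Nat.succ_pred_eq_of_ne_zero (h i)

end FirstStick

/-! ### Summing over the sticks: the partition probability function and its urn ratios -/

section Partition

variable {ι : Type} [Fintype ι]

/-- The urn weights have total mass 1; this makes the partition function a fixed point of the
first-stick recursion. -/
theorem sum_weights {ν : ℝ} (hν : 0 < ν) (m : ι → ℕ) :
    ENNReal.ofReal (ν / (ν + (∑ i, m i : ℕ))) + ∑ j, ENNReal.ofReal (m j / (ν + (∑ i, m i : ℕ))) = 1 := by
  have h : (0 : ℝ) < ν + (∑ i, m i : ℕ) := by positivity
  rw [← ENNReal.ofReal_sum_of_nonneg fun j _ => by positivity, ← ENNReal.ofReal_add (by positivity)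
    (Finset.sum_nonneg fun j _ => by positivity), ← Finset.sum_div, ← add_div, ← Nat.cast_sum, div_self h.ne',
    ENNReal.ofReal_one]

/-- Probability, up to the sticks from `L` on, that the classes `j`, of sizes `m j`, are realized
on the sticks `a j`. -/
def stickProd (ν : ℝ) (m a : ι → ℕ) (L : ℕ) : ENNReal :=
  ∏ r ∈ Finset.range L,
    betaMoment ν (∑ j, if a j = r then m j else 0) (∑ j, if r < a j then m j else 0)

/-- Probability that the classes `j`, of sizes `m j`, are realized on the sticks `a j`. -/
def stickProb (ν : ℝ) (m a : ι → ℕ) : ENNReal :=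
  stickProd ν m a (Finset.univ.sup fun j => a j + 1)

/-- Beyond the last occupied stick every factor is the moment with exponents 0 and 0, equal to 1, so
the cutoff is immaterial. -/
theorem stickProd_eq_stickProb {ν : ℝ} (hν : 0 < ν) (m a : ι → ℕ) {L : ℕ} (hL : ∀ j, a j < L) :
    stickProd ν m a L = stickProb ν m a := by
  unfold stickProb stickProd
  refine (Finset.prod_subset (Finset.range_subset_range.2 (Finset.sup_le fun j _ => hL j))
    fun r _ hr => ?_).symm
  have h : ∀ j, a j < r := fun j => by
    have : a j + 1 ≤ Finset.univ.sup fun j => a j + 1 :=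
      Finset.le_sup (f := fun j => a j + 1) (Finset.mem_univ j)
    have hr' := not_lt.1 fun h => hr (Finset.mem_range.2 h)
    exact lt_of_lt_of_le (Nat.lt_succ_self _) (this.trans hr')
  have h1 : ∀ j, ¬ a j = r := fun j => (h j).ne
  have h2 : ∀ j, ¬ r < a j := fun j => (h j).le.not_gt
  simp [h1, h2, betaMoment_zero_left hν, hν.ne']

theorem stickProd_succ (ν : ℝ) (m a : ι → ℕ) (L : ℕ) :
    stickProd ν m (fun j => a j + 1) (L + 1) = betaMoment ν 0 (∑ j, m j) * stickProd ν m a L := by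
  unfold stickProd
  rw [Finset.prod_range_succ', mul_comm]
  simp

theorem stickProb_succ {ν : ℝ} (hν : 0 < ν) (m a : ι → ℕ) :
    stickProb ν m (fun j => a j + 1) = betaMoment ν 0 (∑ j, m j) * stickProb ν m a := by
  have h : ∀ j, a j < Finset.univ.sup fun j => a j + 1 := fun j =>
    Finset.le_sup (f := fun j => a j + 1) (Finset.mem_univ j)
  rw [← stickProd_eq_stickProb hν m a h, ← stickProd_succ,
    stickProd_eq_stickProb hν m _ fun j => Nat.succ_lt_succ (h j)]

variable [DecidableEq ι]

theorem stickProd_insertFirst (ν : ℝ) (m : ι → ℕ) (j : ι) (a : {i // i ≠ j} → ℕ) (L : ℕ) :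
    stickProd ν m (insertFirst j a) (L + 1)
      = betaMoment ν (m j) (∑ i : {i // i ≠ j}, m i) * stickProd ν (fun i : {i // i ≠ j} => m i) a L := by
  unfold stickProd
  rw [Finset.prod_range_succ', mul_comm]
  simp_rw [Fintype.sum_eq_add_sum_subtype_ne _ j, insertFirst_self, insertFirst_coe]
  simp

theorem stickProb_insertFirst {ν : ℝ} (hν : 0 < ν) (m : ι → ℕ) (j : ι) (a : {i // i ≠ j} → ℕ) :
    stickProb ν m (insertFirst j a)
      = betaMoment ν (m j) (∑ i : {i // i ≠ j}, m i) * stickProb ν (fun i : {i // i ≠ j} => m i) a := by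
  have h : ∀ i, a i < Finset.univ.sup fun i => a i + 1 := fun i =>
    Finset.le_sup (f := fun i => a i + 1) (Finset.mem_univ i)
  rw [← stickProd_eq_stickProb hν _ a h, ← stickProd_insertFirst,
    stickProd_eq_stickProb hν m _ fun i => ?_]
  by_cases hi : i = j
  · subst hi; rw [insertFirst_self]; omega
  · rw [insertFirst_coe j a ⟨i, hi⟩]; exact Nat.succ_lt_succ (h _)

open Classical in
/-- Probability that classes of sizes `m j` are realized on distinct sticks before the stick `L`. -/
def partitionSum (ν : ℝ) (m : ι → ℕ) (L : ℕ∞) : ENNReal :=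
  ∑' a : ι ↪ ℕ, if ∀ j, (a j : ℕ∞) < L then stickProb ν m a else 0

/-- The first stick carries no class, in which case all draws pass it, or exactly one class j, in
which case the draws of j hit it and the others pass. The remaining sticks repeat the problem.
Allowing L = ⊤ gives the finite and the infinite recursion at once. -/
theorem partitionSum_succ {ν : ℝ} (hν : 0 < ν) (m : ι → ℕ) (L : ℕ∞) :
    partitionSum ν m (L + 1) = betaMoment ν 0 (∑ j, m j) * partitionSum ν m L
      + ∑ j, betaMoment ν (m j) (∑ i : {i // i ≠ j}, m i)
          * partitionSum ν (fun i : {i // i ≠ j} => m i) L := by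
  have hlt : ∀ k : ℕ, ((k + 1 : ℕ) : ℕ∞) < L + 1 ↔ (k : ℕ∞) < L := fun k => by
    push_cast
    exact ENat.add_lt_add_iff_right (by simp)
  have key : ∀ f : (ι ↪ ℕ) → ENNReal, ∑' a, f a = ∑' b, f (firstStick b) := fun f =>
    ((Equiv.ofBijective _ ⟨firstStick_injective (ι := ι), firstStick_surjective⟩).tsum_eq f).symm
  unfold partitionSum
  rw [key, ENNReal.summable.tsum_sum ENNReal.summable]
  congr 1
  · rw [← ENNReal.tsum_mul_left]
    refine tsum_congr fun a => ?_
    simp only [firstStick_inl, hlt, stickProb_succ hν, mul_ite, mul_zero]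
  · rw [ENNReal.tsum_sigma', tsum_fintype]
    refine Finset.sum_congr rfl fun j _ => ?_
    rw [← ENNReal.tsum_mul_left]
    refine tsum_congr fun a => ?_
    have hiff : (∀ i, (insertFirst j a i : ℕ∞) < L + 1) ↔ ∀ i, (a i : ℕ∞) < L := by
      refine ⟨fun h i => (hlt _).1 (by simpa [insertFirst_coe] using h i), fun h i => ?_⟩
      by_cases hi : i = j
      · subst hi
        rw [insertFirst_self]
        simp
      · rw [insertFirst_coe j a ⟨i, hi⟩]
        exact (hlt _).2 (h _)
    simp only [firstStick_inr, hiff, stickProb_insertFirst hν, mul_ite,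
      mul_zero]

/-- The exchangeable partition probability function of the Dirichlet process. -/
def partitionProb (ν : ℝ) (m : ι → ℕ) : ENNReal :=
  ENNReal.ofReal (ν ^ Fintype.card ι * (∏ j, Real.Gamma (m j)) * Real.Gamma ν
    / Real.Gamma (ν + (∑ j, m j : ℕ)))

/-- Up to the functional equation of Γ, taking class j off the first stick costs exactly its urn
weight. Hence the recursion with the closed form inserted becomes a convex combination. -/
theorem betaMoment_mul_partitionProb {ν : ℝ} (hν : 0 < ν) (m : ι → ℕ) (hm : ∀ j, 0 < m j)
    (j : ι) :
    betaMoment ν (m j) (∑ i : {i // i ≠ j}, m i) * partitionProb ν (fun i : {i // i ≠ j} => m i)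
      = ENNReal.ofReal (m j / (ν + (∑ i, m i : ℕ))) * partitionProb ν m := by
  have hΓ : ∀ i, 0 < Real.Gamma (m i) := fun i =>
    Real.Gamma_pos_of_pos (Nat.cast_pos.2 (hm i))
  set k : ℕ := ∑ i : {i // i ≠ j}, m i with hk
  have hsum : (∑ i, m i : ℕ) = m j + k := Fintype.sum_eq_add_sum_subtype_ne _ j
  have hsum' : ((∑ i, m i : ℕ) : ℝ) = m j + k := by exact_mod_cast hsum
  have hprod : ∏ i, Real.Gamma (m i) = Real.Gamma (m j) * ∏ i : {i // i ≠ j}, Real.Gamma (m i) :=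
    Fintype.prod_eq_mul_prod_subtype_ne _ j
  have hcard : Fintype.card ι = Fintype.card {i // i ≠ j} + 1 := by
    rw [Fintype.card_subtype_compl, Fintype.card_subtype_eq]
    have := Fintype.card_pos_iff.2 ⟨j⟩
    omega
  have h1 : (0 : ℝ) < ν + k := by positivity
  have h2 : (0 : ℝ) < ν + (m j + k) := by positivity
  have g1 := Real.Gamma_pos_of_pos h1
  have g2 := Real.Gamma_pos_of_pos h2
  have g0 := Real.Gamma_pos_of_pos hν
  have hj : (0 : ℝ) < m j := Nat.cast_pos.2 (hm j)
  unfold partitionProb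
  rw [betaMoment_eq hν, ← ENNReal.ofReal_mul (by
      rw [Real.Gamma_add_one hj.ne', show ν + m j + k + 1 = ν + (m j + k) + 1 by ring,
        Real.Gamma_add_one h2.ne']
      have := hΓ j
      positivity), hsum', ← hk, ← ENNReal.ofReal_mul (by positivity)]
  congr 1
  rw [hprod, hcard, Real.Gamma_add_one hj.ne', show ν + m j + k + 1 = ν + (m j + k) + 1 by ring,
    Real.Gamma_add_one h2.ne']
  field_simp
  ring

/-- The closed form is a fixed point of the recursion and dominates at L = 0, where the sum is 1
without classes and 0 otherwise. The induction must range over all class types, since the recursion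
removes a class. -/
theorem partitionSum_nat_le {ν : ℝ} (hν : 0 < ν) (L : ℕ) :
    ∀ (ι : Type) [Fintype ι] [DecidableEq ι] (m : ι → ℕ), (∀ j, 0 < m j) →
      partitionSum ν m L ≤ partitionProb ν m := by
  induction L with
  | zero =>
    intro ι _ _ m hm
    by_cases hι : IsEmpty ι
    · have hΓ := (Real.Gamma_pos_of_pos hν).ne'
      simp [partitionSum, partitionProb, stickProb, stickProd, hΓ]
    · rw [not_isEmpty_iff] at hι
      simp [partitionSum]
  | succ L ih =>
    intro ι _ _ m hm
    rw [Nat.cast_succ, partitionSum_succ hν, betaMoment_zero_left hν]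
    calc _ ≤ ENNReal.ofReal (ν / (ν + (∑ i, m i : ℕ))) * partitionProb ν m
          + ∑ j, betaMoment ν (m j) (∑ i : {i // i ≠ j}, m i)
            * partitionProb ν (fun i : {i // i ≠ j} => m i) := by
          exact add_le_add (mul_le_mul_right (ih ι m hm) _) (Finset.sum_le_sum fun j _ =>
            mul_le_mul_right (ih {i // i ≠ j} (fun i => m i) fun i => hm i) _)
      _ = partitionProb ν m := by
          simp_rw [betaMoment_mul_partitionProb hν m hm, ← Finset.sum_mul, ← add_mul]
          rw [sum_weights hν, one_mul]

theorem partitionSum_top_le {ν : ℝ} (hν : 0 < ν) (m : ι → ℕ) (hm : ∀ j, 0 < m j) :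
    partitionSum ν m ⊤ ≤ partitionProb ν m := by
  unfold partitionSum
  rw [ENNReal.tsum_eq_iSup_sum]
  refine iSup_le fun s => ?_
  -- A finite set of injections uses only sticks below some L, so its partial sum is part of a
  -- truncated one.
  set L : ℕ := s.sup fun a => Finset.univ.sup fun j => a j + 1 with hL
  refine le_trans ?_ (partitionSum_nat_le hν L ι m hm)
  refine le_trans (Finset.sum_le_sum fun a ha => ?_) (ENNReal.sum_le_tsum s)
  have h : ∀ j, (a j : ℕ∞) < (L : ℕ∞) := fun j => by
    have h1 : a j + 1 ≤ Finset.univ.sup fun j => a j + 1 :=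
      Finset.le_sup (f := fun j => a j + 1) (Finset.mem_univ j)
    have h2 := Finset.le_sup (f := fun a : ι ↪ ℕ => Finset.univ.sup fun j => a j + 1) ha
    exact_mod_cast lt_of_lt_of_le (Nat.lt_succ_self _) (h1.trans h2)
  rw [if_pos h]
  split_ifs <;> simp

/-- With infinitely many sticks the series S appears on both sides: S = wS + cΠ, with Π the closed
form, once the claim is known for one class fewer. As w + c = 1 and c ≠ 0, this forces S = Π. The
upper bound supplies S < ∞, without which wS could not be cancelled. -/
theorem partitionSum_top {ν : ℝ} (hν : 0 < ν) (k : ℕ) :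
    ∀ (ι : Type) [Fintype ι] [DecidableEq ι] (m : ι → ℕ), Fintype.card ι = k → (∀ j, 0 < m j) →
      partitionSum ν m ⊤ = partitionProb ν m := by
  induction k with
  | zero =>
    intro ι _ _ m hk hm
    have := Fintype.card_eq_zero_iff.1 hk
    have hΓ := (Real.Gamma_pos_of_pos hν).ne'
    simp [partitionSum, partitionProb, stickProb, stickProd, hΓ]
  | succ k ih =>
    intro ι _ _ m hk hm
    have hne : Nonempty ι := Fintype.card_pos_iff.1 (by omega)
    have hle := partitionSum_top_le hν m hm
    have hfin : partitionProb ν m ≠ ⊤ := ENNReal.ofReal_ne_top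
    have hrec := partitionSum_succ hν m ⊤
    rw [top_add, betaMoment_zero_left hν] at hrec
    have hcard : ∀ j : ι, Fintype.card {i // i ≠ j} = k := fun j => by
      have := Fintype.card_subtype_compl fun i => i = j
      rw [Fintype.card_subtype_eq, hk] at this
      exact this
    have hih : ∀ j : ι, partitionSum ν (fun i : {i // i ≠ j} => m i) ⊤
        = partitionProb ν (fun i : {i // i ≠ j} => m i) := by
      intro j
      apply ih
      · exact hcard j
      · exact fun i => hm i
    simp_rw [hih, betaMoment_mul_partitionProb hν m hm, ← Finset.sum_mul] at hrec
    have hw := sum_weights hν m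
    set w := ENNReal.ofReal (ν / (ν + (∑ i, m i : ℕ))) with hwdef
    set c := ∑ j, ENNReal.ofReal (m j / (ν + (∑ i, m i : ℕ))) with hcdef
    have hN : (0 : ℝ) < ν + (∑ i, m i : ℕ) := by positivity
    have hc0 : c ≠ 0 := by
      obtain ⟨j⟩ := hne
      rw [hcdef]
      refine (lt_of_lt_of_le (ENNReal.ofReal_pos.2 (div_pos (Nat.cast_pos.2 (hm j)) hN))
        (Finset.single_le_sum_of_canonicallyOrdered
          (f := fun j => ENNReal.ofReal (m j / (ν + (∑ i, m i : ℕ)))) (Finset.mem_univ j))).ne'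
    have hwtop : w ≠ ⊤ := ENNReal.ofReal_ne_top
    have hctop : c ≠ ⊤ := fun h => by simp [h] at hw
    have hSfin : partitionSum ν m ⊤ ≠ ⊤ := (lt_of_le_of_lt hle hfin.lt_top).ne
    have h2 : w * partitionSum ν m ⊤ + c * partitionSum ν m ⊤
        = w * partitionSum ν m ⊤ + c * partitionProb ν m := by
      rw [← hrec, ← add_mul, hw, one_mul]
    have h3 := (ENNReal.add_right_inj (ENNReal.mul_ne_top hwtop hSfin)).1 h2
    exact (ENNReal.mul_right_inj hc0 hctop).1 h3

theorem tsum_stickProb {ν : ℝ} (hν : 0 < ν) (m : ι → ℕ) (hm : ∀ j, 0 < m j) :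
    ∑' a : ι ↪ ℕ, stickProb ν m a = partitionProb ν m := by
  rw [← partitionSum_top hν _ ι m rfl hm]
  simp [partitionSum]

/-- Urn probability of an old surface: Γ(m_j + 1) = m_j Γ(m_j) in the numerator and Γ(ν + N + 1) in
the denominator. -/
theorem partitionProb_add_one {ν : ℝ} (hν : 0 < ν) (m m' : ι → ℕ) (hm : ∀ j, 0 < m j) (j : ι)
    (hj : m' j = m j + 1) (h : ∀ i ≠ j, m' i = m i) :
    partitionProb ν m' = ENNReal.ofReal (m j / (ν + (∑ i, m i : ℕ))) * partitionProb ν m := by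
  have hsum : ((∑ i, m' i : ℕ) : ℝ) = (∑ i, m i : ℕ) + 1 := by
    rw [Fintype.sum_eq_add_sum_subtype_ne m' j, hj, Fintype.sum_eq_add_sum_subtype_ne m j,
      Fintype.sum_congr _ _ fun i : {i // i ≠ j} => h i.1 i.2]
    push_cast
    ring
  have hprod : ∏ i, Real.Gamma (m' i) = m j * ∏ i, Real.Gamma (m i) := by
    rw [Fintype.prod_eq_mul_prod_subtype_ne (fun i => Real.Gamma (m' i)) j, hj,
      Fintype.prod_eq_mul_prod_subtype_ne (fun i => Real.Gamma (m i)) j,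
      Fintype.prod_congr _ _ fun i : {i // i ≠ j} => congrArg (fun k : ℕ => Real.Gamma k)
        (h i.1 i.2)]
    push_cast
    rw [Real.Gamma_add_one (Nat.cast_ne_zero.2 (hm j).ne')]
    ring
  have hN : (0 : ℝ) < ν + (∑ i, m i : ℕ) := by positivity
  unfold partitionProb
  rw [← ENNReal.ofReal_mul (by positivity), hsum, hprod, ← add_assoc, Real.Gamma_add_one hN.ne']
  congr 1
  field_simp

/-- Urn probability of a new surface: one more factor ν, with Γ(1) = 1 for the new singleton. -/
theorem partitionProb_snoc {ν : ℝ} (hν : 0 < ν) {K : ℕ} (m : Fin K → ℕ) (m' : Fin (K + 1) → ℕ)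
    (h : ∀ j, m' (Fin.castSucc j) = m j) (hl : m' (Fin.last K) = 1) :
    partitionProb ν m' = ENNReal.ofReal (ν / (ν + (∑ i, m i : ℕ))) * partitionProb ν m := by
  have hN : (0 : ℝ) < ν + (∑ i, m i : ℕ) := by positivity
  unfold partitionProb
  rw [← ENNReal.ofReal_mul (by positivity), Fin.sum_univ_castSucc, Fin.prod_univ_castSucc, hl]
  simp only [h, Nat.cast_one, Real.Gamma_one, mul_one, Fintype.card_fin]
  rw [Nat.cast_succ, ← add_assoc, Real.Gamma_add_one hN.ne']
  congr 1
  field_simp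
  ring

end Partition

/-! ### Moments of the stick-breaking weights -/

/-- Extend finitely many sticks by zero. -/
def extendStick {L : ℕ} (v : Fin L → ℝ) (r : ℕ) : ℝ := if h : r < L then v ⟨r, h⟩ else 0

theorem measurable_extendStick {L : ℕ} (r : ℕ) :
    Measurable fun v : Fin L → ℝ => extendStick v r := by
  unfold extendStick
  split_ifs <;> fun_prop

theorem measurable_stickWeight (l : ℕ) : Measurable fun v : ℕ → ℝ => stickWeight v l := by
  unfold stickWeight
  fun_prop

theorem stickWeight_congr {v w : ℕ → ℝ} {l : ℕ} (h : ∀ r ≤ l, v r = w r) :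
    stickWeight v l = stickWeight w l := by
  unfold stickWeight
  rw [h l le_rfl, Finset.prod_congr rfl fun r hr => by rw [h r (Finset.mem_range.1 hr).le]]

/-- Every stick below a common bound contributes a factor, possibly 1, so that products of weights
can be regrouped stick by stick. -/
theorem stickWeight_eq_prod (v : ℕ → ℝ) {l L : ℕ} (hl : l < L) :
    stickWeight v l = ∏ r ∈ Finset.range L,
      ((if l = r then v r else 1) * if r < l then 1 - v r else 1) := by
  rw [Finset.prod_mul_distrib, Finset.prod_ite_eq, if_pos (Finset.mem_range.2 hl), stickWeight,
    ← Finset.prod_filter]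
  congr 2
  ext r
  simp only [Finset.mem_range, Finset.mem_filter]
  omega

theorem ae_betaMeasure_mem (ν : ℝ) : ∀ᵐ v ∂betaMeasure 1 ν, 0 ≤ v ∧ v ≤ 1 := by
  rw [betaMeasure, ae_withDensity_iff (by unfold betaPDF; fun_prop)]
  refine ae_of_all _ fun v hv => ?_
  rw [betaPDF_eq] at hv
  split_ifs at hv with h
  · exact ⟨h.1.le, h.2.le⟩
  · simp at hv

theorem lintegral_pi_prod {κ : Type*} [Fintype κ] {α : Type*} [MeasurableSpace α]
    (μ : Measure α) [IsProbabilityMeasure μ] {f : κ → α → ENNReal} (hf : ∀ i, Measurable (f i)) :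
    ∫⁻ v, ∏ i, f i (v i) ∂(Measure.pi fun _ : κ => μ) = ∏ i, ∫⁻ x, f i x ∂μ := by
  have h := lintegral_prod_eq_prod_lintegral_of_indepFun Finset.univ
    (fun i (v : κ → α) => f i (v i)) (iIndepFun_pi (μ := fun _ : κ => μ)
      fun i => (hf i).aemeasurable) fun i => (hf i).comp (measurable_pi_apply i)
  rw [h]
  refine Finset.prod_congr rfl fun i _ => ?_
  rw [← lintegral_map (hf i) (measurable_pi_apply i)]
  congr 1
  exact (measurePreserving_eval (fun _ : κ => μ) i).map_eq

theorem map_pi_comp_embedding {ι κ : Type*} [Fintype ι] [Fintype κ] {α : Type*}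
    [MeasurableSpace α] (μ : Measure α) [IsProbabilityMeasure μ] {a : ι → κ}
    (ha : Function.Injective a) :
    (Measure.pi fun _ : κ => μ).map (fun e j => e (a j)) = Measure.pi fun _ : ι => μ := by
  have h := (iIndepFun_pi (μ := fun _ : κ => μ) (X := fun _ => id)
    fun i => aemeasurable_id).precomp ha
  refine ((iIndepFun_iff_map_fun_eq_pi_map (f := fun j (e : κ → α) => e (a j))
    (μ := Measure.pi fun _ => μ) fun i => (measurable_pi_apply _).aemeasurable).1 h).trans ?_
  congr 1
  funext i
  exact (measurePreserving_eval (fun _ : κ => μ) (a i)).map_eq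

/-- Number of the positions of a word which carry the letter `j`. -/
def letterCount {N : ℕ} {ι : Type} [DecidableEq ι] (z : Fin N → ι) (j : ι) : ℕ :=
  (Finset.univ.filter fun i => z i = j).card

/-- Regrouped by sticks, the product is ∏ V_r^hits (1 - V_r)^passes, and independence of the sticks
factors the expectation into Beta moments. -/
theorem lintegral_prod_stickWeight {ν : ℝ} (hν : 0 < ν) {ι : Type} [Fintype ι] [DecidableEq ι]
    {N L : ℕ} (z : Fin N → ι) (a : ι → ℕ) (ha : ∀ j, a j < L) :
    ∫⁻ v, ∏ i, ENNReal.ofReal (stickWeight (extendStick v) (a (z i)))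
        ∂(Measure.pi fun _ : Fin L => betaMeasure 1 ν)
      = stickProb ν (letterCount z) a := by
  have := isProbabilityMeasureBeta one_pos hν
  rw [← stickProd_eq_stickProb hν _ a ha, stickProd, ← Fin.prod_univ_eq_prod_range
    (fun r => betaMoment ν (∑ j, if a j = r then letterCount z j else 0)
      (∑ j, if r < a j then letterCount z j else 0)) L]
  unfold betaMoment
  rw [← lintegral_pi_prod (betaMeasure 1 ν)
    (f := fun (r : Fin L) v => ENNReal.ofReal (v ^ (∑ j, if a j = r then letterCount z j else 0)
      * (1 - v) ^ (∑ j, if r < a j then letterCount z j else 0))) fun r => by fun_prop]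
  -- Nonnegativity almost surely, since `ENNReal.ofReal` commutes with products only of nonnegative
  -- factors.
  have hae : ∀ᵐ v ∂(Measure.pi fun _ : Fin L => betaMeasure 1 ν), ∀ r, 0 ≤ v r ∧ v r ≤ 1 :=
    ae_all_iff.2 fun r => (Measure.quasiMeasurePreserving_eval
      (μ := fun _ : Fin L => betaMeasure 1 ν) r).ae (ae_betaMeasure_mem ν)
  refine lintegral_congr_ae ?_
  filter_upwards [hae] with v hv
  have hext : ∀ r, 0 ≤ extendStick v r ∧ extendStick v r ≤ 1 := fun r => by
    unfold extendStick; split_ifs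
    · exact hv _
    · simp
  have hw : ∀ l, 0 ≤ stickWeight (extendStick v) l := fun l =>
    mul_nonneg (hext l).1 (Finset.prod_nonneg fun r _ => sub_nonneg.2 (hext r).2)
  rw [← ENNReal.ofReal_prod_of_nonneg fun i _ => hw _, ← ENNReal.ofReal_prod_of_nonneg fun r _ =>
    mul_nonneg (pow_nonneg (hv r).1 _) (pow_nonneg (sub_nonneg.2 (hv r).2) _)]
  congr 1
  have h1 : ∏ i, stickWeight (extendStick v) (a (z i))
      = ∏ j, stickWeight (extendStick v) (a j) ^ letterCount z j := by
    rw [← Finset.prod_fiberwise Finset.univ z]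
    refine Finset.prod_congr rfl fun j _ => ?_
    rw [letterCount, ← Finset.prod_const]
    exact Finset.prod_congr rfl fun i hi => by rw [(Finset.mem_filter.1 hi).2]
  rw [h1]
  simp_rw [stickWeight_eq_prod (extendStick v) (ha _), ← Finset.prod_pow]
  rw [Finset.prod_comm, ← Fin.prod_univ_eq_prod_range
    (fun r => ∏ j, ((if a j = r then extendStick v r else 1)
      * if r < a j then 1 - extendStick v r else 1) ^ letterCount z j) L]
  refine Finset.prod_congr rfl fun r _ => ?_
  have hr : extendStick v r = v r := by simp [extendStick]
  simp_rw [mul_pow, Finset.prod_mul_distrib, hr, ← Finset.prod_pow_eq_pow_sum]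
  congr 1 <;> refine Finset.prod_congr rfl fun j _ => ?_ <;> split_ifs <;> simp

/-! ### Conditional laws as disintegrations -/

section CondLaw

variable {Ω α β γ δ : Type*} [MeasurableSpace Ω] [MeasurableSpace α] [MeasurableSpace β]
  [MeasurableSpace γ] [MeasurableSpace δ] {P : Measure Ω}

/-- `κ` is a version of the conditional law of `Y` given `X`. -/
def CondLaw (P : Measure Ω) (X : Ω → α) (Y : Ω → β) (κ : α → Measure β) : Prop :=
  ∀ f : α × β → ENNReal, Measurable f →
    ∫⁻ ω, f (X ω, Y ω) ∂P = ∫⁻ ω, ∫⁻ y, f (X ω, y) ∂κ (X ω) ∂P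

theorem CondLaw.congr {X : Ω → α} {Y : Ω → β} {κ κ' : α → Measure β} (h : CondLaw P X Y κ)
    (hX : Measurable X) (hκ : ∀ᵐ c ∂P.map X, κ c = κ' c) : CondLaw P X Y κ' := fun f hf => by
  rw [h f hf]
  refine lintegral_congr_ae ?_
  filter_upwards [ae_of_ae_map hX.aemeasurable hκ] with ω hω
  rw [hω]

/-- Tower property: a conditional law that sees X only through g(X) is also the conditional law
given g(X). It is used throughout to drop superfluous conditioning. -/
theorem CondLaw.comp_left {X : Ω → α} {Y : Ω → β} {g : α → δ} {κ : δ → Measure β}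
    (h : CondLaw P X Y fun a => κ (g a)) (hg : Measurable g) :
    CondLaw P (fun ω => g (X ω)) Y κ := fun f hf =>
  h (fun p => f (g p.1, p.2)) (hf.comp ((hg.comp measurable_fst).prodMk measurable_snd))

theorem CondLaw.map {X : Ω → α} {Y : Ω → β} {κ : α → Measure β} (h : CondLaw P X Y κ)
    {φ : α × β → γ} (hφ : Measurable φ) :
    CondLaw P X (fun ω => φ (X ω, Y ω)) fun a => (κ a).map fun y => φ (a, y) := fun f hf => by
  rw [h (fun p => f (p.1, φ p)) (hf.comp (measurable_fst.prodMk hφ))]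
  refine lintegral_congr fun ω => ?_
  rw [lintegral_map (f := fun y => f (X ω, y)) (g := fun y => φ (X ω, y))
    (hf.comp measurable_prodMk_left) (hφ.comp measurable_prodMk_left)]

variable [IsProbabilityMeasure P]

theorem condLaw_of_condDistrib [StandardBorelSpace β] [Nonempty β] {X : Ω → α} {Y : Ω → β}
    (hX : Measurable X) (hY : Measurable Y) {κ : α → Measure β}
    (h : ∀ᵐ c ∂P.map X, condDistrib Y X P c = κ c) : CondLaw P X Y κ := fun f hf => by
  rw [← lintegral_map hf (hX.prodMk hY), ← compProd_map_condDistrib hY.aemeasurable,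
    Measure.lintegral_compProd hf, lintegral_map hf.lintegral_kernel_prod_right' hX]
  refine lintegral_congr_ae ?_
  filter_upwards [ae_of_ae_map hX.aemeasurable h] with ω hω
  rw [hω]

/-- Test functions of X alone show that the total mass integrates like 1 over every set. -/
theorem CondLaw.ae_univ {X : Ω → α} {Y : Ω → β} (hX : Measurable X)
    {κ : α → Measure β} (hκ : Measurable κ) (h : CondLaw P X Y κ) :
    ∀ᵐ c ∂P.map X, κ c Set.univ = 1 := by
  have := Measure.isProbabilityMeasure_map (μ := P) hX.aemeasurable
  have hm : Measurable fun c => κ c Set.univ := (Measure.measurable_coe MeasurableSet.univ).comp hκ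
  refine ae_eq_of_forall_setLIntegral_eq_of_sigmaFinite hm measurable_const fun s hs _ => ?_
  have h1 := h (fun p => s.indicator 1 p.1) ((measurable_one.indicator hs).comp measurable_fst)
  simp only [lintegral_const] at h1
  rw [← lintegral_indicator hs, ← lintegral_indicator hs, lintegral_map (hm.indicator hs) hX,
    lintegral_map (measurable_const.indicator hs) hX]
  refine Eq.trans ?_ (h1.symm.trans ?_) <;> refine lintegral_congr fun ω => ?_ <;>
    by_cases hω : X ω ∈ s <;> simp [hω]

/-- The explicit mixtures need not have mass 1 at inadmissible parameters or arbitrary words. On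
that null set they are replaced by a Dirac mass, so that the theory of Markov kernels applies. -/
theorem CondLaw.exists_kernel [Nonempty β] {X : Ω → α} {Y : Ω → β} (hX : Measurable X)
    {κ : α → Measure β} (hκ : Measurable κ) (h : CondLaw P X Y κ) :
    ∃ κ' : Kernel α β, IsMarkovKernel κ' ∧ ∀ᵐ c ∂P.map X, κ' c = κ c := by
  classical
  have hm : Measurable fun c => κ c Set.univ := (Measure.measurable_coe MeasurableSet.univ).comp hκ
  obtain ⟨b⟩ := ‹Nonempty β›
  refine ⟨⟨fun c => if κ c Set.univ = 1 then κ c else Measure.dirac b,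
    Measurable.ite (hm (measurableSet_singleton 1)) hκ measurable_const⟩, ⟨fun c => ?_⟩, ?_⟩
  · change IsProbabilityMeasure (if κ c Set.univ = 1 then κ c else Measure.dirac b)
    split_ifs with hc
    · exact ⟨hc⟩
    · infer_instance
  · filter_upwards [h.ae_univ hX hκ] with c hc
    exact if_pos hc

theorem CondLaw.condDistrib_eq [StandardBorelSpace β] [Nonempty β] {X : Ω → α} {Y : Ω → β}
    (hX : Measurable X) (hY : Measurable Y) {κ : α → Measure β} (hκ : Measurable κ)
    (h : CondLaw P X Y κ) : ∀ᵐ c ∂P.map X, condDistrib Y X P c = κ c := by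
  obtain ⟨κ', _, hae⟩ := h.exists_kernel hX hκ
  have h' : CondLaw P X Y κ' := h.congr hX (hae.mono fun _ h => h.symm)
  have heq : P.map (fun ω => (X ω, Y ω)) = P.map X ⊗ₘ κ' := by
    refine Measure.ext_of_lintegral _ fun f hf => ?_
    rw [lintegral_map hf (hX.prodMk hY), h' f hf, Measure.lintegral_compProd hf,
      lintegral_map hf.lintegral_kernel_prod_right' hX]
  filter_upwards [condDistrib_ae_eq_of_measure_eq_compProd X hY.aemeasurable heq, hae]
    with c h1 h2
  rw [h1, h2]

theorem measurable_map_kernel (κ : Kernel α β) [IsMarkovKernel κ] {φ : α × β → γ}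
    (hφ : Measurable φ) : Measurable fun c => (κ c).map fun y => φ (c, y) := by
  refine Measure.measurable_of_measurable_coe _ fun s hs => ?_
  have : ∀ c, (κ c).map (fun y => φ (c, y)) s = κ c (Prod.mk c ⁻¹' (φ ⁻¹' s)) := fun c => by
    rw [Measure.map_apply (f := fun y => φ (c, y)) (hφ.comp measurable_prodMk_left) hs]; rfl
  simp_rw [this]
  exact Kernel.measurable_kernel_prodMk_left (hφ hs)

/-- The hypothesis is conditional independence of Y and D given X, because κ ignores the second
component. Given D, one may then draw X from its posterior and Y from κ(X). -/
theorem CondLaw.posterior [StandardBorelSpace α] [Nonempty α] [Nonempty β]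
    [StandardBorelSpace γ] [Nonempty γ] {X : Ω → α} {D : Ω → δ} {Y : Ω → β}
    (hX : Measurable X) (hD : Measurable D) (hY : Measurable Y) {κ : α → Measure β}
    (hκ : Measurable κ) (h : CondLaw P (fun ω => (X ω, D ω)) Y fun c => κ c.1)
    {φ : α × β → γ} (hφ : Measurable φ) :
    ∀ᵐ H ∂P.map D, condDistrib (fun ω => φ (X ω, Y ω)) D P H
      = (condDistrib X D P H).bind fun c => (κ c).map fun y => φ (c, y) := by
  have hXY : CondLaw P X Y κ := h.comp_left (g := Prod.fst) measurable_fst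
  obtain ⟨κ', _, hae⟩ := hXY.exists_kernel hX hκ
  have hpush := measurable_map_kernel κ' hφ
  have hbind : Measurable fun H => (condDistrib X D P H).bind fun c =>
      (κ' c).map fun y => φ (c, y) :=
    (Measure.measurable_bind' hpush).comp (condDistrib X D P).measurable
  have hlaw : CondLaw P D (fun ω => φ (X ω, Y ω)) fun H =>
      (condDistrib X D P H).bind fun c => (κ' c).map fun y => φ (c, y) := fun f hf => by
    rw [h (fun p => f (p.1.2, φ (p.1.1, p.2))) (hf.comp ((measurable_snd.comp measurable_fst).prodMk
      (hφ.comp ((measurable_fst.comp measurable_fst).prodMk measurable_snd))))]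
    have h1 : ∀ᵐ ω ∂P, ∫⁻ y, f (D ω, φ (X ω, y)) ∂κ (X ω)
        = ∫⁻ y, f (D ω, φ (X ω, y)) ∂κ' (X ω) := by
      filter_upwards [ae_of_ae_map hX.aemeasurable hae] with ω hω
      rw [hω]
    have hg : Measurable fun p : δ × α => ∫⁻ y, f (p.1, φ (p.2, y)) ∂κ' p.2 :=
      Measurable.lintegral_kernel_prod_right' (κ := κ'.comap Prod.snd measurable_snd)
        (f := fun q : (δ × α) × β => f (q.1.1, φ (q.1.2, q.2)))
        (hf.comp ((measurable_fst.comp measurable_fst).prodMk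
          (hφ.comp ((measurable_snd.comp measurable_fst).prodMk measurable_snd))))
    rw [lintegral_congr_ae h1, (condLaw_of_condDistrib hD hX (ae_of_all _ fun _ => rfl))
      (fun p : δ × α => ∫⁻ y, f (p.1, φ (p.2, y)) ∂κ' p.2) hg]
    refine lintegral_congr fun ω => ?_
    rw [Measure.lintegral_bind (f := fun y => f (D ω, y)) hpush.aemeasurable
      (hf.comp measurable_prodMk_left).aemeasurable]
    refine lintegral_congr fun c => ?_
    rw [lintegral_map (f := fun y => f (D ω, y)) (g := fun y => φ (c, y))
      (hf.comp measurable_prodMk_left) (hφ.comp measurable_prodMk_left)]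
  -- The law of X is the mixture of its posteriors, so a null set for X is null for almost every
  -- posterior.
  have hcomp : ∀ᵐ H ∂P.map D, ∀ᵐ c ∂condDistrib X D P H, κ' c = κ c := by
    refine Measure.ae_ae_of_ae_comp ?_
    rwa [condDistrib_comp_map hD.aemeasurable hX.aemeasurable]
  filter_upwards [hlaw.condDistrib_eq hD
    (show Measurable fun ω => φ (X ω, Y ω) from hφ.comp (hX.prodMk hY)) hbind, hcomp] with H h1 h2
  rw [h1]
  refine Measure.bind_congr_right ?_
  filter_upwards [h2] with c hc
  rw [hc]

/-- Associativity of integration, passing through the Markov modification because κ is a probability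
only almost surely. It merges the two integrals in ∫∫ A B C. -/
theorem CondLaw.bind_posterior {ζ : Type*} [MeasurableSpace ζ] [StandardBorelSpace α] [Nonempty α]
    [Nonempty β] {X : Ω → α} {D : Ω → δ} {Y : Ω → β}
    (hX : Measurable X) (hD : Measurable D) {κ : α → Measure β}
    (hκ : Measurable κ) (h : CondLaw P X Y κ)
    {φ : α × β → γ} (hφ : Measurable φ) {ρ : γ → Measure ζ} (hρ : Measurable ρ) :
    ∀ᵐ H ∂P.map D, ((condDistrib X D P H).bind fun c => (κ c).map fun y => φ (c, y)).bind ρ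
      = (condDistrib X D P H).bind fun c => (κ c).bind fun y => ρ (φ (c, y)) := by
  obtain ⟨κ', _, hae⟩ := h.exists_kernel hX hκ
  have hcomp : ∀ᵐ H ∂P.map D, ∀ᵐ c ∂condDistrib X D P H, κ' c = κ c := by
    refine Measure.ae_ae_of_ae_comp ?_
    rwa [condDistrib_comp_map hD.aemeasurable hX.aemeasurable]
  filter_upwards [hcomp] with H h2
  rw [Measure.bind_congr_right (g := fun c => (κ' c).map fun y => φ (c, y))
    (h2.mono fun c hc => by simp only [hc]),
    Measure.bind_bind (measurable_map_kernel κ' hφ).aemeasurable hρ.aemeasurable]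
  refine Measure.bind_congr_right (h2.mono fun c hc => ?_)
  have hc' : Measurable fun y => φ (c, y) := hφ.comp measurable_prodMk_left
  simp only [hc]
  ext s hs
  rw [Measure.bind_apply hs hρ.aemeasurable, Measure.bind_apply (f := fun y => ρ (φ (c, y))) hs
      (hρ.comp hc').aemeasurable]
  exact lintegral_map ((Measure.measurable_coe hs).comp hρ) hc'

/-- Symmetry of conditional independence: if N depends on (X, Y) only through X, then Y depends on
(X, N) only through X. Integrate N, then Y, exchange by Tonelli, and read the result backwards. -/
theorem CondLaw.add_noise [Nonempty β] {X : Ω → α} {Y : Ω → β} {N : Ω → δ}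
    (hX : Measurable X) {κ : α → Measure β} (hκ : Measurable κ)
    {ν : α → Measure δ} (hν : Measurable ν) [∀ a, IsProbabilityMeasure (ν a)]
    (h : CondLaw P X Y κ) (hN : CondLaw P (fun ω => (X ω, Y ω)) N fun c => ν c.1) :
    CondLaw P (fun ω => (X ω, N ω)) Y fun c => κ c.1 := by
  obtain ⟨κ', _, hae⟩ := h.exists_kernel hX hκ
  have hae' := ae_of_ae_map hX.aemeasurable hae
  have h' : CondLaw P X Y κ' := h.congr hX (hae.mono fun _ h => h.symm)
  have hNX : CondLaw P X N ν := hN.comp_left (g := Prod.fst) measurable_fst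
  let νk : Kernel α δ := ⟨ν, hν⟩
  have : IsMarkovKernel νk := ⟨fun a => inferInstanceAs (IsProbabilityMeasure (ν a))⟩
  intro f hf
  have e1 := hN (fun p => f ((p.1.1, p.2), p.1.2)) (by fun_prop)
  have m1 : Measurable fun p : α × β => ∫⁻ e, f ((p.1, e), p.2) ∂ν p.1 :=
    Measurable.lintegral_kernel_prod_right' (κ := νk.comap Prod.fst measurable_fst)
      (f := fun q : (α × β) × δ => f ((q.1.1, q.2), q.1.2)) (by fun_prop)
  have e2 := h' (fun p => ∫⁻ e, f ((p.1, e), p.2) ∂ν p.1) m1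
  have m2 : Measurable fun p : α × δ => ∫⁻ y, f ((p.1, p.2), y) ∂κ' p.1 :=
    Measurable.lintegral_kernel_prod_right' (κ := κ'.comap Prod.fst measurable_fst)
      (f := fun q : (α × δ) × β => f ((q.1.1, q.1.2), q.2)) (by fun_prop)
  have e3 := hNX (fun p => ∫⁻ y, f ((p.1, p.2), y) ∂κ' p.1) m2
  refine e1.trans (e2.trans (Eq.trans ?_ (e3.symm.trans (lintegral_congr_ae ?_))))
  · refine lintegral_congr fun ω => lintegral_lintegral_swap (μ := κ' (X ω)) (ν := ν (X ω))
      (f := fun y e => f ((X ω, e), y)) ?_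
    exact (hf.comp (by fun_prop : Measurable fun q : β × δ => ((X ω, q.2), q.1))).aemeasurable
  · filter_upwards [hae'] with ω hω
    simp only [hω]

end CondLaw

/-! ### Order of first appearance -/

section Appearance

variable {c z : ℕ → ℕ} {n N K : ℕ}

theorem appearance_succ (c : ℕ → ℕ) (n : ℕ) : appearance c (n + 1)
    = if c n ∈ appearance c n then appearance c n else appearance c n ++ [c n] := rfl

theorem mem_appearance_iff {l : ℕ} : l ∈ appearance c n ↔ ∃ i < n, c i = l := by
  induction n with
  | zero => simp [appearance]
  | succ n ih =>
    rw [appearance_succ]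
    split_ifs with h
    · rw [ih]
      refine ⟨fun ⟨i, hi, e⟩ => ⟨i, by omega, e⟩, fun ⟨i, hi, e⟩ => ?_⟩
      rcases Nat.lt_succ_iff_lt_or_eq.1 hi with hi | rfl
      · exact ⟨i, hi, e⟩
      · rw [← e]; exact ih.1 (e ▸ h)|>.elim fun j hj => ⟨j, hj.1, hj.2.trans e.symm⟩
    · rw [List.mem_append, ih, List.mem_singleton]
      constructor
      · rintro (⟨i, hi, e⟩ | rfl)
        · exact ⟨i, by omega, e⟩
        · exact ⟨n, by omega, rfl⟩
      · rintro ⟨i, hi, e⟩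
        rcases Nat.lt_succ_iff_lt_or_eq.1 hi with hi | rfl
        · exact Or.inl ⟨i, hi, e⟩
        · exact Or.inr e.symm

theorem mem_appearance {i : ℕ} (hi : i < n) : c i ∈ appearance c n :=
  mem_appearance_iff.2 ⟨i, hi, rfl⟩

theorem nodup_appearance : (appearance c n).Nodup := by
  induction n with
  | zero => simp [appearance]
  | succ n ih =>
    rw [appearance_succ]
    split_ifs with h
    · exact ih
    · exact List.nodup_append.2 ⟨ih, List.nodup_singleton _, by
        rintro a ha b hb rfl; exact h (List.mem_singleton.1 hb ▸ ha)⟩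

theorem appearance_prefix_succ : appearance c n <+: appearance c (n + 1) := by
  rw [appearance_succ]
  split_ifs
  · exact List.prefix_rfl
  · exact List.prefix_append _ _

theorem appearance_prefix (h : n ≤ N) : appearance c n <+: appearance c N := by
  induction N, h using Nat.le_induction with
  | base => exact List.prefix_rfl
  | succ N _ ih => exact ih.trans appearance_prefix_succ

theorem appearance_congr (h : ∀ i < n, c i = z i) : appearance c n = appearance z n := by
  induction n with
  | zero => rfl
  | succ n ih =>
    rw [appearance_succ, appearance_succ, ih fun i hi => h i (by omega), h n (by omega)]

theorem idxOf_appearance {i : ℕ} (hi : i < n) :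
    (appearance c n).idxOf (c i) = appearanceLabel c i := by
  obtain ⟨t, ht⟩ := appearance_prefix (c := c) (Nat.succ_le_of_lt hi)
  rw [appearanceLabel, ← ht, List.idxOf_append_of_mem (mem_appearance (Nat.lt_succ_self i))]

theorem appearanceLabel_lt {i : ℕ} (hi : i < n) : appearanceLabel c i < (appearance c n).length := by
  rw [← idxOf_appearance hi]
  exact List.idxOf_lt_length_of_mem (mem_appearance hi)

theorem getElem_appearanceLabel {i : ℕ} (hi : i < n) :
    (appearance c n)[appearanceLabel c i]'(appearanceLabel_lt hi) = c i := by
  simp only [← idxOf_appearance hi, List.getElem_idxOf]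

/-- Labels are issued in the order 0, 1, 2, …. Words with this property are exactly the possible
values of the assignments. -/
theorem appearance_appearanceLabel :
    appearance (appearanceLabel c) n = List.range (appearance c n).length := by
  induction n with
  | zero => simp [appearance]
  | succ n ih =>
    rw [appearance_succ, ih, appearance_succ c]
    by_cases h : c n ∈ appearance c n
    · have hl : appearanceLabel c n < (appearance c n).length := by
        rw [appearanceLabel, appearance_succ, if_pos h]
        exact List.idxOf_lt_length_of_mem h
      rw [if_pos h, if_pos (List.mem_range.2 hl)]
    · have hl : appearanceLabel c n = (appearance c n).length := by
        rw [appearanceLabel, appearance_succ, if_neg h, List.idxOf_append_of_notMem h]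
        simp
      rw [if_neg h, hl, if_neg (by simp), List.length_append, List.length_singleton,
        List.range_succ]

theorem lt_of_appearance_eq_range (hz : appearance z N = List.range K) {i : ℕ} (hi : i < N) :
    z i < K :=
  List.mem_range.1 (hz ▸ mem_appearance hi)

theorem exists_of_appearance_eq_range (hz : appearance z N = List.range K) (j : Fin K) :
    ∃ i : Fin N, z i = j := by
  obtain ⟨i, hi, e⟩ := mem_appearance_iff.1 (hz ▸ List.mem_range.2 j.2)
  exact ⟨⟨i, hi⟩, e⟩

/-- A word in order of appearance, as a map onto its letters. -/
def letters (hz : appearance z N = List.range K) (i : Fin N) : Fin K :=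
  ⟨z i, lt_of_appearance_eq_range hz i.2⟩

/-- An injective renaming preserves which letters are repetitions, so it carries the list of first
appearances along. The value 0 outside the alphabet is never used. -/
theorem appearance_map (hz : appearance z N = List.range K) (a : Fin K ↪ ℕ)
    (h : ∀ i, c i.1 = a (letters hz i)) (k : ℕ) (hk : k ≤ N) :
    appearance c k = (appearance z k).map fun j => if hj : j < K then a ⟨j, hj⟩ else 0 := by
  have hc : ∀ i, i < N → c i = if hj : z i < K then a ⟨z i, hj⟩ else 0 := fun i hi => by
    rw [dif_pos (lt_of_appearance_eq_range hz hi)]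
    exact h ⟨i, hi⟩
  induction k with
  | zero => simp [appearance]
  | succ k ih =>
    have ihk := ih (by omega)
    have hmem : c k ∈ appearance c k ↔ z k ∈ appearance z k := by
      rw [mem_appearance_iff, mem_appearance_iff]
      refine exists_congr fun i => and_congr_right fun hi => ?_
      rw [show c i = _ from h ⟨i, by omega⟩, show c k = _ from h ⟨k, by omega⟩,
        a.injective.eq_iff]
      simp [letters]
    rw [appearance_succ, appearance_succ]
    by_cases hzk : z k ∈ appearance z k
    · rw [if_pos (hmem.2 hzk), if_pos hzk, ihk]
    · rw [if_neg (mt hmem.1 hzk), if_neg hzk, ihk, hc k (by omega), List.map_append,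
        List.map_singleton]

theorem appearance_eq_of_letters (hz : appearance z N = List.range K) (a : Fin K ↪ ℕ)
    (h : ∀ i, c i.1 = a (letters hz i)) : appearance c N = List.ofFn a := by
  rw [appearance_map hz a h N le_rfl, hz]
  refine List.ext_getElem (by simp) fun j h1 h2 => ?_
  have : j < K := by simpa using h1
  simp [this]

theorem appearanceLabel_eq_of_letters (hz : appearance z N = List.range K) (a : Fin K ↪ ℕ)
    (h : ∀ i, c i.1 = a (letters hz i)) {i : ℕ} (hi : i < N) : appearanceLabel c i = z i := by
  rw [← idxOf_appearance hi, appearance_eq_of_letters hz a h, show c i = _ from h ⟨i, hi⟩]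
  have hlt : (letters hz ⟨i, hi⟩ : ℕ) < (List.ofFn a).length := by simp
  have hnd : (List.ofFn a).Nodup := List.nodup_ofFn.2 a.injective
  have := hnd.idxOf_getElem _ hlt
  simpa [letters] using this

/-- Decomposes the event of a given assignment word by the sticks that carry its letters;
`letters_unique` makes the union disjoint. The witness sends j to the j-th index to appear. -/
theorem exists_letters_iff (hz : appearance z N = List.range K) :
    (∀ i < N, appearanceLabel c i = z i) ↔ ∃ a : Fin K ↪ ℕ, ∀ i, c i.1 = a (letters hz i) := by
  refine ⟨fun h => ?_, fun ⟨a, ha⟩ i hi => appearanceLabel_eq_of_letters hz a ha hi⟩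
  have hlen : (appearance c N).length = K := by
    have h1 := appearance_appearanceLabel (c := c) (n := N)
    rw [appearance_congr h, hz] at h1
    simpa using congrArg List.length h1.symm
  refine ⟨⟨fun j => (appearance c N)[(j : ℕ)]'(hlen.symm ▸ j.2), fun j k hjk => ?_⟩, fun i => ?_⟩
  · exact Fin.ext ((nodup_appearance.getElem_inj_iff).1 hjk)
  · change c i = (appearance c N)[z i]'_
    rw [← getElem_appearanceLabel (c := c) i.2]
    simp only [h i i.2]
    rfl

theorem letters_unique (hz : appearance z N = List.range K) {a b : Fin K ↪ ℕ}
    (ha : ∀ i, c i.1 = a (letters hz i)) (hb : ∀ i, c i.1 = b (letters hz i)) : a = b := by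
  ext j
  obtain ⟨i, hi⟩ := exists_of_appearance_eq_range hz j
  have hj : letters hz i = j := Fin.ext hi
  rw [← hj, ← ha, ← hb]

theorem numSurfaces_eq (z : ℕ → ℕ) (n : ℕ) :
    numSurfaces (fun i : Fin n => z i) = (appearance z n).length := by
  rw [numSurfaces, ← List.toFinset_card_of_nodup nodup_appearance]
  congr 1
  ext l
  simp only [Finset.mem_image, Finset.mem_univ, true_and, List.mem_toFinset, mem_appearance_iff]
  exact ⟨fun ⟨i, e⟩ => ⟨i, i.2, e⟩, fun ⟨i, hi, e⟩ => ⟨⟨i, hi⟩, e⟩⟩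

theorem letterCount_letters (hz : appearance z N = List.range K) (j : Fin K) :
    letterCount (letters hz) j = surfaceCount (fun i : Fin N => z i) j := by
  unfold letterCount surfaceCount
  congr 1
  ext i
  simp [letters, Fin.ext_iff]

theorem letterCount_pos (hz : appearance z N = List.range K) (j : Fin K) :
    0 < letterCount (letters hz) j := by
  obtain ⟨i, hi⟩ := exists_of_appearance_eq_range hz j
  exact Finset.card_pos.2 ⟨i, by simp [letters, Fin.ext_iff, hi]⟩

theorem sum_letterCount {ι : Type} [Fintype ι] [DecidableEq ι] (z : Fin N → ι) :
    ∑ j, letterCount z j = N := by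
  have := Finset.card_eq_sum_card_fiberwise (f := z) (s := Finset.univ) (t := Finset.univ)
    (by simp)
  simpa [letterCount] using this.symm

/-- The word `z` followed by the letter `j`. -/
def extendWord (z : Fin n → ℕ) (j i : ℕ) : ℕ := if h : i < n then z ⟨i, h⟩ else j

theorem extendWord_coe (z : Fin n → ℕ) (j : ℕ) (i : Fin n) : extendWord z j i = z i := by
  simp [extendWord]

theorem extendWord_last (z : Fin n → ℕ) (j : ℕ) : extendWord z j n = j := by
  simp [extendWord]

theorem appearance_extendWord (z : Fin n → ℕ) (j k : ℕ) :
    appearance (extendWord z j) n = appearance (extendWord z k) n :=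
  appearance_congr fun i hi => by simp [extendWord, hi]

theorem surfaceCount_extendWord (z : Fin n → ℕ) (j k : ℕ) :
    surfaceCount (fun i : Fin (n + 1) => extendWord z j i) k
      = surfaceCount z k + if j = k then 1 else 0 := by
  unfold surfaceCount
  rw [Fin.univ_castSuccEmb, Finset.filter_cons]
  simp only [Fin.val_last, extendWord_last, Finset.filter_map, Function.comp_def,
    Fin.coe_castSuccEmb, Fin.val_castSucc, extendWord_coe]
  split_ifs <;> simp

end Appearance

/-! ### Measurability in the concentration parameter -/

theorem measurable_indicator_Gamma : Measurable ((Set.Ioi (0 : ℝ)).indicator Real.Gamma) := by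
  classical
  rw [← Set.piecewise_eq_indicator]
  refine ContinuousOn.measurable_piecewise (fun s hs => ?_) continuousOn_const measurableSet_Ioi
  exact (Real.differentiableAt_Gamma fun m =>
    ((neg_nonpos.mpr m.cast_nonneg).trans_lt hs).ne').continuousAt.continuousWithinAt

/-- Γ is only used on the positive half-line, where continuity gives measurability; cutting it off
elsewhere costs nothing because ν > 0 almost surely. -/
theorem exists_measurable_stickProb {ι : Type} [Fintype ι] (m a : ι → ℕ) :
    ∃ g : ℝ → ENNReal, Measurable g ∧ ∀ ν, 0 < ν → stickProb ν m a = g ν := by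
  let G := (Set.Ioi (0 : ℝ)).indicator Real.Gamma
  have hG : Measurable G := measurable_indicator_Gamma
  have hG' : ∀ s, 0 < s → Real.Gamma s = G s := fun s hs => (Set.indicator_of_mem hs _).symm
  refine ⟨fun ν => ∏ r ∈ Finset.range (Finset.univ.sup fun j => a j + 1), ENNReal.ofReal
    (ν * Real.Gamma ((∑ j, if a j = r then m j else 0 : ℕ) + 1)
      * G (ν + (∑ j, if r < a j then m j else 0 : ℕ))
      / G (ν + (∑ j, if a j = r then m j else 0 : ℕ) + (∑ j, if r < a j then m j else 0 : ℕ) + 1)),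
    by fun_prop, fun ν hν => ?_⟩
  unfold stickProb stickProd
  refine Finset.prod_congr rfl fun r _ => ?_
  rw [betaMoment_eq hν, hG' (ν + _) (by positivity), hG' (ν + _ + _ + _) (by positivity)]

theorem exists_measurable_partitionProb {ι : Type} [Fintype ι] (m : ι → ℕ) :
    ∃ g : ℝ → ENNReal, Measurable g ∧ ∀ ν, 0 < ν → partitionProb ν m = g ν := by
  let G := (Set.Ioi (0 : ℝ)).indicator Real.Gamma
  have hG : Measurable G := measurable_indicator_Gamma
  have hG' : ∀ s, 0 < s → Real.Gamma s = G s := fun s hs => (Set.indicator_of_mem hs _).symm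
  refine ⟨fun ν => ENNReal.ofReal (ν ^ Fintype.card ι * (∏ j, Real.Gamma (m j)) * G ν
    / G (ν + (∑ j, m j : ℕ))), by fun_prop, fun ν hν => ?_⟩
  rw [partitionProb, hG' ν hν, hG' (ν + _) (by positivity)]

/-! ### Products of baseline processes -/

section Pi

variable {d m n K : ℕ} {S : Set (EuclideanSpace ℝ (Fin d))}

theorem measurable_lintegral_pi_baseGP {α : Type*} [MeasurableSpace α] (q : Fin m → S)
    {θ : α → SecondLayer d} (hθ : Measurable θ)
    {g : α × (Fin K → EuclideanSpace ℝ (Fin m)) → ENNReal} (hg : Measurable g) :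
    Measurable fun c => ∫⁻ e, g (c, e) ∂(Measure.pi fun _ : Fin K => baseGP (θ c) q) := by
  let κ : Kernel α (Fin K → EuclideanSpace ℝ (Fin m)) :=
    ⟨fun c => Measure.pi fun _ : Fin K => baseGP (θ c) q, (measurable_pi_baseGP K q).comp hθ⟩
  have : IsMarkovKernel κ := ⟨fun c => inferInstanceAs
    (IsProbabilityMeasure (Measure.pi fun _ : Fin K => baseGP (θ c) q))⟩
  exact Measurable.lintegral_kernel_prod_right' (κ := κ) hg

theorem measurable_lintegral_krigGP {α : Type*} [MeasurableSpace α] (x : Fin n → S)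
    (p : Fin m → S) {θ : α → SecondLayer d} (hθ : Measurable θ) {v : α → Fin n → ℝ}
    (hv : Measurable v) {g : α × EuclideanSpace ℝ (Fin m) → ENNReal} (hg : Measurable g) :
    Measurable fun c => ∫⁻ u, g (c, u) ∂krigGP (θ c) x (v c) p := by
  have hκ := (measurable_krigGP x p).comp (hθ.prodMk hv)
  let κ : Kernel α (EuclideanSpace ℝ (Fin m)) := ⟨fun c => krigGP (θ c) x (v c) p, hκ⟩
  have : IsMarkovKernel κ := ⟨fun c => inferInstanceAs
    (IsProbabilityMeasure (krigGP (θ c) x (v c) p))⟩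
  exact Measurable.lintegral_kernel_prod_right' (κ := κ) hg

theorem measurable_lintegral_baseGP {α : Type*} [MeasurableSpace α]
    (p : Fin m → S) {θ : α → SecondLayer d} (hθ : Measurable θ)
    {g : α × EuclideanSpace ℝ (Fin m) → ENNReal} (hg : Measurable g) :
    Measurable fun c => ∫⁻ u, g (c, u) ∂baseGP (θ c) p := by
  let κ : Kernel α (EuclideanSpace ℝ (Fin m)) :=
    ⟨fun c => baseGP (θ c) p, (measurable_baseGP p).comp hθ⟩
  have : IsMarkovKernel κ := ⟨fun c => inferInstanceAs (IsProbabilityMeasure (baseGP (θ c) p))⟩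
  exact Measurable.lintegral_kernel_prod_right' (κ := κ) hg

theorem lintegral_pi_insertNth {α : Type*} [MeasurableSpace α] (μ : Measure α)
    [IsProbabilityMeasure μ] (j : Fin (K + 1)) {f : (Fin (K + 1) → α) → ENNReal}
    (hf : Measurable f) :
    ∫⁻ e, f e ∂(Measure.pi fun _ => μ)
      = ∫⁻ r, ∫⁻ y, f (j.insertNth y r) ∂μ ∂(Measure.pi fun _ : Fin K => μ) := by
  have h := (measurePreserving_piFinSuccAbove (fun _ : Fin (K + 1) => μ) j).symm
  rw [← h.lintegral_comp hf]
  exact lintegral_prod_symm _ (hf.comp (MeasurableEquiv.measurable _)).aemeasurable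

theorem measurable_insertNth {α : Type*} [MeasurableSpace α] (j : Fin (K + 1)) :
    Measurable fun c : α × (Fin K → α) =>
      (j.insertNth c.1 c.2 : Fin (K + 1) → α) :=
  (MeasurableEquiv.piFinSuccAbove (fun _ => α) j).symm.measurable

/-- The other surfaces are independent of surface j and can be frozen, so only row j matters for its
prediction. -/
theorem lintegral_pi_baseGP_realized {θ : SecondLayer d} (hθ : θ.Admissible) {x : Fin n → S}
    (hx : Function.Injective x) (p : Fin m → S) (j : Fin K)
    {f : (Fin K → Fin n → ℝ) × EuclideanSpace ℝ (Fin m) → ENNReal} (hf : Measurable f) :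
    ∫⁻ e, f (fun k => leftPart n m (e k), rightPart n m (e j))
        ∂(Measure.pi fun _ : Fin K => baseGP θ (Fin.append x p))
      = ∫⁻ e, ∫⁻ u, f (fun k => leftPart n m (e k), u) ∂krigGP θ x (leftPart n m (e j)) p
          ∂(Measure.pi fun _ : Fin K => baseGP θ (Fin.append x p)) := by
  have hl := measurable_leftPart (n := n) (m := m)
  have hr := measurable_rightPart (n := n) (m := m)
  obtain _ | K := K
  · exact j.elim0
  rw [lintegral_pi_insertNth _ j (by fun_prop), lintegral_pi_insertNth _ j
    (measurable_lintegral_krigGP (θ := fun _ => θ) (v := fun e : Fin (K + 1) → _ => leftPart n m (e j))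
      (g := fun c => f (fun k => leftPart n m (c.1 k), c.2)) x p measurable_const
      (by fun_prop) (by fun_prop))]
  refine lintegral_congr fun r => ?_
  have hins : ∀ y, (fun k => leftPart n m ((j.insertNth y r : Fin (K + 1) → _) k))
      = (j.insertNth (leftPart n m y) fun k => leftPart n m (r k) : Fin (K + 1) → _) := fun y => by
    funext k
    refine Fin.succAboveCases j ?_ (fun i => ?_) k <;> simp
  simp only [hins, Fin.insertNth_apply_same]
  exact lintegral_baseGP_append hθ hx p (f := fun c =>
    f ((j.insertNth c.1 fun k => leftPart n m (r k) : Fin (K + 1) → _), c.2))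
    (hf.comp (((measurable_insertNth j).comp
      (measurable_fst.prodMk measurable_const)).prodMk measurable_snd))

/-- The design values of a surface not yet realized do not enter the table, so they integrate out
and leave the unconditioned baseline marginal. -/
theorem lintegral_pi_baseGP_new {θ : SecondLayer d} (hθ : θ.Admissible) (x : Fin n → S)
    (p : Fin m → S)
    {f : (Fin K → Fin n → ℝ) × EuclideanSpace ℝ (Fin m) → ENNReal} (hf : Measurable f) :
    ∫⁻ e, f (fun k => leftPart n m (e (Fin.castSucc k)), rightPart n m (e (Fin.last K)))
        ∂(Measure.pi fun _ : Fin (K + 1) => baseGP θ (Fin.append x p))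
      = ∫⁻ e, ∫⁻ u, f (fun k => leftPart n m (e k), u) ∂baseGP θ p
          ∂(Measure.pi fun _ : Fin K => baseGP θ (Fin.append x p)) := by
  have hl := measurable_leftPart (n := n) (m := m)
  have hr := measurable_rightPart (n := n) (m := m)
  rw [lintegral_pi_insertNth _ (Fin.last K) (by fun_prop)]
  refine lintegral_congr fun r => ?_
  simp only [Fin.insertNth_apply_same, Fin.insertNth_last', Fin.snoc_castSucc]
  rw [← map_rightPart_baseGP hθ x p, lintegral_map (f := fun u => f (fun k => leftPart n m (r k), u))
    (by fun_prop) hr]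

end Pi

/-! ### The joint law of the assignments and the realized surfaces -/

theorem ae_gammaMeasure_pos (a b : ℝ) : ∀ᵐ t ∂gammaMeasure a b, 0 < t := by
  rw [gammaMeasure, ae_withDensity_iff (show Measurable (gammaPDF a b) from
    (measurable_gammaPDFReal a b).ennreal_ofReal)]
  have h0 : ∀ᵐ t : ℝ, t ≠ 0 := by simp [ae_iff]
  filter_upwards [h0] with t ht h
  rcases lt_trichotomy t 0 with h1 | h1 | h1
  · exact absurd (gammaPDF_of_neg h1) h
  · exact absurd h1 ht
  · exact h1

theorem ae_inverseGammaMeasure_pos (a b : ℝ) : ∀ᵐ t ∂inverseGammaMeasure a b, 0 < t := by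
  rw [inverseGammaMeasure, ae_map_iff measurable_inv.aemeasurable measurableSet_Ioi]
  exact (ae_gammaMeasure_pos a b).mono fun t ht => inv_pos.2 ht

theorem ae_uniformCube_pos (d : ℕ) (b : ℝ) : ∀ᵐ φ ∂uniformCube d b, ∀ k, 0 < φ k := by
  rw [uniformCube, ProbabilityTheory.cond]
  refine Measure.ae_smul_measure ?_ _
  filter_upwards [ae_restrict_mem (MeasurableSet.univ_pi fun _ : Fin d => measurableSet_Ioc)]
    with φ hφ k
  exact (hφ k trivial).1

theorem HyperPrior.ae_admissible {d : ℕ} (h : HyperPrior d) :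
    ∀ᵐ θ ∂h.first.prod h.second, θ.2.Admissible := by
  refine Measure.quasiMeasurePreserving_snd.ae (p := SecondLayer.Admissible) ?_
  have h1 := (Measure.quasiMeasurePreserving_fst (μ := gammaMeasure h.aNu h.bNu)
    (ν := (inverseGammaMeasure h.aSigma h.bSigma).prod (uniformCube d h.bPhi))).ae
    (ae_gammaMeasure_pos h.aNu h.bNu)
  have h2 := Measure.quasiMeasurePreserving_snd (μ := gammaMeasure h.aNu h.bNu)
    (ν := (inverseGammaMeasure h.aSigma h.bSigma).prod (uniformCube d h.bPhi)) |>.ae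
    ((Measure.quasiMeasurePreserving_fst (μ := inverseGammaMeasure h.aSigma h.bSigma)
      (ν := uniformCube d h.bPhi)).ae (ae_inverseGammaMeasure_pos h.aSigma h.bSigma))
  have h3 := Measure.quasiMeasurePreserving_snd (μ := gammaMeasure h.aNu h.bNu)
    (ν := (inverseGammaMeasure h.aSigma h.bSigma).prod (uniformCube d h.bPhi)) |>.ae
    ((Measure.quasiMeasurePreserving_snd (μ := inverseGammaMeasure h.aSigma h.bSigma)
      (ν := uniformCube d h.bPhi)).ae (ae_uniformCube_pos d h.bPhi))
  filter_upwards [h1, h2, h3] with θ t1 t2 t3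
  exact ⟨t1, t2, t3⟩

-- For arbitrary real sticks the weights need not sum to 1, yet each singleton has finite mass; this
-- suffices for product measures of singletons.
instance (v : ℕ → ℝ) : SigmaFinite (stickMeasure v) :=
  ⟨⟨{ set := fun l => {l}
      set_mem := fun _ => trivial
      finite := fun l => by
        rw [stickMeasure, Measure.sum_apply _ (measurableSet_singleton l),
          tsum_eq_single l fun k hk => by simp [hk]]
        simp
      spanning := Set.iUnion_of_singleton ℕ }⟩⟩

theorem stickMeasure_singleton (v : ℕ → ℝ) (l : ℕ) :
    stickMeasure v {l} = ENNReal.ofReal (stickWeight v l) := by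
  rw [stickMeasure, Measure.sum_apply _ (measurableSet_singleton l),
    tsum_eq_single l fun k hk => by simp [hk]]
  simp

/-! ### Probability of an assignment word together with the law of its surfaces -/

namespace Model

variable {d m n N K : ℕ} {h : HyperPrior d} {S : Set (EuclideanSpace ℝ (Fin d))}
  {Ω : Type*} [MeasurableSpace Ω] {P : Measure Ω} [IsProbabilityMeasure P]

/-- The values of the `l`-th surface at finitely many points. -/
def values (M : Model h S P) (q : Fin m → S) (l : ℕ) (ω : Ω) : EuclideanSpace ℝ (Fin m) :=
  WithLp.toLp 2 fun b => M.surface l (q b) ω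

theorem measurable_hyper (M : Model h S P) : Measurable fun ω => (M.first ω, M.second ω) :=
  M.measurable_first.prodMk M.measurable_second

theorem measurable_values (M : Model h S P) (q : Fin m → S) (l : ℕ) :
    Measurable (M.values q l) := by
  have := fun b => M.measurable_surface l (q b)
  unfold values
  fun_prop

theorem ae_admissible (M : Model h S P) : ∀ᵐ ω ∂P, (M.second ω).Admissible := by
  have := h.ae_admissible
  rw [← M.law_hyper] at this
  exact ae_of_ae_map M.measurable_hyper.aemeasurable this

theorem lintegral_stickIndex (M : Model h S P) (b : Fin N → ℕ)
    {f : (FirstLayer d × SecondLayer d) × (ℕ → ℝ) × (ℕ → S → ℝ) → ENNReal} (hf : Measurable f) :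
    ∫⁻ ω in {ω | ∀ i : Fin N, M.stickIndex i ω = b i},
        f ((M.first ω, M.second ω), (fun r => M.stick r ω), fun l p => M.surface l p ω) ∂P
      = ∫⁻ ω, f ((M.first ω, M.second ω), (fun r => M.stick r ω), fun l p => M.surface l p ω)
          * ∏ i, ENNReal.ofReal (stickWeight (fun r => M.stick r ω) (b i)) ∂P := by
  have m1 := M.measurable_stickIndex
  have m2 := M.measurable_stick
  have m3 := M.measurable_surface
  have m4 := M.measurable_hyper
  have hU : Measurable fun ω => ((M.first ω, M.second ω), (fun r => M.stick r ω),
      fun l p => M.surface l p ω) :=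
    m4.prodMk ((measurable_pi_lambda _ m2).prodMk
      (measurable_pi_lambda _ fun l => measurable_pi_lambda _ fun p => m3 l p))
  have hC : Measurable fun ω => fun i : Fin N => M.stickIndex i ω :=
    measurable_pi_lambda _ fun i => m1 i
  have hE : MeasurableSet {ω | ∀ i : Fin N, M.stickIndex i ω = b i} := by
    have : {ω | ∀ i : Fin N, M.stickIndex i ω = b i}
        = (fun ω => fun i : Fin N => M.stickIndex i ω) ⁻¹' {b} := by
      ext ω; simp [funext_iff]
    rw [this]
    exact hC (measurableSet_singleton b)
  have key := condLaw_of_condDistrib hU hC (M.law_stickIndex N)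
    (fun c => ({b} : Set (Fin N → ℕ)).indicator (fun _ => f c.1) c.2) ?_
  · rw [← lintegral_indicator hE]
    refine Eq.trans (lintegral_congr fun ω => ?_) (key.trans (lintegral_congr fun ω => ?_))
    · simp only [Set.indicator, Set.mem_ofPred_eq, Set.mem_singleton_iff, funext_iff]
    · change ∫⁻ y, ({b} : Set (Fin N → ℕ)).indicator (fun _ => f ((M.first ω, M.second ω),
        (fun r => M.stick r ω), fun l p => M.surface l p ω)) y
        ∂(Measure.pi fun _ : Fin N => stickMeasure fun r => M.stick r ω) = _
      rw [lintegral_indicator (measurableSet_singleton b), lintegral_const,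
        Measure.restrict_apply_univ, Measure.pi_singleton]
      simp_rw [stickMeasure_singleton]
  · have : (fun c : _ × (Fin N → ℕ) => ({b} : Set (Fin N → ℕ)).indicator (fun _ => f c.1) c.2)
        = (Prod.snd ⁻¹' {b}).indicator fun c => f c.1 := by
      ext c; simp [Set.indicator]
    rw [this]
    exact (hf.comp measurable_fst).indicator (measurable_snd (measurableSet_singleton b))

/-- Finitely many sticks and surfaces are involved, and they are independent given the
hyperparameters, so the expectation factors. The surface factor does not depend on a, because
distinct surfaces are i.i.d. -/
theorem lintegral_stickIndex_values (M : Model h S P) (z : Fin N → Fin K) (a : Fin K ↪ ℕ)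
    (q : Fin m → S)
    {g : (FirstLayer d × SecondLayer d) × (Fin K → EuclideanSpace ℝ (Fin m)) → ENNReal}
    (hg : Measurable g) :
    ∫⁻ ω in {ω | ∀ i : Fin N, M.stickIndex i ω = a (z i)},
        g ((M.first ω, M.second ω), fun j => M.values q (a j) ω) ∂P
      = ∫⁻ ω, stickProb (M.second ω).nu (letterCount z) a
          * ∫⁻ e, g ((M.first ω, M.second ω), e)
              ∂(Measure.pi fun _ : Fin K => baseGP (M.second ω) q) ∂P := by
  obtain ⟨L, hL⟩ : ∃ L, ∀ j, a j < L :=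
    ⟨Finset.univ.sup fun j => a j + 1, fun j =>
      Finset.le_sup (f := fun j => a j + 1) (Finset.mem_univ j)⟩
  have m2 := M.measurable_stick
  have mv := M.measurable_values q
  have mw := fun l => (measurable_stickWeight l).comp
    (measurable_pi_lambda _ fun r => measurable_extendStick (L := L) r)
  have h1 := M.lintegral_stickIndex (fun i => a (z i))
    (f := fun c => g (c.1, fun j => WithLp.toLp 2 fun b => c.2.2 (a j) (q b)))
    (hg.comp (by fun_prop))
  refine h1.trans ?_
  have hX : Measurable fun ω => ((fun r : Fin L => M.stick r ω),
      (fun l : Fin L => (WithLp.toLp 2 fun b => M.surface l (q b) ω : EuclideanSpace ℝ (Fin m)))) :=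
    (measurable_pi_lambda _ fun r : Fin L => m2 r).prodMk
      (measurable_pi_lambda _ fun l : Fin L => mv l)
  have hA : Measurable fun v : Fin L → ℝ =>
      ∏ i, ENNReal.ofReal (stickWeight (extendStick v) (a (z i))) :=
    Finset.measurable_prod _ fun i _ => (mw (a (z i))).ennreal_ofReal
  have hB : Measurable fun c : (FirstLayer d × SecondLayer d) × (Fin L → EuclideanSpace ℝ (Fin m)) =>
      g (c.1, fun j => c.2 ⟨a j, hL j⟩) := by fun_prop
  have key := condLaw_of_condDistrib M.measurable_hyper hX (M.law_stick_surface L m q)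
    (fun c => (∏ i, ENNReal.ofReal (stickWeight (extendStick c.2.1) (a (z i))))
      * g (c.1, fun j => c.2.2 ⟨a j, hL j⟩))
    ((hA.comp (measurable_fst.comp measurable_snd)).mul
      (hB.comp (measurable_fst.prodMk (measurable_snd.comp measurable_snd))))
  refine Eq.trans (lintegral_congr fun ω => ?_) (key.trans (lintegral_congr_ae ?_))
  · rw [mul_comm]
    congr 1
    refine Finset.prod_congr rfl fun i _ => ?_
    -- A weight uses only sticks up to its own index, which is below L, so the padding with zeros is
    -- invisible.
    rw [stickWeight_congr fun r hr => ?_]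
    have := hL (z i)
    rw [extendStick, dif_pos (hr.trans_lt this)]
  · filter_upwards [M.ae_admissible] with ω hω
    have := isProbabilityMeasureBeta one_pos hω.1
    refine (lintegral_prod_mul (ν := Measure.pi fun _ : Fin L => baseGP (M.second ω) q)
      (g := fun e : Fin L → EuclideanSpace ℝ (Fin m) =>
        g ((M.first ω, M.second ω), fun j => e ⟨a j, hL j⟩)) hA.aemeasurable
      (hB.comp measurable_prodMk_left).aemeasurable).trans ?_
    rw [lintegral_prod_stickWeight hω.1 z a hL]
    congr 1
    rw [← map_pi_comp_embedding (ι := Fin K) (κ := Fin L) (baseGP (M.second ω) q)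
      (a := fun j => ⟨a j, hL j⟩) fun i j hij => a.injective (by simpa using hij),
      lintegral_map (by fun_prop) (by fun_prop)]

/-- Summing over the sticks touches only `stickProb`, whose sum is the partition function. Labels
and surfaces therefore separate: given the hyperparameters, the realized surfaces are i.i.d. from
the baseline whatever the word. -/
theorem lintegral_assignment (M : Model h S P) {z : ℕ → ℕ} (hz : appearance z N = List.range K)
    (q : Fin m → S) {F : Ω → ENNReal}
    {g : (FirstLayer d × SecondLayer d) × (Fin K → EuclideanSpace ℝ (Fin m)) → ENNReal}
    (hg : Measurable g)
    (hF : ∀ (a : Fin K ↪ ℕ) ω, (∀ i : Fin N, M.stickIndex i ω = a (letters hz i)) →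
      F ω = g ((M.first ω, M.second ω), fun j => M.values q (a j) ω)) :
    ∫⁻ ω in {ω | ∀ i < N, M.assignment i ω = z i}, F ω ∂P
      = ∫⁻ ω, partitionProb (M.second ω).nu (letterCount (letters hz))
          * ∫⁻ e, g ((M.first ω, M.second ω), e)
              ∂(Measure.pi fun _ : Fin K => baseGP (M.second ω) q) ∂P := by
  have hset : {ω | ∀ i < N, M.assignment i ω = z i}
      = ⋃ a : Fin K ↪ ℕ, {ω | ∀ i : Fin N, M.stickIndex i ω = a (letters hz i)} := by
    ext ω
    simp only [Set.mem_iUnion, Set.mem_ofPred_eq]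
    exact exists_letters_iff hz
  have hE : ∀ a : Fin K ↪ ℕ,
      MeasurableSet {ω | ∀ i : Fin N, M.stickIndex i ω = a (letters hz i)} := fun a => by
    simp only [Set.ofPred_forall]
    exact MeasurableSet.iInter fun i => M.measurable_stickIndex i (measurableSet_singleton _)
  have hdisj : Pairwise (Function.onFun Disjoint fun a : Fin K ↪ ℕ =>
      {ω | ∀ i : Fin N, M.stickIndex i ω = a (letters hz i)}) := fun a b hab =>
    Set.disjoint_left.2 fun ω ha hb =>
      hab (letters_unique (c := fun k => M.stickIndex k ω) hz ha hb)
  have : Countable (Fin K ↪ ℕ) := DFunLike.coe_injective.countable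
  rw [hset, lintegral_iUnion hE hdisj]
  have h1 : ∀ a : Fin K ↪ ℕ,
      ∫⁻ ω in {ω | ∀ i : Fin N, M.stickIndex i ω = a (letters hz i)}, F ω ∂P
        = ∫⁻ ω, stickProb (M.second ω).nu (letterCount (letters hz)) a
          * ∫⁻ e, g ((M.first ω, M.second ω), e)
              ∂(Measure.pi fun _ : Fin K => baseGP (M.second ω) q) ∂P := fun a => by
    rw [← M.lintegral_stickIndex_values (letters hz) a q hg]
    exact setLIntegral_congr_fun (hE a) fun ω hω => hF a ω hω
  simp_rw [h1]
  have hm : Measurable fun ω => ∫⁻ e, g ((M.first ω, M.second ω), e)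
      ∂(Measure.pi fun _ : Fin K => baseGP (M.second ω) q) :=
    measurable_lintegral_pi_baseGP (g := fun c => g ((M.first c.1, M.second c.1), c.2)) q
      M.measurable_second
      (hg.comp ((M.measurable_hyper.comp measurable_fst).prodMk measurable_snd))
  rw [← lintegral_tsum]
  · refine lintegral_congr_ae ?_
    filter_upwards [M.ae_admissible] with ω hω
    rw [ENNReal.tsum_mul_right, tsum_stickProb hω.1 _ (letterCount_pos hz)]
  · intro a
    obtain ⟨s, hs, hs'⟩ := exists_measurable_stickProb (letterCount (letters hz)) a
    refine AEMeasurable.mul ⟨_, hs.comp (measurable_nu.comp M.measurable_second), ?_⟩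
      hm.aemeasurable
    filter_upwards [M.ae_admissible] with ω hω
    exact hs' _ hω.1

end Model

/-! ### The conditional law of the next surface -/

/-- A table with the given rows, filled with zeros. -/
def padRows {K : ℕ} (n : ℕ) (t : Fin K → Fin n → ℝ) : Fin n → Fin n → ℝ :=
  fun j i => if h : (j : ℕ) < K then t ⟨j, h⟩ i else 0

theorem measurable_padRows {K n : ℕ} : Measurable (padRows (K := K) n) := by
  refine measurable_pi_lambda _ fun j => measurable_pi_lambda _ fun i => ?_
  unfold padRows
  split_ifs <;> fun_prop

theorem lintegral_eq_tsum_fiber {Ω ι : Type*} [MeasurableSpace Ω] [Countable ι]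
    [MeasurableSpace ι] [MeasurableSingletonClass ι] (μ : Measure Ω) {T : Ω → ι}
    (hT : Measurable T) (F : Ω → ENNReal) :
    ∫⁻ ω, F ω ∂μ = ∑' i, ∫⁻ ω in {ω | T ω = i}, F ω ∂μ := by
  rw [← lintegral_iUnion (s := fun i => {ω | T ω = i}) (fun i => hT (measurableSet_singleton i))
    fun i j hij => Set.disjoint_left.2 fun ω hi hj => hij (hi.symm.trans hj),
    show (⋃ i, {ω | T ω = i}) = Set.univ from Set.eq_univ_of_forall fun ω =>
    Set.mem_iUnion.2 ⟨T ω, rfl⟩, Measure.restrict_univ]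

theorem lintegral_urnKriging {d m n K : ℕ} {S : Set (EuclideanSpace ℝ (Fin d))}
    (θ : SecondLayer d) (x : Fin n → S) (t : Fin K → Fin n → ℝ) {z : Fin n → ℕ}
    (hz : numSurfaces z = K) (hK : K ≤ n) (p : Fin m → S)
    {f : ℕ × EuclideanSpace ℝ (Fin m) → ENNReal} (hf : Measurable f) :
    ∫⁻ y, f y ∂urnKriging θ x (padRows n t) z p
      = ENNReal.ofReal (θ.nu / (θ.nu + n)) * ∫⁻ u, f (K, u) ∂baseGP θ p
        + ∑ j : Fin K, ENNReal.ofReal (surfaceCount z j / (θ.nu + n))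
          * ∫⁻ u, f (j, u) ∂krigGP θ x (t j) p := by
  have hd : ∀ (k : ℕ) (μ : Measure (EuclideanSpace ℝ (Fin m))) [SFinite μ],
      ∫⁻ y, f y ∂(Measure.dirac k).prod μ = ∫⁻ u, f (k, u) ∂μ := fun k μ _ => by
    rw [Measure.dirac_prod, lintegral_map hf measurable_prodMk_left]
  rw [urnKriging, lintegral_add_measure, lintegral_smul_measure, lintegral_finsetSum_measure, hd,
    hz, smul_eq_mul]
  congr 1
  symm
  refine Finset.sum_bij (fun j _ => Fin.castLE hK j) (fun j _ => by simp)
    (fun i _ j _ hij => by simpa using hij) (fun j hj => ?_) fun j _ => ?_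
  · exact ⟨⟨j, (Finset.mem_filter.1 hj).2⟩, Finset.mem_univ _, rfl⟩
  · rw [lintegral_smul_measure, hd, smul_eq_mul,
      show padRows n t (Fin.castLE hK j) = t j by funext; simp [padRows]]
    rfl

theorem letterCount_extendWord {n K : ℕ} {w : Fin n → ℕ}
    (hw : appearance (extendWord w 0) n = List.range K) (j : Fin K) :
    letterCount (letters hw) j = surfaceCount w j := by
  rw [letterCount_letters]
  simp_rw [extendWord_coe]

theorem measurable_appearanceLabel (i : ℕ) : Measurable fun c : ℕ → ℕ => appearanceLabel c i := by
  have hd : ∀ c, appearanceLabel c i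
      = appearanceLabel (extendWord (fun k : Fin (i + 1) => c k) 0) i := fun c => by
    have hlt : ∀ k < i + 1, c k = extendWord (fun k : Fin (i + 1) => c k) 0 k := fun k hk => by
      simp [extendWord, hk]
    rw [appearanceLabel, appearanceLabel, appearance_congr hlt, ← hlt i (Nat.lt_succ_self i)]
  rw [show (fun c => appearanceLabel c i) = _ from funext hd]
  exact (measurable_of_countable fun c : Fin (i + 1) → ℕ =>
    appearanceLabel (extendWord c 0) i).comp (by fun_prop)

namespace Model

variable {d m n K : ℕ} {h : HyperPrior d} {S : Set (EuclideanSpace ℝ (Fin d))}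
  {Ω : Type*} [MeasurableSpace Ω] {P : Measure Ω} [IsProbabilityMeasure P]

/-- The values of the surface of the next observation. -/
def latentVec (M : Model h S P) (n : ℕ) (p : Fin m → S) (ω : Ω) : EuclideanSpace ℝ (Fin m) :=
  WithLp.toLp 2 fun a => M.latent n (p a) ω

theorem table_eq_padRows (M : Model h S P) (x : Fin n → S) (p : Fin m → S) {a : Fin K → ℕ} {ω : Ω}
    (ha : appearance (fun k => M.stickIndex k ω) n = List.ofFn a) :
    M.table x ω = padRows n fun k => leftPart n m (M.values (Fin.append x p) (a k) ω) := by
  funext j i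
  unfold table padRows
  rw [ha, List.getElem?_ofFn]
  by_cases hj : (j : ℕ) < K <;> simp [hj, leftPart, values]

theorem latentVec_eq_rightPart (M : Model h S P) (x : Fin n → S) (p : Fin m → S) {l i : ℕ} {ω : Ω}
    (hl : M.stickIndex i ω = l) :
    M.latentVec i p ω = rightPart n m (M.values (Fin.append x p) l ω) := by
  subst hl
  ext a
  simp [latentVec, latent, rightPart, values]

theorem aemeasurable_partitionProb (M : Model h S P) {ι : Type} [Fintype ι] (m : ι → ℕ) :
    AEMeasurable (fun ω => partitionProb (M.second ω).nu m) P := by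
  obtain ⟨s, hs, hs'⟩ := exists_measurable_partitionProb m
  refine ⟨_, hs.comp (measurable_nu.comp M.measurable_second), ?_⟩
  filter_upwards [M.ae_admissible] with ω hω
  exact hs' _ hω.1

/-- The longer word has the same letters, so its partition probability differs by the weight of
class j. Each surface is recorded at the design and the new points together, which permits
conditioning on its design values. -/
theorem lintegral_realized (M : Model h S P) {x : Fin n → S} (hx : Function.Injective x)
    (p : Fin m → S) {w : Fin n → ℕ} (hw : appearance (extendWord w 0) n = List.range K) (j : Fin K)
    {f : ((FirstLayer d × SecondLayer d) × (Fin n → Fin n → ℝ) × (Fin n → ℕ))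
      × (ℕ × EuclideanSpace ℝ (Fin m)) → ENNReal} (hf : Measurable f) :
    ∫⁻ ω in {ω | ∀ i < n + 1, M.assignment i ω = extendWord w j i},
        f (((M.first ω, M.second ω), M.table x ω, M.assignments n ω),
          (M.assignment n ω, M.latentVec n p ω)) ∂P
      = ∫⁻ ω, partitionProb (M.second ω).nu (letterCount (letters hw))
          * (ENNReal.ofReal (surfaceCount w j / ((M.second ω).nu + n))
            * ∫⁻ e, ∫⁻ u, f (((M.first ω, M.second ω), padRows n (fun k => leftPart n m (e k)), w),
                ((j : ℕ), u)) ∂krigGP (M.second ω) x (leftPart n m (e j)) p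
              ∂(Measure.pi fun _ : Fin K => baseGP (M.second ω) (Fin.append x p))) ∂P := by
  have hl := measurable_leftPart (n := n) (m := m)
  have hr := measurable_rightPart (n := n) (m := m)
  have hpad := measurable_padRows (K := K) (n := n)
  have hz : appearance (extendWord w j) (n + 1) = List.range K := by
    rw [appearance_succ, appearance_extendWord w j 0, hw, extendWord_last,
      if_pos (List.mem_range.2 j.2)]
  have hlet : ∀ i : Fin n, letters hz i.castSucc = letters hw i := fun i =>
    Fin.ext ((extendWord_coe w j i).trans (extendWord_coe w 0 i).symm)
  have hlast : letters hz (Fin.last n) = j := Fin.ext (extendWord_last w j)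
  rw [M.lintegral_assignment hz (Fin.append x p) (g := fun c =>
    f ((c.1, padRows n (fun k => leftPart n m (c.2 k)), w), ((j : ℕ), rightPart n m (c.2 j))))
    (hf.comp (by fun_prop)) fun a ω hc => ?_]
  · refine lintegral_congr_ae ?_
    filter_upwards [M.ae_admissible] with ω hω
    rw [partitionProb_add_one hω.1 (letterCount (letters hw)) _ (letterCount_pos hw) j
      (by rw [letterCount_letters, surfaceCount_extendWord, letterCount_extendWord, if_pos rfl])
      fun i hi => by rw [letterCount_letters, surfaceCount_extendWord, letterCount_extendWord,
        if_neg fun h => hi (Fin.ext h.symm), add_zero],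
      sum_letterCount, letterCount_extendWord, mul_comm (ENNReal.ofReal _), mul_assoc]
    congr 2
    exact lintegral_pi_baseGP_realized hω hx p j (f := fun c =>
      f (((M.first ω, M.second ω), padRows n c.1, w), ((j : ℕ), c.2))) (hf.comp (by fun_prop))
  · have hc' : ∀ i : Fin n, M.stickIndex i ω = a (letters hw i) := fun i =>
      (hc i.castSucc).trans (congrArg a (hlet i))
    have h1 : M.assignments n ω = w := funext fun i =>
      (appearanceLabel_eq_of_letters (c := fun k => M.stickIndex k ω) hw a hc' i.2).trans (extendWord_coe w 0 i)
    have h2 : M.assignment n ω = j :=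
      (appearanceLabel_eq_of_letters (c := fun k => M.stickIndex k ω) hz a hc (Nat.lt_succ_self n)).trans (extendWord_last w j)
    have h3 : M.stickIndex n ω = a j := (hc (Fin.last n)).trans (congrArg a hlast)
    rw [h1, h2, M.table_eq_padRows x p (appearance_eq_of_letters hw a hc'),
      M.latentVec_eq_rightPart x p h3]

/-- The longer word has one extra letter K, a singleton; its surface is the last of K + 1
independent draws and contributes nothing to the table. -/
theorem lintegral_new (M : Model h S P) (x : Fin n → S)
    (p : Fin m → S) {w : Fin n → ℕ} (hw : appearance (extendWord w 0) n = List.range K)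
    {f : ((FirstLayer d × SecondLayer d) × (Fin n → Fin n → ℝ) × (Fin n → ℕ))
      × (ℕ × EuclideanSpace ℝ (Fin m)) → ENNReal} (hf : Measurable f) :
    ∫⁻ ω in {ω | ∀ i < n + 1, M.assignment i ω = extendWord w K i},
        f (((M.first ω, M.second ω), M.table x ω, M.assignments n ω),
          (M.assignment n ω, M.latentVec n p ω)) ∂P
      = ∫⁻ ω, partitionProb (M.second ω).nu (letterCount (letters hw))
          * (ENNReal.ofReal ((M.second ω).nu / ((M.second ω).nu + n))
            * ∫⁻ e, ∫⁻ u, f (((M.first ω, M.second ω), padRows n (fun k => leftPart n m (e k)), w),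
                (K, u)) ∂baseGP (M.second ω) p
              ∂(Measure.pi fun _ : Fin K => baseGP (M.second ω) (Fin.append x p))) ∂P := by
  have hl := measurable_leftPart (n := n) (m := m)
  have hr := measurable_rightPart (n := n) (m := m)
  have hpad := measurable_padRows (K := K) (n := n)
  have hz : appearance (extendWord w K) (n + 1) = List.range (K + 1) := by
    rw [appearance_succ, appearance_extendWord w K 0, hw, extendWord_last,
      if_neg (by simp), List.range_succ]
  have hlet : ∀ i : Fin n, letters hz i.castSucc = (letters hw i).castSucc := fun i =>
    Fin.ext ((extendWord_coe w K i).trans (extendWord_coe w 0 i).symm)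
  have hlast : letters hz (Fin.last n) = Fin.last K := Fin.ext (extendWord_last w K)
  rw [M.lintegral_assignment hz (Fin.append x p) (g := fun c =>
    f ((c.1, padRows n (fun k : Fin K => leftPart n m (c.2 k.castSucc)), w),
      (K, rightPart n m (c.2 (Fin.last K)))))
    (hf.comp (by fun_prop)) fun a ω hc => ?_]
  · refine lintegral_congr_ae ?_
    filter_upwards [M.ae_admissible] with ω hω
    have hcount : ∀ i : Fin (K + 1), letterCount (letters hz) i
        = surfaceCount w i + if K = i then 1 else 0 := fun i => by
      rw [letterCount_letters, surfaceCount_extendWord]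
    have hzero : surfaceCount w K = 0 := by
      rw [surfaceCount, Finset.card_eq_zero, Finset.filter_eq_empty_iff]
      intro i _ hi
      have := lt_of_appearance_eq_range hw i.2
      rw [extendWord_coe, hi] at this
      exact lt_irrefl _ this
    rw [partitionProb_snoc hω.1 (letterCount (letters hw)) _
      (fun i => by rw [hcount, letterCount_extendWord, Fin.val_castSucc, if_neg i.2.ne', add_zero])
      (by rw [hcount, Fin.val_last, if_pos rfl, hzero]),
      sum_letterCount, mul_comm (ENNReal.ofReal _), mul_assoc]
    congr 2
    exact lintegral_pi_baseGP_new hω x p (f := fun c =>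
      f (((M.first ω, M.second ω), padRows n c.1, w), (K, c.2))) (hf.comp (by fun_prop))
  · let b : Fin K ↪ ℕ := Fin.castSuccEmb.trans a
    have hc' : ∀ i : Fin n, M.stickIndex i ω = b (letters hw i) := fun i =>
      (hc i.castSucc).trans (congrArg a (hlet i))
    have h1 : M.assignments n ω = w := funext fun i =>
      (appearanceLabel_eq_of_letters (c := fun k => M.stickIndex k ω) hw b hc' i.2).trans (extendWord_coe w 0 i)
    have h2 : M.assignment n ω = K :=
      (appearanceLabel_eq_of_letters (c := fun k => M.stickIndex k ω) hz a hc (Nat.lt_succ_self n)).trans (extendWord_last w K)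
    have h3 : M.stickIndex n ω = a (Fin.last K) := (hc (Fin.last n)).trans (congrArg a hlast)
    rw [h1, h2, M.table_eq_padRows x p (appearance_eq_of_letters hw b hc'),
      M.latentVec_eq_rightPart x p h3]
    rfl

theorem measurable_assignment (M : Model h S P) (i : ℕ) : Measurable (M.assignment i) :=
  (measurable_appearanceLabel i).comp (measurable_pi_lambda _ M.measurable_stickIndex)

theorem measurable_assignments (M : Model h S P) (n : ℕ) : Measurable (M.assignments n) :=
  measurable_pi_lambda _ fun i => M.measurable_assignment i

/-- The predicted side of the urn law on one past word, expanded into exactly the terms that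
`lintegral_new` and `lintegral_realized` give for the actual side. -/
theorem lintegral_urn (M : Model h S P) (x : Fin n → S)
    (p : Fin m → S) {w : Fin n → ℕ} (hw : appearance (extendWord w 0) n = List.range K)
    {f : ((FirstLayer d × SecondLayer d) × (Fin n → Fin n → ℝ) × (Fin n → ℕ))
      × (ℕ × EuclideanSpace ℝ (Fin m)) → ENNReal} (hf : Measurable f) :
    ∫⁻ ω in {ω | ∀ i < n, M.assignment i ω = extendWord w 0 i},
        ∫⁻ y, f (((M.first ω, M.second ω), M.table x ω, M.assignments n ω), y)
          ∂urnKriging (M.second ω) x (M.table x ω) (M.assignments n ω) p ∂P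
      = (∫⁻ ω, partitionProb (M.second ω).nu (letterCount (letters hw))
          * (ENNReal.ofReal ((M.second ω).nu / ((M.second ω).nu + n))
            * ∫⁻ e, ∫⁻ u, f (((M.first ω, M.second ω), padRows n (fun k => leftPart n m (e k)), w),
                (K, u)) ∂baseGP (M.second ω) p
              ∂(Measure.pi fun _ : Fin K => baseGP (M.second ω) (Fin.append x p))) ∂P)
        + ∑ j : Fin K, ∫⁻ ω, partitionProb (M.second ω).nu (letterCount (letters hw))
          * (ENNReal.ofReal (surfaceCount w j / ((M.second ω).nu + n))
            * ∫⁻ e, ∫⁻ u, f (((M.first ω, M.second ω), padRows n (fun k => leftPart n m (e k)), w),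
                ((j : ℕ), u)) ∂krigGP (M.second ω) x (leftPart n m (e j)) p
              ∂(Measure.pi fun _ : Fin K => baseGP (M.second ω) (Fin.append x p))) ∂P := by
  have hl := measurable_leftPart (n := n) (m := m)
  have hpad := measurable_padRows (K := K) (n := n)
  have hsec := M.measurable_second
  have hhyp := M.measurable_hyper
  have hν := measurable_nu (d := d)
  have hnum : numSurfaces w = K := by
    have := numSurfaces_eq (extendWord w 0) n
    rw [hw, List.length_range] at this
    simpa only [extendWord_coe] using this
  have hK : K ≤ n := hnum ▸ Finset.card_image_le.trans (by simp)
  let μ : FirstLayer d × SecondLayer d → Measure (Fin K → EuclideanSpace ℝ (Fin (n + m))) :=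
    fun θ => Measure.pi fun _ => baseGP θ.2 (Fin.append x p)
  let G : (FirstLayer d × SecondLayer d) × (Fin K → EuclideanSpace ℝ (Fin (n + m))) → ENNReal :=
    fun c => ∫⁻ u, f ((c.1, padRows n (fun k => leftPart n m (c.2 k)), w), (K, u)) ∂baseGP c.1.2 p
  let H : Fin K → (FirstLayer d × SecondLayer d) × (Fin K → EuclideanSpace ℝ (Fin (n + m)))
      → ENNReal := fun j c =>
    ∫⁻ u, f ((c.1, padRows n (fun k => leftPart n m (c.2 k)), w), ((j : ℕ), u))
      ∂krigGP c.1.2 x (leftPart n m (c.2 j)) p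
  have mG : Measurable G :=
    measurable_lintegral_baseGP p (θ := fun c : (FirstLayer d × SecondLayer d)
      × (Fin K → EuclideanSpace ℝ (Fin (n + m))) => c.1.2)
      (g := fun c => f ((c.1.1, padRows n (fun k => leftPart n m (c.1.2 k)), w), (K, c.2)))
      (by fun_prop) (hf.comp (by fun_prop))
  have mH : ∀ j, Measurable (H j) := fun j =>
    measurable_lintegral_krigGP x p (θ := fun c : (FirstLayer d × SecondLayer d)
      × (Fin K → EuclideanSpace ℝ (Fin (n + m))) => c.1.2) (v := fun c => leftPart n m (c.2 j))
      (g := fun c => f ((c.1.1, padRows n (fun k => leftPart n m (c.1.2 k)), w), ((j : ℕ), c.2)))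
      (by fun_prop) (by fun_prop) (hf.comp (by fun_prop))
  have mI : ∀ {g : (FirstLayer d × SecondLayer d) × (Fin K → EuclideanSpace ℝ (Fin (n + m)))
      → ENNReal}, Measurable g → Measurable fun ω =>
        ∫⁻ e, g ((M.first ω, M.second ω), e) ∂μ (M.first ω, M.second ω) := fun hg =>
    (measurable_lintegral_pi_baseGP (Fin.append x p) measurable_snd hg).comp hhyp
  let b : FirstLayer d × SecondLayer d → ENNReal := fun θ =>
    ENNReal.ofReal (θ.2.nu / (θ.2.nu + n))
  let b' : Fin K → FirstLayer d × SecondLayer d → ENNReal := fun j θ =>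
    ENNReal.ofReal (surfaceCount w j / (θ.2.nu + n))
  have mb : Measurable b := by fun_prop
  have mb' : ∀ j, Measurable (b' j) := fun j => by fun_prop
  have hmix : ∀ θ, ∫⁻ e, (b θ * G (θ, e) + ∑ j, b' j θ * H j (θ, e)) ∂μ θ
      = b θ * ∫⁻ e, G (θ, e) ∂μ θ + ∑ j, b' j θ * ∫⁻ e, H j (θ, e) ∂μ θ := fun θ => by
    have mG' : Measurable fun e => G (θ, e) := mG.comp measurable_prodMk_left
    have mH' : ∀ j, Measurable fun e => H j (θ, e) := fun j => (mH j).comp measurable_prodMk_left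
    rw [lintegral_add_left (mG'.const_mul _), lintegral_const_mul _ mG',
      lintegral_finsetSum _ fun j _ => (mH' j).const_mul _]
    simp_rw [lintegral_const_mul _ (mH' _)]
  rw [M.lintegral_assignment hw (Fin.append x p) (g := fun c =>
      b c.1 * G c + ∑ j, b' j c.1 * H j c) (by fun_prop) fun a ω hc => ?_]
  · let A : Ω → ENNReal := fun ω => partitionProb (M.second ω).nu (letterCount (letters hw))
    have mA : AEMeasurable A P := M.aemeasurable_partitionProb _
    change ∫⁻ ω, A ω * ∫⁻ e, (b (M.first ω, M.second ω) * G ((M.first ω, M.second ω), e)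
        + ∑ j, b' j (M.first ω, M.second ω) * H j ((M.first ω, M.second ω), e))
        ∂μ (M.first ω, M.second ω) ∂P
      = (∫⁻ ω, A ω * (b (M.first ω, M.second ω)
          * ∫⁻ e, G ((M.first ω, M.second ω), e) ∂μ (M.first ω, M.second ω)) ∂P)
        + ∑ j, ∫⁻ ω, A ω * (b' j (M.first ω, M.second ω)
          * ∫⁻ e, H j ((M.first ω, M.second ω), e) ∂μ (M.first ω, M.second ω)) ∂P
    have mAG : AEMeasurable (fun ω => A ω * (b (M.first ω, M.second ω)
        * ∫⁻ e, G ((M.first ω, M.second ω), e) ∂μ (M.first ω, M.second ω))) P :=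
      mA.mul ((mb.comp hhyp).mul (mI mG)).aemeasurable
    have mAH : ∀ j, AEMeasurable (fun ω => A ω * (b' j (M.first ω, M.second ω)
        * ∫⁻ e, H j ((M.first ω, M.second ω), e) ∂μ (M.first ω, M.second ω))) P := fun j =>
      mA.mul (((mb' j).comp hhyp).mul (mI (mH j))).aemeasurable
    rw [← lintegral_finsetSum' _ fun j _ => mAH j, ← lintegral_add_left' mAG]
    refine lintegral_congr fun ω => ?_
    rw [hmix, mul_add, Finset.mul_sum]
  · have h1 : M.assignments n ω = w := funext fun i =>
      (appearanceLabel_eq_of_letters (c := fun k => M.stickIndex k ω) hw a hc i.2).trans (extendWord_coe w 0 i)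
    rw [h1, M.table_eq_padRows x p (appearance_eq_of_letters hw a hc)]
    exact lintegral_urnKriging _ x _ hnum hK p (hf.comp measurable_prodMk_left)

/-- Both sides are split by the past word; on a word with K letters the actual side is split further
by the next label, and the terms match one by one. -/
theorem condLaw_urnKriging (M : Model h S P) {x : Fin n → S} (hx : Function.Injective x)
    (p : Fin m → S) :
    CondLaw P (fun ω => ((M.first ω, M.second ω), M.table x ω, M.assignments n ω))
      (fun ω => (M.assignment n ω, M.latentVec n p ω))
      fun c => urnKriging c.1.2 x c.2.1 c.2.2 p := by
  intro f hf
  rw [lintegral_eq_tsum_fiber P (M.measurable_assignments n),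
    lintegral_eq_tsum_fiber P (M.measurable_assignments n)]
  refine tsum_congr fun w => ?_
  have hpast : ∀ ω, M.assignments n ω = w ↔ ∀ i < n, M.assignment i ω = extendWord w 0 i :=
    fun ω => ⟨fun h i hi => by rw [← h]; simp [extendWord, hi, assignments], fun h =>
      funext fun i => (h i i.2).trans (extendWord_coe w 0 i)⟩
  by_cases hK : ∃ K, appearance (extendWord w 0) n = List.range K
  · obtain ⟨K, hw⟩ := hK
    have hnext : ∀ j, {ω | M.assignment n ω = j} ∩ {ω | M.assignments n ω = w}
        = {ω | ∀ i < n + 1, M.assignment i ω = extendWord w j i} := fun j => by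
      ext ω
      simp only [Set.mem_inter_iff, Set.mem_ofPred_eq, Nat.forall_lt_succ_right, extendWord_last,
        hpast]
      rw [and_comm]
      refine and_congr_left fun _ => forall₂_congr fun i hi => ?_
      simp [extendWord, hi]
    -- The next label is an old one or the next unused number K, so the sum over labels is finite.
    have hj : ∀ j, j ∉ Finset.range (K + 1) →
        {ω | M.assignment n ω = j} ∩ {ω | M.assignments n ω = w} = ∅ := fun j hj => by
      refine Set.eq_empty_of_forall_notMem fun ω ⟨h1, h2⟩ => hj (Finset.mem_range.2 ?_)
      have h3 := appearance_appearanceLabel (c := fun k => M.stickIndex k ω) (n := n)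
      rw [appearance_congr (c := appearanceLabel fun k => M.stickIndex k ω) ((hpast ω).1 h2),
        hw] at h3
      have h4 := congrArg List.length h3
      simp only [List.length_range] at h4
      rw [← show M.assignment n ω = j from h1, h4]
      refine (appearanceLabel_lt (Nat.lt_succ_self n)).trans_le ?_
      rw [appearance_succ]
      split_ifs <;> simp
    have hset : ∀ j, MeasurableSet {ω | M.assignment n ω = j} := fun j =>
      M.measurable_assignment n (measurableSet_singleton j)
    have hset' : {ω | M.assignments n ω = w}
        = {ω | ∀ i < n, M.assignment i ω = extendWord w 0 i} := Set.ext hpast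
    rw [lintegral_eq_tsum_fiber _ (M.measurable_assignment n)]
    simp_rw [Measure.restrict_restrict (hset _)]
    rw [tsum_eq_sum (s := Finset.range (K + 1)) fun j h => by
        rw [hj j h, Measure.restrict_empty, lintegral_zero_measure],
      Finset.sum_range_succ, Finset.sum_range, hset', M.lintegral_urn x p hw hf, add_comm]
    simp_rw [← hset', hnext]
    rw [M.lintegral_new x p hw hf]
    simp_rw [M.lintegral_realized hx p hw _ hf]
  -- A word whose letters do not appear in the order 0, 1, 2, … is never an assignment vector.
  · have hempty : {ω | M.assignments n ω = w} = ∅ := by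
      refine Set.eq_empty_of_forall_notMem fun ω h2 =>
        hK ⟨(appearance (fun k => M.stickIndex k ω) n).length, ?_⟩
      rw [← appearance_congr (c := appearanceLabel fun k => M.stickIndex k ω) ((hpast ω).1 h2)]
      exact appearance_appearanceLabel
    rw [hempty, Measure.restrict_empty, lintegral_zero_measure, lintegral_zero_measure]

end Model

/-! ### The observations -/

section Observables

variable {d n : ℕ} {S : Set (EuclideanSpace ℝ (Fin d))}

/-- The value on the surface with a given index, as a function of all surfaces and indices. -/
theorem measurable_surface_index (i : ℕ) (p : S) :
    Measurable fun u : (ℕ → S → ℝ) × (ℕ → ℕ) => u.1 (u.2 i) p := by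
  have h : Measurable fun u : (ℕ → S → ℝ) × ℕ => u.1 u.2 p :=
    measurable_from_prod_countable_left fun l => by fun_prop
  exact h.comp (by fun_prop : Measurable fun u : (ℕ → S → ℝ) × (ℕ → ℕ) => (u.1, u.2 i))

/-- The table of the values of the realized surfaces, as a function of all surfaces and indices. -/
def tableOf (x : Fin n → S) (u : (ℕ → S → ℝ) × (ℕ → ℕ)) : Fin n → Fin n → ℝ :=
  fun j i => ((appearance u.2 n)[(j : ℕ)]?).elim 0 fun l => u.1 l (x i)

/-- Only the first n indices matter, and they take countably many values; for fixed indices an entry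
is a coordinate or 0. -/
theorem measurable_tableOf (x : Fin n → S) : Measurable (tableOf x) := by
  refine measurable_pi_lambda _ fun j => measurable_pi_lambda _ fun i => ?_
  have hd : ∀ u : (ℕ → S → ℝ) × (ℕ → ℕ), tableOf x u j i
      = ((appearance (extendWord (fun k : Fin n => u.2 k) 0) n)[(j : ℕ)]?).elim 0
        fun l => u.1 l (x i) := fun u => by
    rw [tableOf, appearance_congr (c := u.2) (z := extendWord (fun k : Fin n => u.2 k) 0)
      fun k hk => by simp [extendWord, hk]]
  rw [show (fun u => tableOf x u j i) = _ from funext hd]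
  have h : Measurable fun u : (ℕ → S → ℝ) × (Fin n → ℕ) =>
      ((appearance (extendWord u.2 0) n)[(j : ℕ)]?).elim 0 fun l => u.1 l (x i) :=
    measurable_from_prod_countable_left fun c => by
      change Measurable fun s : ℕ → S → ℝ =>
        ((appearance (extendWord c 0) n)[(j : ℕ)]?).elim 0 fun l => s l (x i)
      obtain _ | l := (appearance (extendWord c 0) n)[(j : ℕ)]?
      · exact measurable_const
      · exact (by fun_prop : Measurable fun s : ℕ → S → ℝ => s l (x i))
  exact h.comp (by fun_prop :
    Measurable fun u : (ℕ → S → ℝ) × (ℕ → ℕ) => (u.1, fun k : Fin n => u.2 k))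

/-- The latent value of the `i`-th observation, as an entry of the table. -/
def tableEntry (t : Fin n → Fin n → ℝ) (z : Fin n → ℕ) (i : Fin n) : ℝ :=
  if h : z i < n then t ⟨z i, h⟩ i else 0

theorem measurable_tableEntry (i : Fin n) :
    Measurable fun c : (Fin n → Fin n → ℝ) × (Fin n → ℕ) => tableEntry c.1 c.2 i := by
  refine measurable_from_prod_countable_left fun z => ?_
  change Measurable fun t : Fin n → Fin n → ℝ => tableEntry t z i
  unfold tableEntry
  split_ifs <;> fun_prop

end Observables

/-! ### Noise, data, and what conditioning on the data does not change -/

namespace Model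

variable {d m n : ℕ} {h : HyperPrior d} {S : Set (EuclideanSpace ℝ (Fin d))}
  {Ω : Type*} [MeasurableSpace Ω] {P : Measure Ω} [IsProbabilityMeasure P]

/-- Everything but the noise. -/
def noiseless (M : Model h S P) (ω : Ω) :
    (FirstLayer d × SecondLayer d) × (ℕ → ℝ) × (ℕ → S → ℝ) × (ℕ → ℕ) :=
  ((M.first ω, M.second ω), (fun r => M.stick r ω), (fun l p => M.surface l p ω),
    fun i => M.stickIndex i ω)

/-- The noise of the first `n` observations. -/
def noises (M : Model h S P) (n : ℕ) (ω : Ω) : Fin n → ℝ := fun i => M.noise i ω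

theorem measurable_noiseless (M : Model h S P) : Measurable M.noiseless :=
  M.measurable_hyper.prodMk ((measurable_pi_lambda _ M.measurable_stick).prodMk
    ((measurable_pi_lambda _ fun l => measurable_pi_lambda _ fun p => M.measurable_surface l p).prodMk
      (measurable_pi_lambda _ M.measurable_stickIndex)))

theorem measurable_noises (M : Model h S P) (n : ℕ) : Measurable (M.noises n) :=
  measurable_pi_lambda _ fun i => M.measurable_noise i

theorem measurable_latent (M : Model h S P) (i : ℕ) (p : S) : Measurable (M.latent i p) :=
  (measurable_surface_index i p).comp (measurable_snd.comp (measurable_snd.comp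
    M.measurable_noiseless))

theorem measurable_latentVec (M : Model h S P) (i : ℕ) (p : Fin m → S) :
    Measurable (M.latentVec i p) := by
  have := fun a => M.measurable_latent i (p a)
  unfold latentVec
  fun_prop

theorem measurable_table (M : Model h S P) (x : Fin n → S) : Measurable (M.table x) :=
  (measurable_tableOf x).comp (measurable_snd.comp (measurable_snd.comp M.measurable_noiseless))

theorem measurable_obs (M : Model h S P) (i : ℕ) (p : S) : Measurable (M.obs i p) := by
  have h1 := M.measurable_first
  have h2 := M.measurable_latent i p
  have h3 := M.measurable_noise i
  unfold obs
  fun_prop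

theorem measurable_data (M : Model h S P) (x : Fin n → S) : Measurable (M.data x) :=
  measurable_pi_lambda _ fun i => measurable_const.prodMk (M.measurable_obs i (x i))

/-- At most n surfaces are realized, so the label of an observation always indexes a row and the
fallback 0 does not occur. This makes the data a function of table, assignments, hyperparameters and
noise. -/
theorem tableEntry_table (M : Model h S P) (x : Fin n → S) (i : Fin n) (ω : Ω) :
    tableEntry (M.table x ω) (M.assignments n ω) i = M.latent i (x i) ω := by
  have hlen : (appearance (fun k => M.stickIndex k ω) n).length ≤ n := by
    rw [← numSurfaces_eq]
    exact Finset.card_image_le.trans (by simp)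
  have hlt := appearanceLabel_lt (c := fun k => M.stickIndex k ω) i.2
  have hlt' : M.assignments n ω i < n := hlt.trans_le hlen
  have hget := getElem_appearanceLabel (c := fun k => M.stickIndex k ω) i.2
  rw [tableEntry, dif_pos hlt', table]
  change ((appearance (fun k => M.stickIndex k ω) n)[
    appearanceLabel (fun k => M.stickIndex k ω) i]?).elim 0 _ = _
  rw [List.getElem?_eq_getElem hlt, hget]
  rfl

/-- The law of the noise of the first `n` observations given everything else. -/
theorem condLaw_noises (M : Model h S P) (n : ℕ) :
    CondLaw P M.noiseless (M.noises n)
      fun c => Measure.pi fun _ : Fin n => gaussianReal 0 c.1.1.2.toNNReal :=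
  condLaw_of_condDistrib M.measurable_noiseless (M.measurable_noises n) (M.law_noise n)

/-- The law of the noise of an observation given everything else and the previous noise. -/
theorem condLaw_noise (M : Model h S P) (n : ℕ) :
    CondLaw P (fun ω => (M.noiseless ω, M.noises n ω)) (M.noise n)
      fun c => gaussianReal 0 c.1.1.1.2.toNNReal := by
  intro f hf
  have h1 := M.condLaw_noises (n + 1)
    (fun c => f ((c.1, fun i : Fin n => c.2 i.castSucc), c.2 (Fin.last n))) (hf.comp (by fun_prop))
  let κ : Kernel (((FirstLayer d × SecondLayer d) × (ℕ → ℝ) × (ℕ → S → ℝ) × (ℕ → ℕ))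
      × (Fin n → ℝ)) ℝ := ⟨fun c => gaussianReal 0 c.1.1.1.2.toNNReal,
    measurable_gaussianReal measurable_const (by fun_prop)⟩
  have : IsMarkovKernel κ := ⟨fun c => inferInstanceAs
    (IsProbabilityMeasure (gaussianReal 0 c.1.1.1.2.toNNReal))⟩
  have h2 := M.condLaw_noises n (fun c => ∫⁻ y, f (c, y) ∂κ c) hf.lintegral_kernel_prod_right'
  refine h1.trans (Eq.trans (lintegral_congr fun ω => ?_) h2.symm)
  rw [lintegral_pi_insertNth _ (Fin.last n) (f := fun e : Fin (n + 1) → ℝ =>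
    f ((M.noiseless ω, fun i : Fin n => e i.castSucc), e (Fin.last n))) (hf.comp (by fun_prop))]
  simp only [Fin.insertNth_last', Fin.snoc_castSucc, Fin.snoc_last]
  rfl

/-- The law of the next observation given the first-layer parameters, its latent value and the
data. -/
theorem condLaw_obs (M : Model h S P) (x : Fin n → S) (p : S) :
    CondLaw P (fun ω => ((M.first ω, M.latent n p ω), M.data x ω)) (M.obs n p)
      fun c => gaussianReal (inner ℝ p.1 c.1.1.1 + c.1.2) c.1.1.2.toNNReal := by
  let g : ((FirstLayer d × SecondLayer d) × (ℕ → ℝ) × (ℕ → S → ℝ) × (ℕ → ℕ)) × (Fin n → ℝ) →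
      (FirstLayer d × ℝ) × (Fin n → S × ℝ) := fun c =>
    ((c.1.1.1, c.1.2.2.1 (c.1.2.2.2 n) p), fun i => (x i,
      inner ℝ c.1.1.1.1 (x i).1 + c.1.2.2.1 (c.1.2.2.2 i) (x i) + c.2 i))
  have hg : Measurable g := by
    have hs : ∀ (i : ℕ) (q : S), Measurable fun c : ((FirstLayer d × SecondLayer d) × (ℕ → ℝ) ×
        (ℕ → S → ℝ) × (ℕ → ℕ)) × (Fin n → ℝ) => c.1.2.2.1 (c.1.2.2.2 i) q := fun i q =>
      (measurable_surface_index i q).comp (measurable_snd.comp (measurable_snd.comp measurable_fst))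
    refine Measurable.prodMk ((by fun_prop : Measurable fun c : ((FirstLayer d × SecondLayer d) ×
      (ℕ → ℝ) × (ℕ → S → ℝ) × (ℕ → ℕ)) × (Fin n → ℝ) => c.1.1.1).prodMk (hs n p))
      (measurable_pi_lambda _ fun i => measurable_const.prodMk ?_)
    exact Measurable.add (Measurable.add (by fun_prop) (hs i (x i))) (by fun_prop)
  have h1 : CondLaw P (fun ω => ((M.first ω, M.latent n p ω), M.data x ω)) (M.noise n)
      fun c => gaussianReal 0 c.1.1.2.toNNReal :=
    (M.condLaw_noise n).comp_left (g := g)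
      (κ := fun c => gaussianReal 0 c.1.1.2.toNNReal) hg
  have h2 := h1.map (φ := fun c => inner ℝ p.1 c.1.1.1.1 + c.1.1.2 + c.2) (by fun_prop)
  intro f hf
  refine Eq.trans (lintegral_congr fun ω => ?_) ((h2 f hf).trans (lintegral_congr fun ω => ?_))
  · rw [obs, real_inner_comm]
  · change ∫⁻ y, f (((M.first ω, M.latent n p ω), M.data x ω), y)
      ∂(gaussianReal 0 (M.first ω).2.toNNReal).map
        (fun y => inner ℝ p.1 (M.first ω).1 + M.latent n p ω + y) = _
    rw [gaussianReal_map_const_add, zero_add]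

/-- All conditioning variables, the next surface included, are functions of the noiseless part of
the model, and the noise law depends on τ² alone. This is the input to `CondLaw.add_noise`. -/
theorem condLaw_noises_latent (M : Model h S P) (x : Fin n → S) (p : Fin m → S) :
    CondLaw P (fun ω => (((M.first ω, M.second ω), M.table x ω, M.assignments n ω),
      (M.assignment n ω, M.latentVec n p ω))) (M.noises n)
      fun c => Measure.pi fun _ : Fin n => gaussianReal 0 c.1.1.1.2.toNNReal := by
  let g : (FirstLayer d × SecondLayer d) × (ℕ → ℝ) × (ℕ → S → ℝ) × (ℕ → ℕ) →
      ((FirstLayer d × SecondLayer d) × (Fin n → Fin n → ℝ) × (Fin n → ℕ)) ×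
        (ℕ × EuclideanSpace ℝ (Fin m)) := fun u =>
    ((u.1, tableOf x u.2.2, fun i : Fin n => appearanceLabel u.2.2.2 i),
      (appearanceLabel u.2.2.2 n, WithLp.toLp 2 fun a => u.2.2.1 (u.2.2.2 n) (p a)))
  have hg : Measurable g := by
    have hlat : Measurable fun u : (ℕ → S → ℝ) × (ℕ → ℕ) =>
        (WithLp.toLp 2 fun a => u.1 (u.2 n) (p a) : EuclideanSpace ℝ (Fin m)) := by
      have := fun a => measurable_surface_index n (p a)
      fun_prop
    have hlabel : ∀ i, Measurable fun u : (FirstLayer d × SecondLayer d) × (ℕ → ℝ) ×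
        (ℕ → S → ℝ) × (ℕ → ℕ) => appearanceLabel u.2.2.2 i := fun i =>
      (measurable_appearanceLabel i).comp (measurable_snd.comp (measurable_snd.comp measurable_snd))
    exact (measurable_fst.prodMk (((measurable_tableOf x).comp (measurable_snd.comp
      measurable_snd)).prodMk (measurable_pi_lambda _ fun i : Fin n => hlabel i))).prodMk
      ((hlabel n).prodMk (hlat.comp (measurable_snd.comp measurable_snd)))
  exact (M.condLaw_noises n).comp_left (g := g)
    (κ := fun c => Measure.pi fun _ : Fin n => gaussianReal 0 c.1.1.1.2.toNNReal) hg

/-- The data as a function of the parameters, the realized surfaces and the noise. -/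
def dataOf (x : Fin n → S) (c : ((FirstLayer d × SecondLayer d) × (Fin n → Fin n → ℝ) ×
    (Fin n → ℕ)) × (Fin n → ℝ)) : Fin n → S × ℝ := fun i =>
  (x i, inner ℝ c.1.1.1.1 (x i).1 + tableEntry c.1.2.1 c.1.2.2 i + c.2 i)

theorem measurable_dataOf (x : Fin n → S) : Measurable (dataOf (d := d) x) := by
  have hent : ∀ i : Fin n, Measurable fun c : ((FirstLayer d × SecondLayer d) ×
      (Fin n → Fin n → ℝ) × (Fin n → ℕ)) × (Fin n → ℝ) => tableEntry c.1.2.1 c.1.2.2 i := fun i =>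
    (measurable_tableEntry i).comp (measurable_snd.comp measurable_fst)
  have hinner : ∀ i : Fin n, Measurable fun c : ((FirstLayer d × SecondLayer d) ×
      (Fin n → Fin n → ℝ) × (Fin n → ℕ)) × (Fin n → ℝ) => inner ℝ c.1.1.1.1 (x i).1 := fun i => by
    fun_prop
  exact measurable_pi_lambda _ fun i => measurable_const.prodMk
    (((hinner i).add (hent i)).add ((measurable_pi_apply i).comp measurable_snd))

theorem dataOf_eq (M : Model h S P) (x : Fin n → S) (ω : Ω) :
    dataOf x (((M.first ω, M.second ω), M.table x ω, M.assignments n ω), M.noises n ω)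
      = M.data x ω := by
  funext i
  rw [dataOf]
  simp only [tableEntry_table]
  rfl

theorem measurable_latents (M : Model h S P) (x : Fin n → S) :
    Measurable fun ω => ((M.first ω, M.second ω), M.table x ω, M.assignments n ω) :=
  M.measurable_hyper.prodMk ((M.measurable_table x).prodMk (M.measurable_assignments n))

theorem measurable_urnKriging_latents (x : Fin n → S) (p : Fin m → S) :
    Measurable fun c : (FirstLayer d × SecondLayer d) × (Fin n → Fin n → ℝ) × (Fin n → ℕ) =>
      urnKriging c.1.2 x c.2.1 c.2.2 p := by
  have h := (measurable_urnKriging x p).comp (by fun_prop : Measurable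
    fun c : (FirstLayer d × SecondLayer d) × (Fin n → Fin n → ℝ) × (Fin n → ℕ) =>
      (c.1.2, c.2.1, c.2.2))
  exact h

theorem measurable_gpMixture_latents (x : Fin n → S) (p : S) :
    Measurable fun c : (FirstLayer d × SecondLayer d) × (Fin n → Fin n → ℝ) × (Fin n → ℕ) =>
      gpMixture c.1.2 x c.2.1 c.2.2 p := by
  have h := (measurable_gpMixture x p).comp (by fun_prop : Measurable
    fun c : (FirstLayer d × SecondLayer d) × (Fin n → Fin n → ℝ) × (Fin n → ℕ) =>
      (c.1.2, c.2.1, c.2.2))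
  exact h

theorem measurable_urnKriging_surfaces (x : Fin n → S) (p : Fin m → S) :
    Measurable fun c : (Fin n → Fin n → ℝ) × (Fin n → ℕ) × SecondLayer d =>
      urnKriging c.2.2 x c.1 c.2.1 p := by
  have h := (measurable_urnKriging x p).comp (by fun_prop : Measurable
    fun c : (Fin n → Fin n → ℝ) × (Fin n → ℕ) × SecondLayer d => (c.2.2, c.1, c.2.1))
  exact h

theorem measurable_gpMixture_surfaces (x : Fin n → S) (p : S) :
    Measurable fun c : (Fin n → Fin n → ℝ) × (Fin n → ℕ) × SecondLayer d =>
      gpMixture c.2.2 x c.1 c.2.1 p := by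
  have h := (measurable_gpMixture x p).comp (by fun_prop : Measurable
    fun c : (Fin n → Fin n → ℝ) × (Fin n → ℕ) × SecondLayer d => (c.2.2, c.1, c.2.1))
  exact h

/-- The law of the next surface given the parameters, the realized surfaces and the data. -/
theorem condLaw_urnKriging_data (M : Model h S P) {x : Fin n → S} (hx : Function.Injective x)
    (p : Fin m → S) :
    CondLaw P (fun ω => (((M.first ω, M.second ω), M.table x ω, M.assignments n ω), M.data x ω))
      (fun ω => (M.assignment n ω, M.latentVec n p ω))
      fun c => urnKriging c.1.1.2 x c.1.2.1 c.1.2.2 p := by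
  have hν : Measurable fun c : (FirstLayer d × SecondLayer d) × (Fin n → Fin n → ℝ) ×
      (Fin n → ℕ) => Measure.pi fun _ : Fin n => gaussianReal 0 c.1.1.2.toNNReal :=
    measurable_pi_gaussianReal (by fun_prop) n
  let B : (FirstLayer d × SecondLayer d) × (Fin n → Fin n → ℝ) × (Fin n → ℕ) →
    Measure (ℕ × EuclideanSpace ℝ (Fin m)) := fun c => urnKriging c.1.2 x c.2.1 c.2.2 p
  have hB : Measurable B := measurable_urnKriging_latents x p
  have lawB : CondLaw P (fun ω => ((M.first ω, M.second ω), M.table x ω, M.assignments n ω))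
    (fun ω => (M.assignment n ω, M.latentVec n p ω)) B := M.condLaw_urnKriging hx p
  have h1 := lawB.add_noise (M.measurable_latents x) hB hν (M.condLaw_noises_latent x p)
  let κ : ((FirstLayer d × SecondLayer d) × (Fin n → Fin n → ℝ) × (Fin n → ℕ)) × (Fin n → S × ℝ) →
    Measure (ℕ × EuclideanSpace ℝ (Fin m)) := fun c => B c.1
  let g : ((FirstLayer d × SecondLayer d) × (Fin n → Fin n → ℝ) × (Fin n → ℕ)) × (Fin n → ℝ) →
      ((FirstLayer d × SecondLayer d) × (Fin n → Fin n → ℝ) × (Fin n → ℕ)) × (Fin n → S × ℝ) :=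
    fun c => (c.1, dataOf x c)
  have hg : Measurable g := measurable_fst.prodMk (measurable_dataOf x)
  have h2 : CondLaw P (fun ω => g (((M.first ω, M.second ω), M.table x ω, M.assignments n ω),
    M.noises n ω)) (fun ω => (M.assignment n ω, M.latentVec n p ω)) κ :=
    h1.comp_left (g := g) (κ := κ) hg
  simp only [g, dataOf_eq] at h2
  exact h2

theorem condLaw_gpMixture_data (M : Model h S P) {x : Fin n → S} (hx : Function.Injective x)
    (p : S) :
    CondLaw P (fun ω => (((M.first ω, M.second ω), M.table x ω, M.assignments n ω), M.data x ω))
      (M.latent n p) fun c => gpMixture c.1.1.2 x c.1.2.1 c.1.2.2 p := by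
  have hX : Measurable fun ω =>
      (((M.first ω, M.second ω), M.table x ω, M.assignments n ω), M.data x ω) :=
    (M.measurable_latents x).prodMk (M.measurable_data x)
  have h1 := (M.condLaw_urnKriging_data hx fun _ : Fin 1 => p).map
    (φ := fun c => c.2.2 0) (by fun_prop)
  refine CondLaw.congr h1 hX ?_
  -- The mixture is the image of the urn law only at admissible hyperparameters; this holds almost
  -- surely under the prior and is transferred to the full conditioning variable.
  have hθ : ∀ᵐ θ ∂P.map fun ω => (M.first ω, M.second ω), θ.2.Admissible := by
    rw [M.law_hyper]
    exact h.ae_admissible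
  rw [show (fun ω => (M.first ω, M.second ω)) = (fun c : ((FirstLayer d × SecondLayer d) ×
    (Fin n → Fin n → ℝ) × (Fin n → ℕ)) × (Fin n → S × ℝ) => c.1.1) ∘ fun ω =>
      (((M.first ω, M.second ω), M.table x ω, M.assignments n ω), M.data x ω) from rfl,
    ← Measure.map_map (by fun_prop) hX] at hθ
  filter_upwards [ae_of_ae_map (by fun_prop) hθ] with c hc
  exact (gpMixture_eq_map hc hx c.1.2.1 c.1.2.2 p).symm

end Model

end InfiniteGP

/-! ### Assembly of the proposition -/

open InfiniteGP in
theorem proposition1 {d n : ℕ} (h : HyperPrior d) (S : Set (EuclideanSpace ℝ (Fin d)))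
    {Ω : Type*} [MeasurableSpace Ω] (P : Measure Ω) [IsProbabilityMeasure P]
    (M : Model h S P) (x : Fin n → S) (hx : Function.Injective x) :
    -- pointwise at an arbitrary new point `p` in the role of `x_{n+1}`
    (∀ p : S,
      -- term A
      (∀ᵐ c ∂(P.map fun ω => (M.first ω, M.latent n p ω)),
        condDistrib (M.obs n p) (fun ω => (M.first ω, M.latent n p ω)) P c
          = gaussianReal (inner ℝ p.1 c.1.1 + c.2) c.1.2.toNNReal) ∧
      -- term B
      (∀ᵐ c ∂(P.map fun ω => (M.table x ω, M.assignments n ω, M.second ω)),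
        condDistrib (M.latent n p) (fun ω => (M.table x ω, M.assignments n ω, M.second ω)) P c
          = gpMixture c.2.2 x c.1 c.2.1 p) ∧
      -- the predictive distribution as the integral of A against the posterior of `(Θ⁽¹⁾, ξ)`
      (∀ᵐ H ∂(P.map (M.data x)),
        condDistrib (M.obs n p) (M.data x) P H
          = (condDistrib (fun ω => (M.first ω, M.latent n p ω)) (M.data x) P H).bind
              fun c => gaussianReal (inner ℝ p.1 c.1.1 + c.2) c.1.2.toNNReal) ∧
      -- the posterior of `(Θ⁽¹⁾, ξ)` as the integral of B against C
      (∀ᵐ H ∂(P.map (M.data x)),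
        condDistrib (fun ω => (M.first ω, M.latent n p ω)) (M.data x) P H
          = (condDistrib
              (fun ω => ((M.first ω, M.second ω), M.table x ω, M.assignments n ω))
              (M.data x) P H).bind
              fun c => (gpMixture c.1.2 x c.2.1 c.2.2 p).map fun u => (c.1.1, u)) ∧
      -- the predictive distribution as the integral of A and B against C
      (∀ᵐ H ∂(P.map (M.data x)),
        condDistrib (M.obs n p) (M.data x) P H
          = (condDistrib
              (fun ω => ((M.first ω, M.second ω), M.table x ω, M.assignments n ω))
              (M.data x) P H).bind
              fun c => (gpMixture c.1.2 x c.2.1 c.2.2 p).bind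
                fun u => gaussianReal (inner ℝ p.1 c.1.1.1 + u) c.1.1.2.toNNReal)) ∧
    -- the same for the new surface as a process over `S`: its label and finite-dimensional laws
    (∀ (m : ℕ) (p : Fin m → S),
      (∀ᵐ c ∂(P.map fun ω => (M.table x ω, M.assignments n ω, M.second ω)),
        condDistrib
            (fun ω => (M.assignment n ω,
              (WithLp.toLp 2 fun a => M.latent n (p a) ω : EuclideanSpace ℝ (Fin m))))
            (fun ω => (M.table x ω, M.assignments n ω, M.second ω)) P c
          = urnKriging c.2.2 x c.1 c.2.1 p) ∧
      (∀ᵐ H ∂(P.map (M.data x)),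
        condDistrib
            (fun ω => (M.first ω, M.assignment n ω,
              (WithLp.toLp 2 fun a => M.latent n (p a) ω : EuclideanSpace ℝ (Fin m))))
            (M.data x) P H
          = (condDistrib
              (fun ω => ((M.first ω, M.second ω), M.table x ω, M.assignments n ω))
              (M.data x) P H).bind
              fun c => (urnKriging c.1.2 x c.2.1 c.2.2 p).map fun u => (c.1.1, u))) := by
  have hD := M.measurable_data x
  have hT : Measurable fun ω => (M.table x ω, M.assignments n ω, M.second ω) :=
    (M.measurable_table x).prodMk ((M.measurable_assignments n).prodMk M.measurable_second)
  have hW := M.measurable_latents x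
  let order : ((FirstLayer d × SecondLayer d) × (Fin n → Fin n → ℝ) × (Fin n → ℕ)) ×
      (Fin n → S × ℝ) → (Fin n → Fin n → ℝ) × (Fin n → ℕ) × SecondLayer d :=
    fun c => (c.1.2.1, c.1.2.2, c.1.1.2)
  have horder : Measurable order := by fun_prop
  refine ⟨fun p => ?_, fun m p => ?_⟩
  · have hX : Measurable fun ω => (M.first ω, M.latent n p ω) :=
      M.measurable_first.prodMk (M.measurable_latent n p)
    have hY := M.measurable_obs n p
    have hL := M.measurable_latent n p
    let A : FirstLayer d × ℝ → Measure ℝ := fun c =>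
      gaussianReal (inner ℝ p.1 c.1.1 + c.2) c.1.2.toNNReal
    let B : (FirstLayer d × SecondLayer d) × (Fin n → Fin n → ℝ) × (Fin n → ℕ) → Measure ℝ :=
      fun c => gpMixture c.1.2 x c.2.1 c.2.2 p
    let B' : (Fin n → Fin n → ℝ) × (Fin n → ℕ) × SecondLayer d → Measure ℝ :=
      fun c => gpMixture c.2.2 x c.1 c.2.1 p
    have hA : Measurable A := measurable_gaussianReal (by fun_prop) (by fun_prop)
    have hB : Measurable B := Model.measurable_gpMixture_latents x p
    have hB' : Measurable B' := Model.measurable_gpMixture_surfaces x p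
    have lawA : CondLaw P (fun ω => ((M.first ω, M.latent n p ω), M.data x ω)) (M.obs n p)
      fun c => A c.1 := M.condLaw_obs x p
    have lawB : CondLaw P (fun ω => (((M.first ω, M.second ω), M.table x ω, M.assignments n ω),
      M.data x ω)) (M.latent n p) fun c => B c.1 := M.condLaw_gpMixture_data hx p
    have lawA' := lawA.comp_left (g := Prod.fst) measurable_fst
    have lawB' := lawB.comp_left (g := Prod.fst) measurable_fst
    have lawB'' := lawB.comp_left (g := order) (κ := B') horder
    -- The same lemma is used at two levels: here the state is Θ⁽¹⁾ with the latent value and only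
    -- the new observation is kept; below, the state is all hyperparameters and latent variables,
    -- and Θ⁽¹⁾ with the new value is kept.
    have predictive := lawA.posterior hX hD hY hA measurable_snd
    have posterior := lawB.posterior hW hD hL hB (φ := fun c => (c.1.1.1, c.2)) (by fun_prop)
    have compose := lawB'.bind_posterior hW hD hB (φ := fun c => (c.1.1.1, c.2)) (by fun_prop) hA
    simp only [Measure.map_id'] at predictive
    refine ⟨lawA'.condDistrib_eq hX hY hA, lawB''.condDistrib_eq hT hL hB', predictive, posterior,
      ?_⟩
    filter_upwards [predictive, posterior, compose] with H h1 h2 h3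
    rw [h1, h2, h3]
  · let B : (FirstLayer d × SecondLayer d) × (Fin n → Fin n → ℝ) × (Fin n → ℕ) →
      Measure (ℕ × EuclideanSpace ℝ (Fin m)) := fun c => urnKriging c.1.2 x c.2.1 c.2.2 p
    let B' : (Fin n → Fin n → ℝ) × (Fin n → ℕ) × SecondLayer d →
      Measure (ℕ × EuclideanSpace ℝ (Fin m)) := fun c => urnKriging c.2.2 x c.1 c.2.1 p
    have hB : Measurable B := Model.measurable_urnKriging_latents x p
    have hB' : Measurable B' := Model.measurable_urnKriging_surfaces x p
    have hL : Measurable fun ω => (M.assignment n ω, M.latentVec n p ω) :=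
      (M.measurable_assignment n).prodMk (M.measurable_latentVec n p)
    have lawB : CondLaw P (fun ω => (((M.first ω, M.second ω), M.table x ω, M.assignments n ω),
      M.data x ω)) (fun ω => (M.assignment n ω, M.latentVec n p ω)) fun c => B c.1 :=
      M.condLaw_urnKriging_data hx p
    have lawB' := lawB.comp_left (g := order) (κ := B') horder
    exact ⟨lawB'.condDistrib_eq hT hL hB',
      lawB.posterior hW hD hL hB (φ := fun c => (c.1.1.1, c.2)) (by fun_prop)⟩

end
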